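/- Let $\varphi=\frac12(1+\sqrt5)$ and let $R\subset\mathbb R^3$ be the set of the 30 vectors obtained by cyclic permutations from $(\pm2,0,0)$ and $(\pm\varphi,\pm(\varphi-1),\pm1)$ (independent signs). Let $R_+$ be the set of the 15 vectors of $R$ with positive inner product with $(3,2\varphi,1)$, let $\sigma_v$ be the reflection $x\mapsto x-2\frac{\langle x,v\rangle}{\langle v,v\rangle}v$, and let $H_3$ be the group (of order 120) generated by the $\sigma_v$, $v\in R$. Its conjugacy classes are $C_1=\{I\}$, $C_2=\{-I\}$, the class $C_3$ of the reflections, the classes $C_4,C_5,C_6,C_7$ of the rotations by $\pi$, $2\pi/3$, $4\pi/5$, $2\pi/5$, and $C_8=-C_5$, $C_9=-C_7$, $C_{10}=-C_6$. Let $\mathcal P=\mathbb R[x_1,x_2,x_3]$. For a real finite-dimensional irreducible representation $\tau$ of $H_3$ on $V$, let $w\in H_3$ act on $\mathcal P_\tau=\mathcal P\otimes V$ by $w(p(x)\otimes u)=p(xw)\otimes\tau(w)u$ ($x$ a row vector), and for $\kappa\in\mathbb R$ let $$\mathcal D_i(p\otimes u)=\frac{\partial p}{\partial x_i}\otimes u+\kappa\sum_{v\in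 R_+}\frac{p(x)-p(x\sigma_v)}{\langle x,v\rangle}\,v_i\otimes\tau(\sigma_v)u,\qquad i=1,2,3 .$$ A singular polynomial for $\kappa$ is a nonconstant $p\in\mathcal P_\tau$ (one that is not in $1\otimes V$) with $\mathcal D_ip=0$ for all $i$; $\kappa$ is a singular value of $\tau$ if there is one. A polynomial $p\in\mathcal P_\tau$ is of isotype $\rho$ if $H_3$ acts on $\operatorname{span}\{wp:w\in H_3\}$ by a representation isomorphic to $\rho$. Given an $H_3$-invariant inner product $\beta$ on $V$, a Gaussian form for $\kappa$ is a symmetric bilinear form on $\mathcal P_\tau$ with $\langle wf,wg\rangle_\kappa=\langle f,g\rangle_\kappa$, $\langle\mathcal D_if,g\rangle_\kappa=\langle f,(x_i-\mathcal D_i)g\rangle_\kappa$ and $\langle1\otimes u,1\otimes u'\rangle_\kappa=\beta(u,u')$. Then the following hold. (a) Up to isomorphism $H_3$ has exactly ten real finite-dimensional irreducible representations $\tau_1,\dots,\tau_{10}$. Their characters take on $C_1,\dots,C_{10}$ the values - $\tau_1$: $1,1,1,1,1,1,1,1,1,1$; - $\tau_2$: $1,-1,-1,1,1,1,1,-1,-1,-1$;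 - $\tau_3$: $3,-3,1,-1,0,1-\varphi,\varphi,0,-\varphi,\varphi-1$; - $\tau_4$: $3,3,-1,-1,0,1-\varphi,\varphi,0,\varphi,1-\varphi$; - $\tau_5$: $3,-3,1,-1,0,\varphi,1-\varphi,0,\varphi-1,-\varphi$; - $\tau_6$: $3,3,-1,-1,0,\varphi,1-\varphi,0,1-\varphi,\varphi$; - $\tau_7$: $4,4,0,0,1,-1,-1,1,-1,-1$; - $\tau_8$: $4,-4,0,0,1,-1,-1,-1,1,1$; - $\tau_9$: $5,5,1,1,-1,0,0,-1,0,0$; - $\tau_{10}$: $5,-5,-1,1,-1,0,0,1,0,0$. (b) For each $\tau$, each invariant inner product $\beta$ on $V$ and each $\kappa\in\mathbb R$ there is exactly one Gaussian form. (c) Let $\kappa_-$ and $\kappa_+$ denote the negative and the positive singular value of smallest absolute value. For each $\tau_i$ they are given by the following table; in brackets stands the isotype of some singular polynomial for that value, and "none" means that there is no singular value of that sign. - $\tau_1$: $\kappa_-=-\frac1{10}\;[\tau_3]$, $\kappa_+$: none. - $\tau_2$: $\kappa_-$: none, $\kappa_+=\frac1{10}\;[\tau_4]$. - $\tau_3$: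 $\kappa_-=-\frac1{10}\;[\tau_4]$, $\kappa_+=\frac1{10}\;[\tau_1]$. - $\tau_4$: $\kappa_-=-\frac1{10}\;[\tau_2]$, $\kappa_+=\frac1{10}\;[\tau_3]$. - $\tau_5$: $\kappa_-=-\frac15\;[\tau_7]$, $\kappa_+=\frac3{10}\;[\tau_1]$. - $\tau_6$: $\kappa_-=-\frac3{10}\;[\tau_2]$, $\kappa_+=\frac15\;[\tau_8]$. - $\tau_7$: $\kappa_-=-\frac15\;[\tau_2]$, $\kappa_+=\frac15\;[\tau_5]$. - $\tau_8$: $\kappa_-=-\frac15\;[\tau_6]$, $\kappa_+=\frac15\;[\tau_1]$. - $\tau_9$: $\kappa_-=-\frac16\;[\tau_{10}]$, $\kappa_+=\frac16\;[\tau_1]$. - $\tau_{10}$: $\kappa_-=-\frac16\;[\tau_2]$, $\kappa_+=\frac16\;[\tau_9]$. (d) For each $\tau_i$ and each invariant inner product $\beta$, the set of the $\kappa\in\mathbb R$ for which the Gaussian form is positive definite is the open interval $(\kappa_-,\kappa_+)$, where $\kappa_-=-\infty$ or $\kappa_+=\infty$ if there is none. In particular this interval is not symmetric about $0$ for $\tau_5$,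 where it is $(-\frac15,\frac3{10})$, and for $\tau_6$, where it is $(-\frac3{10},\frac15)$. -/

import Mathlib

open scoped TensorProduct
open MvPolynomial

namespace Icosahedral

noncomputable section

/-! ### The root system and the group -/

/-- The golden ratio `(1 + √5) / 2`. -/
abbrev gold : ℝ := (1 + Real.sqrt 5) / 2

/-- The cyclic permutations of `(a, b, c)`. -/
def cyclicPerms (a b c : ℝ) : Finset (Fin 3 → ℝ) := {![a, b, c], ![c, a, b], ![b, c, a]}

/-- The root system of type `H₃`: the cyclic permutations of `(±2, 0, 0)` and of
`(±φ, ±(φ - 1), ±1)`, with independent signs, where `φ` is the golden ratio. -/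
def roots : Finset (Fin 3 → ℝ) :=
  (({1, -1} : Finset ℝ) ×ˢ ({1, -1} : Finset ℝ) ×ˢ ({1, -1} : Finset ℝ)).biUnion fun s =>
    cyclicPerms (s.1 * 2) 0 0 ∪ cyclicPerms (s.1 * gold) (s.2.1 * (gold - 1)) s.2.2

/-- The positive roots: those with positive inner product with `(3, 2φ, 1)`. -/
def posRoots : Finset (Fin 3 → ℝ) :=
  roots.filter fun v => 0 < v ⬝ᵥ ![3, 2 * gold, 1]

/-- The matrix of the reflection `x ↦ x - 2 ⟨x, v⟩ / ⟨v, v⟩ v`. -/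
def reflMatrix (v : Fin 3 → ℝ) : Matrix (Fin 3) (Fin 3) ℝ :=
  1 - (2 / (v ⬝ᵥ v)) • Matrix.vecMulVec v v

theorem reflMatrix_mul_self (v : Fin 3 → ℝ) : reflMatrix v * reflMatrix v = 1 := by
  by_cases h : v ⬝ᵥ v = 0
  · simp [reflMatrix, h]
  · have h2 : Matrix.vecMulVec v v * Matrix.vecMulVec v v
        = (v ⬝ᵥ v) • Matrix.vecMulVec v v := by
      rw [Matrix.vecMulVec_mul_vecMulVec]
      ext i j
      simp [Matrix.vecMulVec_apply]
      ring
    simp only [reflMatrix, sub_mul, mul_sub, one_mul, mul_one, smul_mul_assoc,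
      mul_smul_comm, h2, smul_smul]
    rw [div_mul_cancel₀ _ h, smul_sub, smul_smul, mul_comm, mul_smul, two_smul]
    abel

/-- The reflection `σ_v` as an invertible matrix. -/
def refl (v : Fin 3 → ℝ) : GL (Fin 3) ℝ :=
  ⟨reflMatrix v, reflMatrix v, reflMatrix_mul_self v, reflMatrix_mul_self v⟩

/-- The icosahedral group, generated by the reflections in the roots. -/
def H3 : Subgroup (GL (Fin 3) ℝ) := Subgroup.closure (refl '' (roots : Set (Fin 3 → ℝ)))

/-- The reflection in a positive root, as an element of the group. -/
def sigma (v : posRoots) : H3 :=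
  ⟨refl v, Subgroup.subset_closure ⟨v, (Finset.mem_filter.mp v.2).1, rfl⟩⟩

/-! ### The character table -/

/-- The determinants of the elements of the conjugacy classes `C₁, …, C₁₀`. -/
def classDet : Fin 10 → ℝ := ![1, -1, -1, 1, 1, 1, 1, -1, -1, -1]

/-- The traces of the elements of the conjugacy classes `C₁, …, C₁₀`. -/
def classTrace : Fin 10 → ℝ :=
  ![3, -3, 1, -1, 0, 1 - gold, gold, 0, -gold, gold - 1]

/-- The ten conjugacy classes (`conjClass 0` is `C₁`, and so on), which are separated by
determinant and trace: `C₁ = {I}`, `C₂ = {-I}`, `C₃` the reflections, `C₄`, `C₅`, `C₆`, `C₇` the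
rotations by `π`, `2π/3`, `4π/5`, `2π/5`, and `C₈ = -C₅`, `C₉ = -C₇`, `C₁₀ = -C₆`. -/
def conjClass (s : Fin 10) : Set H3 :=
  {w | Matrix.det (w : GL (Fin 3) ℝ).1 = classDet s ∧
    Matrix.trace (w : GL (Fin 3) ℝ).1 = classTrace s}

/-- Labels for the ten irreducible representations. -/
inductive Irrep
  | τ₁ | τ₂ | τ₃ | τ₄ | τ₅ | τ₆ | τ₇ | τ₈ | τ₉ | τ₁₀

/-- The character table: the values of each irreducible character on `C₁, …, C₁₀`. -/
def Irrep.chi : Irrep → Fin 10 → ℝ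
  | .τ₁ => ![1, 1, 1, 1, 1, 1, 1, 1, 1, 1]
  | .τ₂ => ![1, -1, -1, 1, 1, 1, 1, -1, -1, -1]
  | .τ₃ => ![3, -3, 1, -1, 0, 1 - gold, gold, 0, -gold, gold - 1]
  | .τ₄ => ![3, 3, -1, -1, 0, 1 - gold, gold, 0, gold, 1 - gold]
  | .τ₅ => ![3, -3, 1, -1, 0, gold, 1 - gold, 0, gold - 1, -gold]
  | .τ₆ => ![3, 3, -1, -1, 0, gold, 1 - gold, 0, 1 - gold, gold]
  | .τ₇ => ![4, 4, 0, 0, 1, -1, -1, 1, -1, -1]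
  | .τ₈ => ![4, -4, 0, 0, 1, -1, -1, -1, 1, 1]
  | .τ₉ => ![5, 5, 1, 1, -1, 0, 0, -1, 0, 0]
  | .τ₁₀ => ![5, -5, -1, 1, -1, 0, 0, 1, 0, 0]

/-- The representation `ρ` has the character labelled `i`. -/
def HasCharacter {V : Type*} [AddCommMonoid V] [Module ℝ V]
    (ρ : Representation ℝ H3 V) (i : Irrep) : Prop :=
  ∀ s : Fin 10, ∀ w ∈ conjClass s, LinearMap.trace ℝ V (ρ w) = i.chi s

/-- The span of the orbit of `p`, as a subrepresentation. -/
def orbitSpan {V : Type*} [AddCommMonoid V] [Module ℝ V] (ρ : Representation ℝ H3 V) (p : V) :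
    Subrepresentation ρ where
  toSubmodule := Submodule.span ℝ (Set.range fun w => ρ w p)
  apply_mem_toSubmodule g v hv := by
    have h : Submodule.span ℝ (Set.range fun w => ρ w p)
        ≤ (Submodule.span ℝ (Set.range fun w => ρ w p)).comap (ρ g) := by
      rw [Submodule.span_le]
      rintro _ ⟨w, rfl⟩
      refine Submodule.subset_span ⟨g * w, ?_⟩
      simp
    exact h hv

/-! ### Polynomials -/

/-- Polynomials in `x₁, x₂, x₃`. -/
abbrev Poly : Type := MvPolynomial (Fin 3) ℝ

/-- The substitution `p(x) ↦ p(x w)`, where `x` is a row vector. -/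
def subst (w : Matrix (Fin 3) (Fin 3) ℝ) : Poly →ₐ[ℝ] Poly :=
  aeval fun j => ∑ i, C (w i j) * X i

theorem subst_one : subst 1 = AlgHom.id ℝ Poly := by
  apply MvPolynomial.algHom_ext
  intro j
  simp [subst, Matrix.one_apply]

theorem subst_mul (w w' : Matrix (Fin 3) (Fin 3) ℝ) :
    subst (w * w') = (subst w).comp (subst w') := by
  apply MvPolynomial.algHom_ext
  intro j
  simp only [subst, aeval_X, AlgHom.comp_apply, map_sum, map_mul, Matrix.mul_apply, algHom_C,
    MvPolynomial.algebraMap_eq, Finset.sum_mul, Finset.mul_sum]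
  rw [Finset.sum_comm]
  refine Finset.sum_congr rfl fun i _ => Finset.sum_congr rfl fun k _ => ?_
  ring

/-- The representation `w p(x) = p(x w)` of the group on the polynomials. -/
def polyRep : Representation ℝ H3 Poly where
  toFun w := (subst (w : GL (Fin 3) ℝ).1).toLinearMap
  map_one' := by
    simp only [OneMemClass.coe_one, Units.val_one, subst_one]
    rfl
  map_mul' w w' := by
    simp only [Subgroup.coe_mul, Units.val_mul, subst_mul]
    rfl

/-- The linear form `⟨x, v⟩`. -/
def linForm (v : Fin 3 → ℝ) : Poly := ∑ i, C (v i) * X i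

theorem linForm_dvd (v : Fin 3 → ℝ) (p : Poly) :
    linForm v ∣ p - subst (reflMatrix v) p := by
  induction p using MvPolynomial.induction_on with
  | C a => simp [subst]
  | add p q hp hq =>
    rw [map_add, add_sub_add_comm]
    exact dvd_add hp hq
  | mul_X p j hp =>
    have hX : linForm v ∣ X j - subst (reflMatrix v) (X j) := by
      refine ⟨C (2 / (v ⬝ᵥ v) * v j), ?_⟩
      have h0 : (∑ i, C ((1 : Matrix (Fin 3) (Fin 3) ℝ) i j) * X i : Poly) = X j := by
        simp [Matrix.one_apply]
      simp only [subst, aeval_X, reflMatrix, Matrix.sub_apply, Matrix.smul_apply,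
        Matrix.vecMulVec_apply, smul_eq_mul, map_sub, sub_mul, Finset.sum_sub_distrib, h0,
        sub_sub_cancel, linForm, Finset.sum_mul]
      refine Finset.sum_congr rfl fun i _ => ?_
      simp only [map_mul]
      ring
    have h : p * X j - subst (reflMatrix v) (p * X j)
        = (p - subst (reflMatrix v) p) * X j
          + subst (reflMatrix v) p * (X j - subst (reflMatrix v) (X j)) := by
      rw [map_mul]
      ring
    rw [h]
    exact dvd_add (Dvd.dvd.mul_right hp _) (Dvd.dvd.mul_left hX _)

open Classical in
/-- The divided difference `(p(x) - p(x σ_v)) / ⟨x, v⟩` (for nonzero `v`), a polynomial. -/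
def divDiff (v : Fin 3 → ℝ) : Poly →ₗ[ℝ] Poly :=
  if hv : linForm v = 0 then 0
  else
    { toFun := fun p => (linForm_dvd v p).choose
      map_add' := fun p q => by
        apply mul_left_cancel₀ hv
        rw [mul_add, ← (linForm_dvd v _).choose_spec, ← (linForm_dvd v _).choose_spec,
          ← (linForm_dvd v _).choose_spec, map_add]
        ring
      map_smul' := fun c p => by
        apply mul_left_cancel₀ hv
        rw [RingHom.id_apply, mul_smul_comm, ← (linForm_dvd v _).choose_spec,
          ← (linForm_dvd v _).choose_spec, map_smul, smul_sub] }

theorem linForm_ne_zero {v : Fin 3 → ℝ} (hv : v ≠ 0) : linForm v ≠ 0 := by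
  intro h
  apply hv
  ext j
  have := congrArg (aeval (Pi.single j (1 : ℝ))) h
  simpa [linForm, Pi.single_apply] using this

/-- The defining property of the divided difference. -/
theorem linForm_mul_divDiff {v : Fin 3 → ℝ} (hv : v ≠ 0) (p : Poly) :
    linForm v * divDiff v p = p - subst (reflMatrix v) p := by
  rw [divDiff, dif_neg (linForm_ne_zero hv)]
  exact (linForm_dvd v p).choose_spec.symm

/-! ### Vector-valued polynomials and Dunkl operators -/

section Dunkl

variable {V : Type*} [AddCommGroup V] [Module ℝ V] (τ : Representation ℝ H3 V)

/-- The action `w (p(x) ⊗ u) = p(x w) ⊗ τ(w) u` on polynomials with values in `V`. -/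
def vecRep : Representation ℝ H3 (Poly ⊗[ℝ] V) := polyRep.tprod τ

/-- The Dunkl operators
`𝒟ᵢ (p ⊗ u) = ∂ᵢ p ⊗ u + κ ∑_v (p(x) - p(x σ_v)) / ⟨x, v⟩ vᵢ ⊗ τ(σ_v) u`. -/
def dunkl (κ : ℝ) (i : Fin 3) : Poly ⊗[ℝ] V →ₗ[ℝ] Poly ⊗[ℝ] V :=
  TensorProduct.map (pderiv i : Derivation ℝ Poly Poly).toLinearMap LinearMap.id
    + κ • ∑ v : posRoots,
        TensorProduct.map ((v : Fin 3 → ℝ) i • divDiff v) (τ (sigma v))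

/-- Multiplication by the coordinate `xᵢ`. -/
def mulX (V : Type*) [AddCommGroup V] [Module ℝ V] (i : Fin 3) :
    Poly ⊗[ℝ] V →ₗ[ℝ] Poly ⊗[ℝ] V :=
  TensorProduct.map (LinearMap.mulLeft ℝ (X i)) LinearMap.id

/-- The constant polynomial with value `u`. -/
def const (V : Type*) [AddCommGroup V] [Module ℝ V] : V →ₗ[ℝ] Poly ⊗[ℝ] V :=
  TensorProduct.mk ℝ Poly V 1

/-- `p` is a singular polynomial for `κ`: it is nonconstant and annihilated by all the Dunkl
operators. -/
def IsSingularPoly (κ : ℝ) (p : Poly ⊗[ℝ] V) : Prop :=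
  p ∉ LinearMap.range (const V) ∧ ∀ i, dunkl τ κ i p = 0

/-- `κ` is a singular value: a singular polynomial for `κ` exists. -/
def IsSingularValue (κ : ℝ) : Prop := ∃ p, IsSingularPoly τ κ p

/-- `p` is of isotype `j`: the group acts on the span of the orbit of `p` by the irreducible
representation labelled `j`. -/
def HasIsotype (p : Poly ⊗[ℝ] V) (j : Irrep) : Prop :=
  HasCharacter (orbitSpan (vecRep τ) p).toRepresentation j

/-- `κ` is the negative singular value of smallest absolute value, and it has a singular
polynomial of isotype `j`. -/
def IsSmallestNegative (κ : ℝ) (j : Irrep) : Prop :=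
  IsGreatest {k | k < 0 ∧ IsSingularValue τ k} κ ∧ ∃ p, IsSingularPoly τ κ p ∧ HasIsotype τ p j

/-- `κ` is the positive singular value of smallest absolute value, and it has a singular
polynomial of isotype `j`. -/
def IsSmallestPositive (κ : ℝ) (j : Irrep) : Prop :=
  IsLeast {k | 0 < k ∧ IsSingularValue τ k} κ ∧ ∃ p, IsSingularPoly τ κ p ∧ HasIsotype τ p j

/-! ### The Gaussian form -/

/-- `β` is an inner product on `V` for which `τ` is orthogonal. -/
structure IsInvariantInner (β : LinearMap.BilinForm ℝ V) : Prop where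
  symm : ∀ u u', β u u' = β u' u
  pos : ∀ u, u ≠ 0 → 0 < β u u
  inv : ∀ w u u', β (τ w u) (τ w u') = β u u'

/-- `B` is the Gaussian form for the parameter `κ` that extends the inner product `β` on
constants. -/
structure IsGaussianForm (κ : ℝ) (β : LinearMap.BilinForm ℝ V)
    (B : LinearMap.BilinForm ℝ (Poly ⊗[ℝ] V)) : Prop where
  symm : ∀ f g, B f g = B g f
  inv : ∀ w f g, B (vecRep τ w f) (vecRep τ w g) = B f g
  adj : ∀ i f g, B (dunkl τ κ i f) g = B f (mulX V i g - dunkl τ κ i g)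
  extend : ∀ u u', B (const V u) (const V u') = β u u'

/-- The set of the parameters `κ` for which the Gaussian form that extends `β` is positive
definite. -/
def positivitySet (β : LinearMap.BilinForm ℝ V) : Set ℝ :=
  {κ | ∃ B, IsGaussianForm τ κ β B ∧ ∀ f, f ≠ 0 → 0 < B f f}

/-- `I` is the set of parameters for which the Gaussian form is positive definite, whichever
invariant inner product on `V` is used to normalize it. -/
def HasPositivitySet (I : Set ℝ) : Prop :=
  ∀ β, IsInvariantInner τ β → positivitySet τ β = I

end Dunkl

end

end Icosahedral

open Icosahedral

/-! Let c(τ) be the scalar by which the sum of the 15 reflections acts on an irreducible τ, so c(τ)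
= 15 χ(σ)/χ(1) (`Irrep.content`). The operator Σ xᵢ𝒟ᵢ + κ Σ σ_v acts on polynomials of degree n as n
+ κ c(τ) (`euler_homog`). Hence Σ xᵢ𝒟ᵢ acts on the ρ-isotypic part of degree n as the scalar λ = n +
κ (c(τ) - c(ρ)) (`sum_mulX_dunkl`).

Because the 𝒟ᵢ commute, there is a unique contravariant form C, for which 𝒟ᵢ is adjoint to xᵢ. The
automorphism exp(½ Σ 𝒟ᵢ²) (`heat`) carries it to the Gaussian form, so both exist uniquely and are
positive definite for the same κ. Adjointness turns the Euler identity into λ C(q, q) = Σ C(𝒟ᵢ q, 𝒟ᵢ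
q) (`IsContravariant.smul_apply_self`). If λ > 0 for all pairs (n, ρ) that occur with n ≥ 1,
induction on the degree gives positivity (`mem_positivitySet`); if λ ≤ 0 for one of them, positivity
fails (`notMem_positivitySet`). A singular polynomial forces some λ = 0
(`IsSingularValue.exists_occurs`), and λ = 0 produces one as soon as the λ of lower degree are
positive (`exists_isSingularPoly`).

Each λ is affine in κ and positive at κ = 0, so only its first zero on either side of 0 matters.
Which ρ occur in degree n is bounded from above by the character of a tensor power
(`tensorMult_ne_zero`) and from below by a character sum weighted with powers of a matrix entry
(`occurs_of_powerMult`). From degree 4 on the size of the contents alone suffices, so a finite check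
remains (`isExtremal_table`).

Group, classes and characters are computed in ℤ[φ], where equality is decidable, with doubled
matrices to avoid denominators; ℤ[φ] embeds in ℝ, which transfers the results. -/

namespace Icosahedral

/-! ### The roots and the 120 group elements over ℤ[φ]. -/

/-- The ring `ℤ[φ]` of golden integers, with `⟨a, b⟩` standing for `a + b φ`. -/
abbrev GoldInt : Type := QuadraticAlgebra ℤ 1 1

/-- Square matrices of golden integers. -/
abbrev GoldMat : Type := Matrix (Fin 3) (Fin 3) GoldInt

/-- Representatives of the roots up to sign, over the golden integers. -/
def rootZ : Fin 15 → Fin 3 → GoldInt :=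
  ![![⟨2, 0⟩, 0, 0], ![0, ⟨2, 0⟩, 0], ![0, 0, ⟨2, 0⟩],
    ![⟨0, 1⟩, ⟨-1, 1⟩, ⟨1, 0⟩], ![⟨1, 0⟩, ⟨0, 1⟩, ⟨-1, 1⟩], ![⟨-1, 1⟩, ⟨1, 0⟩, ⟨0, 1⟩],
    ![⟨0, 1⟩, ⟨-1, 1⟩, ⟨-1, 0⟩], ![⟨-1, 0⟩, ⟨0, 1⟩, ⟨-1, 1⟩], ![⟨-1, 1⟩, ⟨-1, 0⟩, ⟨0, 1⟩],
    ![⟨0, 1⟩, ⟨1, -1⟩, ⟨1, 0⟩], ![⟨1, 0⟩, ⟨0, 1⟩, ⟨1, -1⟩], ![⟨1, -1⟩, ⟨1, 0⟩, ⟨0, 1⟩],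
    ![⟨0, 1⟩, ⟨1, -1⟩, ⟨-1, 0⟩], ![⟨-1, 0⟩, ⟨0, 1⟩, ⟨1, -1⟩], ![⟨-1, 1⟩, ⟨1, 0⟩, ⟨0, -1⟩]]

/-- Twice the matrix of the reflection in a root. -/
def reflZ (a : Fin 15) : GoldMat := 2 - Matrix.vecMulVec (rootZ a) (rootZ a)

/-- Twice the powers of a rotation of order five. -/
def rotZ : Fin 5 → GoldMat :=
  ![!![⟨2, 0⟩, 0, 0; 0, ⟨2, 0⟩, 0; 0, 0, ⟨2, 0⟩],
    !![⟨-1, 1⟩, ⟨1, 0⟩, ⟨0, 1⟩; ⟨-1, 0⟩, ⟨0, 1⟩, ⟨1, -1⟩; ⟨0, -1⟩, ⟨1, -1⟩, ⟨1, 0⟩],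
    !![⟨0, -1⟩, ⟨-1, 1⟩, ⟨1, 0⟩; ⟨1, -1⟩, ⟨1, 0⟩, ⟨0, -1⟩; ⟨-1, 0⟩, ⟨0, -1⟩, ⟨1, -1⟩],
    !![⟨0, -1⟩, ⟨1, -1⟩, ⟨-1, 0⟩; ⟨-1, 1⟩, ⟨1, 0⟩, ⟨0, -1⟩; ⟨1, 0⟩, ⟨0, -1⟩, ⟨1, -1⟩],
    !![⟨-1, 1⟩, ⟨-1, 0⟩, ⟨0, -1⟩; ⟨1, 0⟩, ⟨0, 1⟩, ⟨1, -1⟩; ⟨0, 1⟩, ⟨1, -1⟩, ⟨1, 0⟩]]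

/-- The eight sign vectors. -/
def signZ (s : Fin 8) : Fin 3 → GoldInt := fun i =>
  if s.val.testBit i.val then -1 else 1

/-- The signed cyclic permutation matrices. -/
def monoZ (s : Fin 8) (m : Fin 3) : GoldMat :=
  Matrix.of fun i j => if i = j + m then signZ s i else 0

/-- Twice the elements of the icosahedral group: a power of the rotation of order five times a
signed cyclic permutation matrix. -/
def elemZ (k : Fin 5) (s : Fin 8) (m : Fin 3) : GoldMat :=
  Matrix.of fun i j => rotZ k i (j + m) * signZ s (j + m)

theorem elemZ_eq_mul (k : Fin 5) (s : Fin 8) (m : Fin 3) : elemZ k s m = rotZ k * monoZ s m := by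
  refine Matrix.ext fun i j => ?_
  rw [Matrix.mul_apply]
  simp only [elemZ, monoZ, Matrix.of_apply, mul_ite, mul_zero]
  rw [Finset.sum_ite_eq' Finset.univ (j + m) fun x => rotZ k i x * signZ s x]
  simp

set_option maxRecDepth 100000

/-- The shift by `m` arises from moving the second diagonal sign matrix past the cyclic permutation
of the first factor. -/
theorem signZ_mul_signZ : ∀ s s' m, ∃ s'', ∀ i, signZ s i * signZ s' (i - m) = signZ s'' i := by
  decide +kernel

theorem monoZ_mul_monoZ (s : Fin 8) (m : Fin 3) (s' : Fin 8) (m' : Fin 3) :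
    ∃ s'' m'', monoZ s m * monoZ s' m' = monoZ s'' m'' := by
  obtain ⟨s'', h⟩ := signZ_mul_signZ s s' m
  refine ⟨s'', m' + m, Matrix.ext fun i j => ?_⟩
  have h1 (l : Fin 3) : i = l + m ↔ l = i - m := by rw [eq_comm, eq_sub_iff_add_eq]
  have h2 : j + m' = i - m ↔ i = j + (m' + m) := by rw [eq_comm, sub_eq_iff_eq_add, add_assoc]
  rw [Matrix.mul_apply]
  simp only [monoZ, Matrix.of_apply, h1, ite_mul, zero_mul, Finset.sum_ite_eq', Finset.mem_univ,
    if_true, mul_ite, mul_zero]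
  by_cases hj : j + m' = i - m
  · rw [if_pos hj, if_pos (h2.mp hj), hj, h]
  · rw [if_neg hj, if_neg (mt h2.mpr hj)]

theorem monoZ_eq_mul : ∀ s m, monoZ s m = monoZ s 0 * monoZ 0 m := by
  decide +kernel

/-- Together with `monoZ_mul_monoZ` this makes the list of all `elemZ` stable under left
multiplication by the generators, so it exhausts the group; 75 products suffice because the monomial
factor stays on the right. -/
theorem reflZ_mul_rotZ : ∀ a k, ∃ k' s m, reflZ a * rotZ k = 2 * elemZ k' s m := by
  decide +kernel

/-- This and the next two lemmas give the converse inclusion: every factor of an `elemZ` is a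
product of reflections. -/
theorem rotZ_eq_reflZ_mul : ∀ k, ∃ a b, reflZ a * reflZ b = 2 * rotZ k := by
  decide +kernel

theorem monoZ_eq_reflZ_mul : ∀ m, ∃ a b, reflZ a * reflZ b = 2 * (2 * monoZ 0 m) := by
  decide +kernel

/-- The roots 0, 1, 2 lie on the coordinate axes, so each of their reflections flips one sign. The
alternative `2` is the doubled identity, and the intermediate `s'` appears because every product of
doubled matrices sheds one factor 2. -/
theorem signZ_eq_reflZ_mul : ∀ s, ∃ a b c : Bool, ∃ s',
    (if a then reflZ 0 else 2) * (if b then reflZ 1 else 2) = 2 * (2 * monoZ s' 0) ∧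
    2 * monoZ s' 0 * (if c then reflZ 2 else 2) = 2 * (2 * monoZ s 0) := by
  decide +kernel

theorem rotZ_mul_rotZ : ∀ k k', rotZ k * rotZ k' = 2 * rotZ (k + k') := by
  decide +kernel

/-- A nontrivial power of the rotation has no zero entry, whereas monomial matrices do; this
separates the five cosets of the monomial subgroup. -/
theorem elemZ_eq_zero : ∀ k s m i, elemZ k s m i 0 = 0 → k = 0 := by
  decide +kernel

theorem monoZ_eq_zero : ∀ s m, monoZ s m (m + 1) 0 = 0 := by
  decide +kernel

theorem monoZ_injective : ∀ s m s' m', monoZ s m = monoZ s' m' → s = s' ∧ m = m' := by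
  decide +kernel

theorem two_mul_goldMat_injective {A B : GoldMat} (h : 2 * A = 2 * B) : A = B := by
  refine Matrix.ext fun i j => ?_
  have h1 := congrFun (congrFun h i) j
  rw [two_mul, two_mul, Matrix.add_apply, Matrix.add_apply] at h1
  have h2 := congrArg QuadraticAlgebra.re h1
  have h3 := congrArg QuadraticAlgebra.im h1
  simp only [QuadraticAlgebra.re_add, QuadraticAlgebra.im_add] at h2 h3
  ext <;> omega

theorem elemZ_injective (k : Fin 5) (s : Fin 8) (m : Fin 3) (k' : Fin 5) (s' : Fin 8) (m' : Fin 3)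
    (h : elemZ k s m = elemZ k' s' m') : k = k' ∧ s = s' ∧ m = m' := by
  have h0 : rotZ 0 = 2 := by decide +kernel
  rw [elemZ_eq_mul, elemZ_eq_mul] at h
  -- Cancelling the rotation on the right-hand side leaves a monomial matrix there, so its zero
  -- entry forces the remaining rotation to be trivial.
  have h1 : rotZ (-k' + k) * monoZ s m = 2 * monoZ s' m' := by
    have h2 := congrArg (rotZ (-k') * ·) h
    simp only [← mul_assoc, rotZ_mul_rotZ, neg_add_cancel, h0] at h2
    rw [mul_assoc, mul_assoc] at h2
    exact two_mul_goldMat_injective h2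
  have hk : -k' + k = 0 := by
    by_contra hk
    have h2 := congrFun (congrFun h1 (m' + 1)) 0
    rw [← elemZ_eq_mul, two_mul, Matrix.add_apply, monoZ_eq_zero, add_zero] at h2
    exact hk (elemZ_eq_zero _ _ _ _ h2)
  rw [hk, h0] at h1
  obtain ⟨hs, hm⟩ := monoZ_injective _ _ _ _ (two_mul_goldMat_injective h1)
  exact ⟨(neg_add_eq_zero.mp hk).symm, hs, hm⟩

theorem rootZ_dotProduct_self : ∀ a, rootZ a ⬝ᵥ rootZ a = 4 := by
  decide +kernel

theorem rootZ_injective : ∀ a b, rootZ a = rootZ b → a = b := by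
  decide +kernel

/-- The reflections permute the roots. -/
theorem reflZ_mulVec_rootZ : ∀ a b, ∃ c,
    (reflZ a).mulVec (rootZ b) = 2 • rootZ c ∨ (reflZ a).mulVec (rootZ b) = - (2 • rootZ c) := by
  decide +kernel

/-- The roots as listed by their signs, their shape and the cyclic permutation. -/
def signedRootZ (e₁ e₂ e₃ : ℤˣ) (b : Bool) (c : Fin 3) : Fin 3 → GoldInt := fun i =>
  (if b then ![⟨e₁ * 2, 0⟩, 0, 0] else ![⟨0, e₁⟩, ⟨-e₂, e₂⟩, ⟨e₃, 0⟩] : Fin 3 → GoldInt) (i - c)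

theorem signedRootZ_eq : ∀ e₁ e₂ e₃ b c, ∃ a,
    signedRootZ e₁ e₂ e₃ b c = rootZ a ∨ signedRootZ e₁ e₂ e₃ b c = - rootZ a := by
  decide +kernel

theorem rootZ_eq_signedRootZ : ∀ a, ∃ e₁ e₂ e₃ b c, rootZ a = signedRootZ e₁ e₂ e₃ b c := by
  decide +kernel

theorem neg_signedRootZ : ∀ e₁ e₂ e₃ b c,
    - signedRootZ e₁ e₂ e₃ b c = signedRootZ (-e₁) (-e₂) (-e₃) b c := by
  decide +kernel

/-- The two inequalities say that re + im·x is positive at x = 8/5 and at x = 81/50, which enclose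
φ. -/
theorem rootZ_dotProduct_pos : ∀ a,
    0 < 5 * (rootZ a ⬝ᵥ ![⟨3, 0⟩, ⟨0, 2⟩, 1]).re + 8 * (rootZ a ⬝ᵥ ![⟨3, 0⟩, ⟨0, 2⟩, 1]).im ∧
    0 < 50 * (rootZ a ⬝ᵥ ![⟨3, 0⟩, ⟨0, 2⟩, 1]).re
      + 81 * (rootZ a ⬝ᵥ ![⟨3, 0⟩, ⟨0, 2⟩, 1]).im := by
  decide +kernel

/-! ### Determinants, traces and class sizes over ℤ[φ]. -/

/-- The determinant of a three by three matrix. -/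
def detZ (A : GoldMat) : GoldInt :=
  A 0 0 * A 1 1 * A 2 2 - A 0 0 * A 1 2 * A 2 1 - A 0 1 * A 1 0 * A 2 2
    + A 0 1 * A 1 2 * A 2 0 + A 0 2 * A 1 0 * A 2 1 - A 0 2 * A 1 1 * A 2 0

/-- The determinants of the classes. -/
def classDetZ : Fin 10 → GoldInt := ![1, -1, -1, 1, 1, 1, 1, -1, -1, -1]

/-- The traces of the classes. -/
def classTraceZ : Fin 10 → GoldInt :=
  ![⟨3, 0⟩, ⟨-3, 0⟩, ⟨1, 0⟩, ⟨-1, 0⟩, 0, ⟨1, -1⟩, ⟨0, 1⟩, 0, ⟨0, -1⟩, ⟨-1, 1⟩]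

/-- The sizes of the classes. -/
def classSize : Fin 10 → ℕ := ![1, 1, 15, 15, 20, 12, 12, 20, 12, 12]

/-- The class with the determinant and the trace of half the given matrix. -/
def classZ (A : GoldMat) : Fin 10 :=
  ((List.finRange 10).find? fun s =>
    A 0 0 + A 1 1 + A 2 2 = 2 * classTraceZ s ∧ detZ A = 8 * classDetZ s).getD 0

/-- The search in `classZ` always succeeds, so its default value 0 is never a fallback. The factors
8 and 2 come from doubling. -/
theorem classZ_spec : ∀ k s m, detZ (elemZ k s m) = 8 * classDetZ (classZ (elemZ k s m)) ∧
    elemZ k s m 0 0 + elemZ k s m 1 1 + elemZ k s m 2 2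
      = 2 * classTraceZ (classZ (elemZ k s m)) := by
  decide +kernel

theorem class_injective : ∀ s t, classDetZ s = classDetZ t → classTraceZ s = classTraceZ t →
    s = t := by
  decide +kernel

theorem card_classZ : ∀ t, (Finset.univ.filter fun j : Fin 5 × Fin 8 × Fin 3 =>
    classZ (elemZ j.1 j.2.1 j.2.2) = t).card = classSize t := by
  decide +kernel

/-! ### The two embeddings of ℤ[φ] into the reals. -/

noncomputable section

theorem gold_mul_self : gold * gold = gold + 1 := by
  have h : Real.sqrt 5 * Real.sqrt 5 = 5 := Real.mul_self_sqrt (by norm_num)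
  simp only [gold]
  linear_combination h / 4

/-- The evaluation of golden integers at a root of `x² = x + 1`. -/
def goldEval (x : ℝ) (hx : x * x = x + 1) : GoldInt →+* ℝ where
  toFun z := z.re + z.im * x
  map_one' := by simp [QuadraticAlgebra.re_one, QuadraticAlgebra.im_one]
  map_zero' := by simp
  map_add' z w := by
    push_cast [QuadraticAlgebra.re_add, QuadraticAlgebra.im_add]
    ring
  map_mul' z w := by
    push_cast [QuadraticAlgebra.re_mul, QuadraticAlgebra.im_mul]
    linear_combination (-(z.im : ℝ) * w.im) * hx

/-- The embedding of the golden integers into the reals. -/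
def goldHom : GoldInt →+* ℝ := goldEval gold gold_mul_self

/-- The conjugate embedding of the golden integers into the reals. -/
def goldConj : GoldInt →+* ℝ :=
  goldEval (1 - gold) (by linear_combination gold_mul_self)

theorem goldHom_apply (z : GoldInt) : goldHom z = z.re + z.im * gold := rfl

theorem goldConj_apply (z : GoldInt) : goldConj z = z.re + z.im * (1 - gold) := rfl

/-- Irrationality of φ. Injectivity is what lets non-vanishing, and not only identities, pass
between ℤ[φ] and ℝ. -/
theorem goldHom_injective : Function.Injective goldHom := by
  rw [injective_iff_map_eq_zero]
  intro z hz
  rw [goldHom_apply] at hz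
  have hirr : Irrational gold := Real.goldenRatio_irrational
  have him : z.im = 0 := by
    by_contra h
    have := (hirr.intCast_mul h).intCast_add z.re
    exact this.ne_zero hz
  rw [him] at hz
  ext
  · simpa using hz
  · exact him

/-! ### Enumeration of the positive roots and of the group. -/

/-- The matrix of an element of the icosahedral group. -/
def toMat (w : H3) : Matrix (Fin 3) (Fin 3) ℝ := (w : GL (Fin 3) ℝ).1

@[simp] theorem toMat_one : toMat 1 = 1 := rfl

@[simp] theorem toMat_mul (w w' : H3) : toMat (w * w') = toMat w * toMat w' := rfl

theorem toMat_injective : Function.Injective toMat := fun _ _ h =>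
  Subtype.ext (Units.ext h)

/-- The golden integer matrix `A` represents twice the real matrix `w`. -/
def IsDouble (w : Matrix (Fin 3) (Fin 3) ℝ) (A : GoldMat) : Prop :=
  goldHom.mapMatrix A = (2 : ℝ) • w

theorem goldHom_mapMatrix_injective :
    Function.Injective (goldHom.mapMatrix (m := Fin 3)) := fun _ _ h =>
  Matrix.ext fun i j => goldHom_injective (congrFun (congrFun h i) j)

theorem IsDouble.eq {w A B} (h : IsDouble w A) (h' : IsDouble w B) : A = B :=
  goldHom_mapMatrix_injective (h.trans h'.symm)

theorem IsDouble.eq_left {w w' A} (h : IsDouble w A) (h' : IsDouble w' A) : w = w' := by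
  have := h.symm.trans h'
  exact smul_right_injective _ (two_ne_zero (α := ℝ)) this

/-- (2w)(2w') is twice the double of ww', so one factor 2 has to be removed after each
multiplication. -/
theorem IsDouble.mul {w w' A B C} (h : IsDouble w A) (h' : IsDouble w' B) (hC : A * B = 2 * C) :
    IsDouble (w * w') C := by
  have := congrArg goldHom.mapMatrix hC
  rw [map_mul, map_mul, h, h', map_ofNat, smul_mul_smul_comm] at this
  have h2 : (2 : Matrix (Fin 3) (Fin 3) ℝ) * goldHom.mapMatrix C
      = (2 : ℝ) • goldHom.mapMatrix C := by rw [two_mul, two_smul]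
  rw [h2, mul_smul] at this
  exact (smul_right_injective _ (two_ne_zero (α := ℝ)) this).symm

theorem isDouble_one : IsDouble 1 2 := by
  rw [IsDouble, map_ofNat, ← one_add_one_eq_two, ← one_add_one_eq_two, add_smul, one_smul]

/-- The real vector of a positive root. -/
def root (a : Fin 15) : Fin 3 → ℝ := fun i => goldHom (rootZ a i)

theorem root_dotProduct_self (a : Fin 15) : root a ⬝ᵥ root a = 4 := by
  have := congrArg goldHom (rootZ_dotProduct_self a)
  rw [map_ofNat] at this
  simpa [dotProduct, root] using this

theorem root_injective : Function.Injective root := fun a b h =>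
  rootZ_injective a b (funext fun i => goldHom_injective (congrFun h i))

theorem reflMatrix_neg (v : Fin 3 → ℝ) : reflMatrix (-v) = reflMatrix v := by
  simp [reflMatrix, Matrix.neg_vecMulVec, Matrix.vecMulVec_neg]

theorem isDouble_reflMatrix (a : Fin 15) : IsDouble (reflMatrix (root a)) (reflZ a) := by
  rw [IsDouble, reflMatrix, root_dotProduct_self, reflZ]
  refine Matrix.ext fun i j => ?_
  have h : (2 : Matrix (Fin 3) (Fin 3) ℝ) i j = 2 * (1 : Matrix (Fin 3) (Fin 3) ℝ) i j := by
    rw [← one_add_one_eq_two, Matrix.add_apply]; ring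
  rw [map_sub, map_ofNat, Matrix.sub_apply, h]
  simp [Matrix.vecMulVec_apply, root]
  ring

theorem mem_roots_iff_signedRootZ (v : Fin 3 → ℝ) :
    v ∈ roots ↔ ∃ e₁ e₂ e₃ b c, v = fun i => goldHom (signedRootZ e₁ e₂ e₃ b c i) := by
  have hs : ∀ x : ℝ, x ∈ ({1, -1} : Finset ℝ) ↔ ∃ e : ℤˣ, x = ((e : ℤ) : ℝ) := by
    intro x
    constructor
    · intro hx
      rcases Finset.mem_insert.mp hx with rfl | hx
      · exact ⟨1, by simp⟩
      · exact ⟨-1, by simpa using hx⟩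
    · rintro ⟨e, rfl⟩
      rcases Int.units_eq_one_or e with rfl | rfl <;> simp
  have ht (e₁ e₂ e₃ : ℤˣ) (c : Fin 3) : (fun i => goldHom (signedRootZ e₁ e₂ e₃ true c i)) =
      fun i => (![(e₁ : ℤ) * 2, 0, 0] : Fin 3 → ℝ) (i - c) := by
    funext i
    generalize h : i - c = j
    fin_cases j <;> simp [signedRootZ, h, goldHom_apply]
  have hf (e₁ e₂ e₃ : ℤˣ) (c : Fin 3) : (fun i => goldHom (signedRootZ e₁ e₂ e₃ false c i)) =
      fun i => (![(e₁ : ℤ) * gold, (e₂ : ℤ) * (gold - 1), (e₃ : ℤ)] : Fin 3 → ℝ) (i - c) := by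
    funext i
    generalize h : i - c = j
    fin_cases j <;> simp [signedRootZ, h, goldHom_apply]
    ring
  have hp (a b c : ℝ) : v ∈ cyclicPerms a b c ↔ ∃ k : Fin 3, v = fun i => ![a, b, c] (i - k) := by
    have h0 : (fun i : Fin 3 => ![a, b, c] (i - 0)) = ![a, b, c] := by
      funext i; simp
    have h1 : (fun i : Fin 3 => ![a, b, c] (i - 1)) = ![c, a, b] := by
      funext i; fin_cases i <;> rfl
    have h2 : (fun i : Fin 3 => ![a, b, c] (i - 2)) = ![b, c, a] := by
      funext i; fin_cases i <;> rfl
    simp only [cyclicPerms, Finset.mem_insert, Finset.mem_singleton, Fin.exists_fin_succ,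
      Fin.succ_zero_eq_one, Fin.succ_one_eq_two, h0, h1, h2, IsEmpty.exists_iff, or_false]
  simp only [roots, Finset.mem_biUnion, Finset.mem_product, Finset.mem_union, hp, Prod.exists, hs]
  constructor
  · rintro ⟨_, _, _, ⟨⟨e₁, rfl⟩, ⟨e₂, rfl⟩, ⟨e₃, rfl⟩⟩, ⟨k, h⟩ | ⟨k, h⟩⟩
    · exact ⟨e₁, e₂, e₃, true, k, h.trans (ht e₁ e₂ e₃ k).symm⟩
    · exact ⟨e₁, e₂, e₃, false, k, h.trans (hf e₁ e₂ e₃ k).symm⟩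
  · rintro ⟨e₁, e₂, e₃, b, k, h⟩
    refine ⟨_, _, _, ⟨⟨e₁, rfl⟩, ⟨e₂, rfl⟩, ⟨e₃, rfl⟩⟩, ?_⟩
    cases b
    · exact Or.inr ⟨k, h.trans (hf e₁ e₂ e₃ k)⟩
    · exact Or.inl ⟨k, h.trans (ht e₁ e₂ e₃ k)⟩

theorem mem_roots_iff (v : Fin 3 → ℝ) : v ∈ roots ↔ ∃ a, v = root a ∨ v = - root a := by
  rw [mem_roots_iff_signedRootZ]
  constructor
  · rintro ⟨e₁, e₂, e₃, b, c, rfl⟩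
    obtain ⟨a, h | h⟩ := signedRootZ_eq e₁ e₂ e₃ b c
    · exact ⟨a, Or.inl (by rw [h]; rfl)⟩
    · exact ⟨a, Or.inr (by rw [h]; funext i; simp [root])⟩
  · rintro ⟨a, rfl | rfl⟩
    all_goals obtain ⟨e₁, e₂, e₃, b, c, h⟩ := rootZ_eq_signedRootZ a
    · exact ⟨e₁, e₂, e₃, b, c, by rw [← h]; rfl⟩
    · exact ⟨-e₁, -e₂, -e₃, b, c, by rw [← neg_signedRootZ, ← h]; funext i; simp [root]⟩

theorem gold_bounds : 8 / 5 < gold ∧ gold < 81 / 50 := by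
  have h1 : (2.2 : ℝ) < Real.sqrt 5 := Real.lt_sqrt_of_sq_lt (by norm_num)
  have h2 : Real.sqrt 5 < 2.24 := by
    rw [Real.sqrt_lt' (by norm_num)]; norm_num
  constructor <;> simp only [gold] <;> linarith

theorem root_dotProduct_pos (a : Fin 15) : 0 < root a ⬝ᵥ ![3, 2 * gold, 1] := by
  have h : root a ⬝ᵥ ![3, 2 * gold, 1] = goldHom (rootZ a ⬝ᵥ ![⟨3, 0⟩, ⟨0, 2⟩, 1]) := by
    have h3 : goldHom ⟨3, 0⟩ = 3 := by simp [goldHom_apply]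
    have h2 : goldHom ⟨0, 2⟩ = 2 * gold := by simp [goldHom_apply]
    simp only [dotProduct, Fin.sum_univ_three, map_add, map_mul]
    simp [root, h2, h3]
  obtain ⟨h1, h2⟩ := rootZ_dotProduct_pos a
  rw [h, goldHom_apply]
  generalize (rootZ a ⬝ᵥ ![⟨3, 0⟩, ⟨0, 2⟩, 1]) = z at *
  have h1' : (0 : ℝ) < 5 * z.re + 8 * z.im := by exact_mod_cast h1
  have h2' : (0 : ℝ) < 50 * z.re + 81 * z.im := by exact_mod_cast h2
  obtain ⟨g1, g2⟩ := gold_bounds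
  -- The value at φ is a positive combination of the values at the bounds 8/5 and 81/50.
  nlinarith [mul_pos h1' (sub_pos.mpr g2), mul_pos h2' (sub_pos.mpr g1)]

theorem mem_posRoots_iff (v : Fin 3 → ℝ) : v ∈ posRoots ↔ ∃ a, v = root a := by
  rw [posRoots, Finset.mem_filter, mem_roots_iff]
  constructor
  · rintro ⟨⟨a, rfl | rfl⟩, h⟩
    · exact ⟨a, rfl⟩
    · rw [neg_dotProduct] at h
      linarith [root_dotProduct_pos a]
  · rintro ⟨a, rfl⟩
    exact ⟨⟨a, Or.inl rfl⟩, root_dotProduct_pos a⟩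

/-- The enumeration of the positive roots. -/
def rootEquiv : Fin 15 ≃ posRoots :=
  Equiv.ofBijective (fun a => ⟨root a, (mem_posRoots_iff _).mpr ⟨a, rfl⟩⟩)
    ⟨fun _ _ h => root_injective (congrArg Subtype.val h),
      fun v => ((mem_posRoots_iff _).mp v.2).imp fun _ h => Subtype.ext h.symm⟩

@[simp] theorem coe_rootEquiv (a : Fin 15) : (rootEquiv a : Fin 3 → ℝ) = root a := rfl

/-- The reflection in a positive root, by its index. -/
def reflection (a : Fin 15) : H3 := sigma (rootEquiv a)

theorem toMat_reflection (a : Fin 15) : toMat (reflection a) = reflMatrix (root a) := rfl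

theorem exists_isDouble_elemZ (w : H3) : ∃ k s m, IsDouble (toMat w) (elemZ k s m) := by
  have hmul : ∀ v ∈ roots, ∀ g : Matrix (Fin 3) (Fin 3) ℝ, (∃ k s m, IsDouble g (elemZ k s m)) →
      ∃ k s m, IsDouble (reflMatrix v * g) (elemZ k s m) := by
    rintro v hv g ⟨k, s, m, h⟩
    obtain ⟨a, ha⟩ : ∃ a, reflMatrix v = reflMatrix (root a) := by
      obtain ⟨a, rfl | rfl⟩ := (mem_roots_iff v).mp hv
      · exact ⟨a, rfl⟩
      · exact ⟨a, reflMatrix_neg _⟩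
    obtain ⟨k', s', m', h1⟩ := reflZ_mul_rotZ a k
    obtain ⟨s'', m'', h2⟩ := monoZ_mul_monoZ s' m' s m
    refine ⟨k', s'', m'', ?_⟩
    rw [ha]
    refine (isDouble_reflMatrix a).mul h ?_
    rw [elemZ_eq_mul, ← mul_assoc, h1, elemZ_eq_mul, elemZ_eq_mul, ← h2]
    simp only [mul_assoc]
  obtain ⟨g, hg⟩ := w
  change ∃ k s m, IsDouble g.1 (elemZ k s m)
  induction hg using Subgroup.closure_induction_left with
  | one =>
    refine ⟨0, 0, 0, ?_⟩
    have h : elemZ 0 0 0 = 2 := by decide +kernel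
    rw [h]
    exact isDouble_one
  | mul_left x hx y hy ih =>
    obtain ⟨v, hv, rfl⟩ := hx
    exact hmul v hv _ ih
  | inv_mul_cancel x hx y hy ih =>
    obtain ⟨v, hv, rfl⟩ := hx
    exact hmul v hv _ ih

theorem exists_toMat_isDouble (k s m) : ∃ w : H3, IsDouble (toMat w) (elemZ k s m) := by
  have hmul : ∀ {A B C : GoldMat}, (∃ w : H3, IsDouble (toMat w) A) →
      (∃ w : H3, IsDouble (toMat w) B) → A * B = 2 * C → ∃ w : H3, IsDouble (toMat w) C := by
    rintro A B C ⟨w, hw⟩ ⟨w', hw'⟩ h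
    exact ⟨w * w', hw.mul hw' h⟩
  have hrefl (a) : ∃ w : H3, IsDouble (toMat w) (reflZ a) := ⟨reflection a, isDouble_reflMatrix a⟩
  have htwo : ∃ w : H3, IsDouble (toMat w) 2 := ⟨1, isDouble_one⟩
  have hrot : ∃ w : H3, IsDouble (toMat w) (rotZ k) := by
    obtain ⟨a, b, h⟩ := rotZ_eq_reflZ_mul k
    exact hmul (hrefl a) (hrefl b) h
  have hperm : ∃ w : H3, IsDouble (toMat w) (2 * monoZ 0 m) := by
    obtain ⟨a, b, h⟩ := monoZ_eq_reflZ_mul m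
    exact hmul (hrefl a) (hrefl b) h
  have hsign : ∃ w : H3, IsDouble (toMat w) (2 * monoZ s 0) := by
    have hif (a : Fin 15) (b : Bool) :
        ∃ w : H3, IsDouble (toMat w) (if b then reflZ a else 2) := by
      cases b
      · exact htwo
      · exact hrefl a
    obtain ⟨a, b, c, s', h, h'⟩ := signZ_eq_reflZ_mul s
    exact hmul (hmul (hif 0 a) (hif 1 b) h) (hif 2 c) h'
  have h4 : rotZ k * (2 * monoZ s 0) = 2 * (rotZ k * monoZ s 0) := by
    rw [two_mul, two_mul, mul_add]
  refine hmul (hmul hrot hsign h4) hperm ?_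
  rw [elemZ_eq_mul, monoZ_eq_mul s m]
  simp only [two_mul, mul_add, mul_assoc]

theorem isDouble_toMat_bijective : ∃ e : Fin 5 × Fin 8 × Fin 3 ≃ H3,
    ∀ j, IsDouble (toMat (e j)) (elemZ j.1 j.2.1 j.2.2) := by
  choose f hf using fun j : Fin 5 × Fin 8 × Fin 3 => exists_toMat_isDouble j.1 j.2.1 j.2.2
  refine ⟨Equiv.ofBijective f ⟨fun j j' h => ?_, fun w => ?_⟩, hf⟩
  · have := (hf j).eq (h ▸ hf j')
    obtain ⟨h1, h2, h3⟩ := elemZ_injective _ _ _ _ _ _ this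
    exact Prod.ext h1 (Prod.ext h2 h3)
  · obtain ⟨k, s, m, h⟩ := exists_isDouble_elemZ w
    exact ⟨(k, s, m), toMat_injective ((hf (k, s, m)).eq_left h)⟩

/-- The enumeration of the icosahedral group. -/
def elemEquiv : Fin 5 × Fin 8 × Fin 3 ≃ H3 := isDouble_toMat_bijective.choose

theorem isDouble_elemEquiv (j : Fin 5 × Fin 8 × Fin 3) :
    IsDouble (toMat (elemEquiv j)) (elemZ j.1 j.2.1 j.2.2) :=
  isDouble_toMat_bijective.choose_spec j

instance : Fintype H3 := Fintype.ofEquiv _ elemEquiv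

theorem card_H3 : Nat.card H3 = 120 := by
  rw [← Nat.card_congr elemEquiv]
  simp

/-- Twice the matrix of an element of the group, over the golden integers. -/
def doubleMat (w : H3) : GoldMat :=
  elemZ (elemEquiv.symm w).1 (elemEquiv.symm w).2.1 (elemEquiv.symm w).2.2

theorem isDouble_doubleMat (w : H3) : IsDouble (toMat w) (doubleMat w) := by
  simpa [doubleMat] using isDouble_elemEquiv (elemEquiv.symm w)

theorem goldHom_doubleMat (w : H3) (i j : Fin 3) :
    goldHom (doubleMat w i j) = 2 * toMat w i j :=
  congrFun (congrFun (isDouble_doubleMat w) i) j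

/-! ### Conjugacy classes by determinant and trace. -/

/-- The index of the conjugacy class of an element of the group. -/
def classOf (w : H3) : Fin 10 := classZ (doubleMat w)

theorem goldHom_classDetZ (s : Fin 10) : goldHom (classDetZ s) = classDet s := by
  fin_cases s <;> simp [classDetZ, classDet]

theorem goldHom_classTraceZ (s : Fin 10) : goldHom (classTraceZ s) = classTrace s := by
  fin_cases s <;> simp [classTraceZ, classTrace, goldHom_apply] <;> ring

theorem det_toMat (w : H3) : (toMat w).det = classDet (classOf w) := by
  have h := congrArg goldHom
    (classZ_spec (elemEquiv.symm w).1 (elemEquiv.symm w).2.1 (elemEquiv.symm w).2.2).1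
  change goldHom (detZ (doubleMat w)) = goldHom (8 * classDetZ (classOf w)) at h
  rw [map_mul, map_ofNat, goldHom_classDetZ] at h
  rw [Matrix.det_fin_three]
  simp only [detZ, map_add, map_sub, map_mul, goldHom_doubleMat] at h
  linear_combination h / 8

theorem trace_toMat (w : H3) : (toMat w).trace = classTrace (classOf w) := by
  have h := congrArg goldHom
    (classZ_spec (elemEquiv.symm w).1 (elemEquiv.symm w).2.1 (elemEquiv.symm w).2.2).2
  change goldHom (doubleMat w 0 0 + doubleMat w 1 1 + doubleMat w 2 2)
    = goldHom (2 * classTraceZ (classOf w)) at h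
  rw [map_mul, map_ofNat, goldHom_classTraceZ] at h
  rw [Matrix.trace_fin_three]
  simp only [map_add, goldHom_doubleMat] at h
  linear_combination h / 2

theorem classOf_eq {w : H3} {s : Fin 10} (hd : (toMat w).det = classDet s)
    (ht : (toMat w).trace = classTrace s) : classOf w = s := by
  rw [det_toMat] at hd
  rw [trace_toMat] at ht
  apply class_injective
  · apply goldHom_injective
    rw [goldHom_classDetZ, goldHom_classDetZ, hd]
  · apply goldHom_injective
    rw [goldHom_classTraceZ, goldHom_classTraceZ, ht]

theorem mem_conjClass_iff (w : H3) (s : Fin 10) : w ∈ conjClass s ↔ classOf w = s :=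
  ⟨fun h => classOf_eq h.1 h.2, fun h => ⟨h ▸ det_toMat w, h ▸ trace_toMat w⟩⟩

theorem classOf_mul_comm (w w' : H3) : classOf (w * w') = classOf (w' * w) := by
  apply classOf_eq
  · rw [← det_toMat, toMat_mul, toMat_mul, Matrix.det_mul_comm]
  · rw [← trace_toMat, toMat_mul, toMat_mul, Matrix.trace_mul_comm]

theorem reflMatrix_transpose (v : Fin 3 → ℝ) : (reflMatrix v).transpose = reflMatrix v := by
  simp [reflMatrix, Matrix.transpose_vecMulVec]

theorem toMat_mul_transpose (w : H3) : toMat w * (toMat w).transpose = 1 := by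
  obtain ⟨g, hg⟩ := w
  change g.1 * g.1.transpose = 1
  have key (v) (y : GL (Fin 3) ℝ) (ih : y.1 * y.1.transpose = 1) :
      (refl v * y).1 * (refl v * y).1.transpose = 1 := by
    change (reflMatrix v * y.1) * (reflMatrix v * y.1).transpose = 1
    rw [Matrix.transpose_mul, mul_assoc, ← mul_assoc y.1, ih, one_mul, reflMatrix_transpose,
      reflMatrix_mul_self]
  induction hg using Subgroup.closure_induction_left with
  | one => simp
  | mul_left x hx y hy ih =>
    obtain ⟨v, -, rfl⟩ := hx
    exact key v y ih
  | inv_mul_cancel x hx y hy ih =>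
    obtain ⟨v, -, rfl⟩ := hx
    exact key v y ih

theorem toMat_inv (w : H3) : toMat w⁻¹ = (toMat w).transpose := by
  have h : toMat w⁻¹ * toMat w = 1 := by rw [← toMat_mul, inv_mul_cancel, toMat_one]
  calc toMat w⁻¹ = toMat w⁻¹ * (toMat w * (toMat w).transpose) := by
        rw [toMat_mul_transpose, mul_one]
    _ = (toMat w).transpose := by rw [← mul_assoc, h, one_mul]

theorem transpose_mul_toMat (w : H3) : (toMat w).transpose * toMat w = 1 := by
  rw [← toMat_inv, ← toMat_mul, inv_mul_cancel, toMat_one]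

-- The inverse is the transpose, which has the same determinant and trace; hence inverses disappear
-- from the character sums.
@[simp] theorem classOf_inv (w : H3) : classOf w⁻¹ = classOf w := by
  apply classOf_eq
  · rw [toMat_inv, Matrix.det_transpose, det_toMat]
  · rw [toMat_inv, Matrix.trace_transpose, trace_toMat]

theorem classOf_one : classOf 1 = 0 := by
  apply classOf_eq
  · simp [classDet]
  · rw [toMat_one, Matrix.trace_one]
    simp [classTrace]

theorem eq_one_of_classOf {w : H3} (h : classOf w = 0) : w = 1 := by
  have h2 : ∀ k s m, classZ (elemZ k s m) = 0 → elemZ k s m = 2 := by decide +kernel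
  have hw := isDouble_doubleMat w
  rw [doubleMat, h2 _ _ _ h] at hw
  exact toMat_injective (hw.eq_left isDouble_one)

theorem classOf_reflection (a : Fin 15) : classOf (reflection a) = 2 := by
  have h : ∀ a, classZ (reflZ a) = 2 := by decide +kernel
  have he : doubleMat (reflection a) = reflZ a :=
    (isDouble_doubleMat _).eq (isDouble_reflMatrix a)
  rw [classOf, he, h]

/-- The corner entry is carried along because `powerMult` weights characters by its powers. -/
theorem sum_H3 {M : Type*} [AddCommMonoid M] (F : Fin 10 → GoldInt → M) :
    ∑ w : H3, F (classOf w) (doubleMat w 0 0) = ∑ k, ∑ s, ∑ m,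
      F (classZ (elemZ k s m)) (elemZ k s m 0 0) := by
  rw [← Equiv.sum_comp elemEquiv, Fintype.sum_prod_type]
  refine Finset.sum_congr rfl fun k _ => ?_
  rw [Fintype.sum_prod_type]
  simp [classOf, doubleMat]

theorem sum_classOf (F : Fin 10 → ℝ) : ∑ w : H3, F (classOf w) = ∑ s, classSize s * F s := by
  rw [← Equiv.sum_comp elemEquiv]
  simp only [classOf, doubleMat, Equiv.symm_apply_apply]
  rw [← Finset.sum_fiberwise_of_maps_to (t := Finset.univ) (fun j _ => Finset.mem_univ
    (classZ (elemZ j.1 j.2.1 j.2.2)))]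
  refine Finset.sum_congr rfl fun s _ => ?_
  rw [← card_classZ s, ← nsmul_eq_mul]
  refine Finset.sum_eq_card_nsmul fun j hj => ?_
  rw [(Finset.mem_filter.mp hj).2]

theorem exists_classOf (s : Fin 10) : ∃ w, classOf w = s := by
  have h : ∀ t, ∃ k s m, classZ (elemZ k s m) = t := by decide +kernel
  obtain ⟨k, s', m, h⟩ := h s
  exact ⟨elemEquiv (k, s', m), by simpa [classOf, doubleMat] using h⟩

end

noncomputable section

/-! ### The character table over the golden integers -/

/-- The position of a label. -/
def Irrep.index : Irrep → Fin 10
  | .τ₁ => 0 | .τ₂ => 1 | .τ₃ => 2 | .τ₄ => 3 | .τ₅ => 4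
  | .τ₆ => 5 | .τ₇ => 6 | .τ₈ => 7 | .τ₉ => 8 | .τ₁₀ => 9

/-- The enumeration of the labels. -/
def irrepEquiv : Irrep ≃ Fin 10 where
  toFun := Irrep.index
  invFun := ![.τ₁, .τ₂, .τ₃, .τ₄, .τ₅, .τ₆, .τ₇, .τ₈, .τ₉, .τ₁₀]
  left_inv i := by cases i <;> rfl
  right_inv i := by fin_cases i <;> rfl

instance : DecidableEq Irrep := irrepEquiv.decidableEq

instance : Fintype Irrep := Fintype.ofEquiv _ irrepEquiv.symm

/-- The character table over the golden integers. -/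
def Irrep.chiZ : Irrep → Fin 10 → GoldInt
  | .τ₁ => ![1, 1, 1, 1, 1, 1, 1, 1, 1, 1]
  | .τ₂ => ![1, -1, -1, 1, 1, 1, 1, -1, -1, -1]
  | .τ₃ => ![⟨3, 0⟩, ⟨-3, 0⟩, 1, -1, 0, ⟨1, -1⟩, ⟨0, 1⟩, 0, ⟨0, -1⟩, ⟨-1, 1⟩]
  | .τ₄ => ![⟨3, 0⟩, ⟨3, 0⟩, -1, -1, 0, ⟨1, -1⟩, ⟨0, 1⟩, 0, ⟨0, 1⟩, ⟨1, -1⟩]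
  | .τ₅ => ![⟨3, 0⟩, ⟨-3, 0⟩, 1, -1, 0, ⟨0, 1⟩, ⟨1, -1⟩, 0, ⟨-1, 1⟩, ⟨0, -1⟩]
  | .τ₆ => ![⟨3, 0⟩, ⟨3, 0⟩, -1, -1, 0, ⟨0, 1⟩, ⟨1, -1⟩, 0, ⟨1, -1⟩, ⟨0, 1⟩]
  | .τ₇ => ![⟨4, 0⟩, ⟨4, 0⟩, 0, 0, 1, -1, -1, 1, -1, -1]
  | .τ₈ => ![⟨4, 0⟩, ⟨-4, 0⟩, 0, 0, 1, -1, -1, -1, 1, 1]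
  | .τ₉ => ![⟨5, 0⟩, ⟨5, 0⟩, 1, 1, -1, 0, 0, -1, 0, 0]
  | .τ₁₀ => ![⟨5, 0⟩, ⟨-5, 0⟩, -1, 1, -1, 0, 0, 1, 0, 0]

theorem goldHom_chiZ (i : Irrep) (s : Fin 10) : goldHom (i.chiZ s) = i.chi s := by
  cases i <;> fin_cases s <;>
    simp [Irrep.chiZ, Irrep.chi, goldHom_apply, QuadraticAlgebra.re_one,
      QuadraticAlgebra.im_one] <;> ring

theorem chiZ_row : ∀ i j : Irrep, ∑ s, (classSize s : GoldInt) * (i.chiZ s * j.chiZ s)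
    = if i = j then 120 else 0 := by
  decide +kernel

/-- Only orthogonality to the column of the identity is needed: it says that the isotypic
projections add up to one. -/
theorem chiZ_column : ∀ s, ∑ i : Irrep, i.chiZ 0 * i.chiZ s = if s = 0 then 120 else 0 := by
  decide +kernel

theorem chi_row (i j : Irrep) :
    ∑ w, i.chi (classOf w) * j.chi (classOf w) = if i = j then 120 else 0 := by
  rw [sum_classOf fun s => i.chi s * j.chi s]
  have h := congrArg goldHom (chiZ_row i j)
  simp only [map_sum, map_mul, map_natCast, goldHom_chiZ] at h
  rw [h]
  split_ifs
  · exact map_ofNat _ _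
  · exact map_zero _

theorem chi_column (w : H3) :
    ∑ i : Irrep, i.chi 0 * i.chi (classOf w) = if w = 1 then 120 else 0 := by
  have h := congrArg goldHom (chiZ_column (classOf w))
  simp only [map_sum, map_mul, goldHom_chiZ] at h
  rw [h]
  have h1 : classOf w = 0 ↔ w = 1 := ⟨eq_one_of_classOf, fun h => h ▸ classOf_one⟩
  simp only [h1]
  split_ifs
  · exact map_ofNat _ _
  · exact map_zero _

theorem chi_zero_pos (i : Irrep) : 0 < i.chi 0 := by
  cases i <;> simp [Irrep.chi]

theorem chi_injective {i j : Irrep} (h : i.chi = j.chi) : i = j := by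
  by_contra hij
  have h1 := chi_row i j
  have h2 := chi_row i i
  rw [← h, if_neg hij] at h1
  rw [h1, if_pos rfl] at h2
  norm_num at h2

/-! ### Characters of representations -/

section Representations

variable {X Y V W : Type*} [AddCommGroup X] [Module ℝ X] [AddCommGroup Y] [Module ℝ Y]
  [AddCommGroup V] [Module ℝ V] [AddCommGroup W] [Module ℝ W]
  {ρ : Representation ℝ H3 X} {σ : Representation ℝ H3 Y}
  {τ : Representation ℝ H3 V} {ω : Representation ℝ H3 W} {i j : Irrep}

theorem hasCharacter_iff : HasCharacter τ i ↔ ∀ w, τ.character w = i.chi (classOf w) :=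
  ⟨fun h w => h _ w ((mem_conjClass_iff w _).mpr rfl),
    fun h s w hw => (h w).trans (by rw [(mem_conjClass_iff w s).mp hw])⟩

theorem HasCharacter.unique (h : HasCharacter τ i) (h' : HasCharacter τ j) : i = j := by
  apply chi_injective
  funext s
  obtain ⟨w, rfl⟩ := exists_classOf s
  rw [← hasCharacter_iff.mp h, hasCharacter_iff.mp h']

instance : Invertible (Nat.card H3 : ℝ) := invertibleOfNonzero (by rw [card_H3]; norm_num)

instance : NeZero (Nat.card H3 : ℝ) := ⟨by rw [card_H3]; norm_num⟩

theorem sum_character_mul_character [FiniteDimensional ℝ X] [FiniteDimensional ℝ Y] :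
    ∑ w, σ.character w * ρ.character w⁻¹
      = 120 * Module.finrank ℝ (Representation.IntertwiningMap ρ σ) := by
  rw [← Representation.card_inv_mul_sum_char_mul_char_eq_finrank ρ σ, card_H3]
  push_cast
  ring

theorem HasCharacter.finrank [FiniteDimensional ℝ V] (h : HasCharacter τ i) :
    (Module.finrank ℝ V : ℝ) = i.chi 0 := by
  rw [← τ.char_one, hasCharacter_iff.mp h, classOf_one]

theorem HasCharacter.nontrivial [FiniteDimensional ℝ V] (h : HasCharacter τ i) :
    Nontrivial V := by
  apply Module.nontrivial_of_finrank_pos (R := ℝ)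
  have := chi_zero_pos i
  rw [← h.finrank] at this
  exact_mod_cast this

/-- Schur's lemma over ℝ: the character has norm one, so the commutant has dimension one, and the
trace determines the scalar. Irreducibility is not assumed, but deduced from this in
`HasCharacter.isIrreducible`. -/
theorem HasCharacter.eq_smul_one [FiniteDimensional ℝ V] (h : HasCharacter τ i)
    (A : V →ₗ[ℝ] V) (hA : ∀ w v, A (τ w v) = τ w (A v)) :
    A = (LinearMap.trace ℝ V A / i.chi 0) • (1 : V →ₗ[ℝ] V) := by
  have hfin : Module.finrank ℝ (Representation.IntertwiningMap τ τ) = 1 := by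
    have h1 := sum_character_mul_character (ρ := τ) (σ := τ)
    simp only [hasCharacter_iff.mp h, classOf_inv] at h1
    rw [chi_row, if_pos rfl] at h1
    have : (Module.finrank ℝ (Representation.IntertwiningMap τ τ) : ℝ) = 1 := by linarith
    exact_mod_cast this
  have := h.nontrivial
  have hne : Representation.IntertwiningMap.id τ ≠ 0 := by
    intro h0
    obtain ⟨v, hv⟩ := exists_ne (0 : V)
    exact hv (congrArg (fun F : Representation.IntertwiningMap τ τ => F v) h0)
  obtain ⟨c, hc⟩ := (finrank_eq_one_iff_of_nonzero' _ hne).mp hfin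
    (A.intertwiningMap_of_isIntertwiningMap τ τ hA)
  have hA' : A = c • (1 : V →ₗ[ℝ] V) := by
    ext v
    exact (congrArg (fun F : Representation.IntertwiningMap τ τ => F v) hc).symm
  have ht : LinearMap.trace ℝ V A = c * i.chi 0 := by
    rw [hA', map_smul, LinearMap.trace_one, h.finrank, smul_eq_mul]
  rw [ht, mul_div_cancel_right₀ _ (chi_zero_pos i).ne']
  exact hA'

theorem _root_.Subrepresentation.isCompl_toSubmodule {G k M : Type*} [Monoid G] [CommRing k]
    [AddCommGroup M] [Module k M] {π : Representation k G M} {U U' : Subrepresentation π}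
    (h : IsCompl U U') : IsCompl U.toSubmodule U'.toSubmodule :=
  ⟨disjoint_iff.mpr (congrArg Subrepresentation.toSubmodule (disjoint_iff.mp h.1)),
    codisjoint_iff.mpr (congrArg Subrepresentation.toSubmodule (codisjoint_iff.mp h.2))⟩

/-- An invariant subspace has an invariant complement by Maschke. The projection along it commutes
with the group, hence is a scalar, and the scalar decides between the zero subspace and the whole
space. -/
theorem HasCharacter.isIrreducible [FiniteDimensional ℝ V] (h : HasCharacter τ i) :
    τ.IsIrreducible := by
  have := h.nontrivial
  have : Nontrivial (Subrepresentation τ) := by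
    refine ⟨⊥, ⊤, fun h0 => ?_⟩
    have h1 : (⊥ : Submodule ℝ V) = ⊤ := congrArg Subrepresentation.toSubmodule h0
    exact bot_ne_top h1
  refine ⟨fun U => ?_⟩
  obtain ⟨U', hU⟩ := exists_isCompl U
  have hc := Subrepresentation.isCompl_toSubmodule hU
  have hcomm (w v) : U.toSubmodule.projection U'.toSubmodule hc (τ w v)
      = τ w (U.toSubmodule.projection U'.toSubmodule hc v) := by
    obtain ⟨a, b, ha, hb, rfl⟩ := Submodule.codisjoint_iff_exists_add_eq.mp hc.2 v
    simp only [map_add]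
    rw [Submodule.projection_apply_of_mem_left hc ha, Submodule.projection_apply_of_mem_right hc hb,
      Submodule.projection_apply_of_mem_left hc (U.apply_mem_toSubmodule w ha),
      Submodule.projection_apply_of_mem_right hc (U'.apply_mem_toSubmodule w hb), map_zero]
  have hs := h.eq_smul_one _ hcomm
  set c := LinearMap.trace ℝ V (U.toSubmodule.projection U'.toSubmodule hc) / i.chi 0
  by_cases hc0 : c = 0
  · left
    apply Subrepresentation.toSubmodule_injective
    refine (Submodule.eq_bot_iff _).mpr fun v hv => ?_
    have := Submodule.projection_apply_of_mem_left hc hv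
    rw [hs, hc0, zero_smul] at this
    exact this.symm
  · right
    apply Subrepresentation.toSubmodule_injective
    refine Submodule.eq_top_iff'.mpr fun v => ?_
    have hm : c • v ∈ U.toSubmodule := by
      have : U.toSubmodule.projection U'.toSubmodule hc v ∈ U.toSubmodule :=
        Submodule.projection_apply_mem hc v
      rwa [hs] at this
    have := U.toSubmodule.smul_mem c⁻¹ hm
    rwa [smul_smul, inv_mul_cancel₀ hc0, one_smul] at this

/-- A representation that contains an irreducible one has a complementary part. -/
theorem exists_character_sub [FiniteDimensional ℝ X] [FiniteDimensional ℝ W]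
    (hω : HasCharacter ω i) (h : ∑ w, ρ.character w * i.chi (classOf w) ≠ 0) :
    ∃ U : Subrepresentation ρ, ∀ w, U.toRepresentation.character w
      = ρ.character w - i.chi (classOf w) := by
  have hne : Module.finrank ℝ (Representation.IntertwiningMap ω ρ) ≠ 0 := by
    intro h0
    have h1 := sum_character_mul_character (ρ := ω) (σ := ρ)
    simp only [hasCharacter_iff.mp hω, classOf_inv] at h1
    rw [h0, Nat.cast_zero, mul_zero] at h1
    exact h h1
  have : Nontrivial (Representation.IntertwiningMap ω ρ) := by
    by_contra hn
    rw [not_nontrivial_iff_subsingleton] at hn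
    exact hne Module.finrank_zero_of_subsingleton
  obtain ⟨F, hF⟩ := exists_ne (0 : Representation.IntertwiningMap ω ρ)
  have := hω.isIrreducible
  have hinj := (Representation.IsIrreducible.injective_or_eq_zero F).resolve_right hF
  obtain ⟨U, hU⟩ := exists_isCompl F.range
  have hc := Subrepresentation.isCompl_toSubmodule hU
  refine ⟨U, fun w => ?_⟩
  have e : ∃ e : W ≃ₗ[ℝ] F.range.toSubmodule, ∀ x, (e x : X) = F x :=
    ⟨LinearEquiv.ofInjective F.toLinearMap hinj, fun _ => rfl⟩
  obtain ⟨e, he⟩ := e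
  -- In the splitting into the copy of `ω` and its complement the action is block diagonal, so the
  -- traces add.
  have hprod : ρ w = (Submodule.prodEquivOfIsCompl _ _ hc).conj
      (LinearMap.prodMap (F.range.toRepresentation w) (U.toRepresentation w)) := by
    ext x
    obtain ⟨y, rfl⟩ := (Submodule.prodEquivOfIsCompl _ _ hc).surjective x
    rw [LinearEquiv.conj_apply_apply, LinearEquiv.symm_apply_apply]
    simp [Subrepresentation.toRepresentation]
  have hW : LinearMap.trace ℝ _ (F.range.toRepresentation w) = i.chi (classOf w) := by
    rw [← hasCharacter_iff.mp hω w, Representation.character,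
      ← LinearMap.trace_conj' (ω w) e]
    congr 1
    ext x
    obtain ⟨y, rfl⟩ := e.surjective x
    rw [LinearEquiv.conj_apply_apply, LinearEquiv.symm_apply_apply, he, F.isIntertwining]
    exact congrArg (ρ w) (he y)
  rw [Representation.character, Representation.character, hprod, LinearMap.trace_conj',
    LinearMap.trace_prodMap', hW]
  ring

/-! ### The isotypic projections -/

/-- The projection to the isotypic component with label `i`. -/
def isotypicProj (i : Irrep) (ρ : Representation ℝ H3 X) : X →ₗ[ℝ] X :=
  ∑ w, (i.chi 0 / 120 * i.chi (classOf w)) • ρ w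

theorem isotypicProj_apply (i : Irrep) (ρ : Representation ℝ H3 X) (x : X) :
    isotypicProj i ρ x = ∑ w, (i.chi 0 / 120 * i.chi (classOf w)) • ρ w x := by
  simp [isotypicProj]

theorem sum_isotypicProj (ρ : Representation ℝ H3 X) : ∑ i, isotypicProj i ρ = 1 := by
  simp only [isotypicProj]
  rw [Finset.sum_comm]
  simp only [← Finset.sum_smul, div_mul_eq_mul_div, ← Finset.sum_div, chi_column]
  simp [ite_div]

theorem map_isotypicProj (F : X →ₗ[ℝ] Y) (hF : ∀ w x, F (ρ w x) = σ w (F x)) (i : Irrep) (x : X) :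
    F (isotypicProj i ρ x) = isotypicProj i σ (F x) := by
  simp [isotypicProj_apply, hF]

/-- The coefficients are class functions, so the sum is central in the group algebra. -/
theorem isotypicProj_comm (i : Irrep) (ρ : Representation ℝ H3 X) (w : H3) (x : X) :
    isotypicProj i ρ (ρ w x) = ρ w (isotypicProj i ρ x) := by
  simp only [isotypicProj_apply, map_sum, map_smul]
  rw [← Equiv.sum_comp (MulAut.conj w).toEquiv]
  refine Finset.sum_congr rfl fun g _ => ?_
  have h1 : classOf (w * g * w⁻¹) = classOf g := by
    rw [classOf_mul_comm, inv_mul_cancel_left]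
  have h2 : ρ (w * g * w⁻¹) (ρ w x) = ρ w (ρ g x) := by
    rw [← Module.End.mul_apply, ← map_mul, inv_mul_cancel_right, map_mul, Module.End.mul_apply]
  change _ • ρ (w * g * w⁻¹) (ρ w x) = _
  rw [h2]
  change (_ * i.chi (classOf (w * g * w⁻¹))) • _ = _
  rw [h1]

theorem trace_isotypicProj (i : Irrep) (ρ : Representation ℝ H3 X) :
    LinearMap.trace ℝ X (isotypicProj i ρ)
      = i.chi 0 / 120 * ∑ w, i.chi (classOf w) * ρ.character w := by
  simp [isotypicProj, Finset.mul_sum, Representation.character, mul_assoc]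

theorem HasCharacter.isotypicProj_eq [FiniteDimensional ℝ V] (h : HasCharacter τ j) (i : Irrep) :
    isotypicProj i τ = if i = j then 1 else 0 := by
  rw [h.eq_smul_one _ (isotypicProj_comm i τ), trace_isotypicProj]
  simp only [hasCharacter_iff.mp h]
  rw [chi_row]
  split_ifs with hij
  · subst hij
    rw [div_mul_cancel₀ _ (by norm_num), div_self (chi_zero_pos i).ne', one_smul]
  · simp

attribute [irreducible] isotypicProj

end Representations

end

noncomputable section

/-! ### Existence of the ten representations -/

/-- Some representation has the given function of the class as its character. -/
def IsRealCharacter (f : Fin 10 → GoldInt) : Prop :=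
  ∃ (n : ℕ) (τ : Representation ℝ H3 (Fin n → ℝ)), ∀ w, τ.character w = goldHom (f (classOf w))

theorem IsRealCharacter.of_representation {X : Type*} [AddCommGroup X] [Module ℝ X]
    [FiniteDimensional ℝ X] (ρ : Representation ℝ H3 X) {f : Fin 10 → GoldInt}
    (h : ∀ w, ρ.character w = goldHom (f (classOf w))) : IsRealCharacter f := by
  let e : X ≃ₗ[ℝ] (Fin (Module.finrank ℝ X) → ℝ) := (Module.finBasis ℝ X).equivFun
  refine ⟨_, ⟨⟨fun w => e.conj (ρ w), by rw [map_one]; exact e.conj_id⟩, fun w w' => by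
    change e.conj (ρ (w * w')) = _
    rw [map_mul]; exact e.conj_comp _ _⟩, fun w => ?_⟩
  rw [← h]
  exact LinearMap.trace_conj' (ρ w) e

theorem IsRealCharacter.mul {f g : Fin 10 → GoldInt} (hf : IsRealCharacter f)
    (hg : IsRealCharacter g) : IsRealCharacter (f * g) := by
  obtain ⟨n, ρ, hρ⟩ := hf
  obtain ⟨m, σ, hσ⟩ := hg
  refine .of_representation (ρ.tprod σ) fun w => ?_
  rw [Representation.char_tensor, Pi.mul_apply, hρ, hσ, Pi.mul_apply, map_mul]

theorem hasCharacter_of_chiZ {V : Type*} [AddCommGroup V] [Module ℝ V]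
    {τ : Representation ℝ H3 V} {i : Irrep}
    (h : ∀ w, τ.character w = goldHom (i.chiZ (classOf w))) : HasCharacter τ i :=
  hasCharacter_iff.mpr fun w => (h w).trans (goldHom_chiZ _ _)

/-- Constituents already known are split off, which yields new characters from tensor products. -/
theorem IsRealCharacter.sub {f : Fin 10 → GoldInt} {i : Irrep} (hf : IsRealCharacter f)
    (hi : IsRealCharacter i.chiZ) (h : ∑ s, (classSize s : GoldInt) * (f s * i.chiZ s) ≠ 0) :
    IsRealCharacter (f - i.chiZ) := by
  obtain ⟨n, ρ, hρ⟩ := hf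
  obtain ⟨m, ω, hω⟩ := hi
  obtain ⟨U, hU⟩ := exists_character_sub (ρ := ρ) (hasCharacter_of_chiZ hω) (by
    simp only [hρ]
    rw [sum_classOf fun s => goldHom (f s) * i.chi s]
    have h1 := (map_ne_zero_iff goldHom goldHom_injective).mpr h
    simpa only [map_sum, map_mul, map_natCast, goldHom_chiZ] using h1)
  refine .of_representation U.toRepresentation fun w => ?_
  rw [hU, hρ, Pi.sub_apply, map_sub, goldHom_chiZ]

/-- The representation by the matrices of the group. -/
def natRep : Representation ℝ H3 (Fin 3 → ℝ) where
  toFun w := Matrix.toLin' (toMat w)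
  map_one' := by rw [toMat_one, Matrix.toLin'_one]; rfl
  map_mul' w w' := by rw [toMat_mul, Matrix.toLin'_mul]; rfl

theorem natRep_apply (w : H3) (x : Fin 3 → ℝ) : natRep w x = (toMat w).mulVec x := rfl

theorem two_eq_smul_one : (2 : Matrix (Fin 3) (Fin 3) ℝ) = (2 : ℝ) • 1 := by
  rw [two_smul, one_add_one_eq_two]

theorem doubleMat_mul (w w' : H3) : doubleMat w * doubleMat w' = 2 * doubleMat (w * w') := by
  apply goldHom_mapMatrix_injective
  rw [map_mul, map_mul, isDouble_doubleMat, isDouble_doubleMat, isDouble_doubleMat, map_ofNat,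
    toMat_mul, two_eq_smul_one, smul_mul_smul_comm, smul_mul_smul_comm, one_mul]

theorem doubleMat_one : doubleMat 1 = 2 :=
  (isDouble_doubleMat 1).eq isDouble_one

/-- The representation by the algebraic conjugates of the matrices of the group. -/
def conjRep : Representation ℝ H3 (Fin 3 → ℝ) where
  toFun w := Matrix.toLin' ((1 / 2 : ℝ) • goldConj.mapMatrix (doubleMat w))
  map_one' := by
    rw [doubleMat_one, map_ofNat, two_eq_smul_one, smul_smul, one_div_mul_cancel two_ne_zero, one_smul,
      Matrix.toLin'_one]
    rfl
  map_mul' w w' := by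
    change _ = Matrix.toLin' _ ∘ₗ Matrix.toLin' _
    rw [← Matrix.toLin'_mul, smul_mul_smul_comm, ← map_mul,
      doubleMat_mul, map_mul, map_ofNat, two_mul, ← two_smul ℝ, smul_smul]
    norm_num

theorem trace_conjRep (w : H3) : conjRep.character w = goldConj (classTraceZ (classOf w)) := by
  have h := (classZ_spec (elemEquiv.symm w).1 (elemEquiv.symm w).2.1 (elemEquiv.symm w).2.2).2
  change doubleMat w 0 0 + doubleMat w 1 1 + doubleMat w 2 2 = 2 * classTraceZ (classOf w) at h
  have h' := congrArg goldConj h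
  rw [map_mul, map_ofNat] at h'
  change LinearMap.trace ℝ _ (Matrix.toLin' _) = _
  rw [Matrix.trace_toLin'_eq, Matrix.trace_fin_three]
  simp only [map_add, Matrix.smul_apply, RingHom.mapMatrix_apply, Matrix.map_apply,
    smul_eq_mul] at h' ⊢
  linear_combination h' / 2

theorem isRealCharacter_one : IsRealCharacter (Irrep.chiZ .τ₁) := by
  refine .of_representation (1 : Representation ℝ H3 ℝ) fun w => ?_
  have h : ∀ s, Irrep.chiZ .τ₁ s = 1 := by decide +kernel
  rw [h, map_one]
  simp [Representation.character]

theorem isRealCharacter_det : IsRealCharacter (Irrep.chiZ .τ₂) := by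
  refine .of_representation ((Algebra.lmul ℝ ℝ : ℝ →* Module.End ℝ ℝ).comp
    (Matrix.detMonoidHom.comp ⟨⟨toMat, toMat_one⟩, toMat_mul⟩)) fun w => ?_
  have h : ∀ s, Irrep.chiZ .τ₂ s = classDetZ s := by decide +kernel
  rw [h, goldHom_classDetZ, ← det_toMat]
  simp [Representation.character, LinearMap.trace_eq_matrix_trace ℝ (Module.Basis.singleton Unit ℝ),
    Matrix.trace, LinearMap.toMatrix_apply]

theorem isRealCharacter_nat : IsRealCharacter (Irrep.chiZ .τ₃) := by
  refine .of_representation natRep fun w => ?_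
  have h : ∀ s, Irrep.chiZ .τ₃ s = classTraceZ s := by decide +kernel
  rw [h, goldHom_classTraceZ, ← trace_toMat]
  exact Matrix.trace_toLin'_eq _

theorem isRealCharacter_conj : IsRealCharacter (Irrep.chiZ .τ₅) := by
  refine .of_representation conjRep fun w => ?_
  -- Replacing φ by its conjugate 1 - φ sends a + bφ to (a + b) - bφ.
  have h : ∀ s, Irrep.chiZ .τ₅ s = ⟨(classTraceZ s).re + (classTraceZ s).im,
      -(classTraceZ s).im⟩ := by decide +kernel
  rw [h, trace_conjRep, goldConj_apply, goldHom_apply]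
  push_cast
  ring

/-- The sources are τ₃ ⊗ τ₃ = τ₁ + τ₄ + τ₉ and τ₃ ⊗ τ₅ = τ₇ + τ₉, with τ₅ the Galois conjugate of
τ₃; the other characters are twists by the determinant. -/
theorem isRealCharacter_chiZ (i : Irrep) : IsRealCharacter i.chiZ := by
  have h1 := isRealCharacter_one
  have h2 := isRealCharacter_det
  have h3 := isRealCharacter_nat
  have h5 := isRealCharacter_conj
  have h4 : IsRealCharacter (Irrep.chiZ .τ₄) := by
    have h : Irrep.chiZ .τ₃ * Irrep.chiZ .τ₂ = Irrep.chiZ .τ₄ := by decide +kernel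
    exact h ▸ h3.mul h2
  have h6 : IsRealCharacter (Irrep.chiZ .τ₆) := by
    have h : Irrep.chiZ .τ₅ * Irrep.chiZ .τ₂ = Irrep.chiZ .τ₆ := by decide +kernel
    exact h ▸ h5.mul h2
  have h9 : IsRealCharacter (Irrep.chiZ .τ₉) := by
    have h : Irrep.chiZ .τ₃ * Irrep.chiZ .τ₃ - Irrep.chiZ .τ₁ - Irrep.chiZ .τ₄
        = Irrep.chiZ .τ₉ := by decide +kernel
    exact h ▸ ((h3.mul h3).sub h1 (by decide +kernel)).sub h4 (by decide +kernel)
  have h7 : IsRealCharacter (Irrep.chiZ .τ₇) := by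
    have h : Irrep.chiZ .τ₃ * Irrep.chiZ .τ₅ - Irrep.chiZ .τ₉ = Irrep.chiZ .τ₇ := by
      decide +kernel
    exact h ▸ (h3.mul h5).sub h9 (by decide +kernel)
  cases i
  · exact h1
  · exact h2
  · exact h3
  · exact h4
  · exact h5
  · exact h6
  · exact h7
  · have h : Irrep.chiZ .τ₇ * Irrep.chiZ .τ₂ = Irrep.chiZ .τ₈ := by decide +kernel
    exact h ▸ h7.mul h2
  · exact h9
  · have h : Irrep.chiZ .τ₉ * Irrep.chiZ .τ₂ = Irrep.chiZ .τ₁₀ := by decide +kernel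
    exact h ▸ h9.mul h2

theorem exists_representation (i : Irrep) :
    ∃ (n : ℕ) (τ : Representation ℝ H3 (Fin n → ℝ)), HasCharacter τ i := by
  obtain ⟨n, τ, h⟩ := isRealCharacter_chiZ i
  exact ⟨n, τ, hasCharacter_of_chiZ h⟩

/-! ### Classification -/

section Representations

variable {X Y V W : Type*} [AddCommGroup X] [Module ℝ X] [AddCommGroup Y] [Module ℝ Y]
  [AddCommGroup V] [Module ℝ V] [AddCommGroup W] [Module ℝ W]
  {ρ : Representation ℝ H3 X} {σ : Representation ℝ H3 Y}
  {τ : Representation ℝ H3 V} {ω : Representation ℝ H3 W} {i j : Irrep}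

/-- The projections add up to one, so one of them has nonzero trace. This means a nonzero
intertwining map from one of the ten models, and between irreducibles such a map is bijective. -/
theorem exists_hasCharacter [FiniteDimensional ℝ V] (hτ : τ.IsIrreducible) :
    ∃ i, HasCharacter τ i := by
  have : Nontrivial V := by
    by_contra hn
    rw [not_nontrivial_iff_subsingleton] at hn
    exact bot_ne_top (α := Subrepresentation τ)
      (Subrepresentation.toSubmodule_injective (Subsingleton.elim _ _))
  have h1 := congrArg (LinearMap.trace ℝ V) (sum_isotypicProj τ)
  rw [map_sum, LinearMap.trace_one] at h1
  obtain ⟨i, -, hi⟩ : ∃ i ∈ Finset.univ, LinearMap.trace ℝ V (isotypicProj i τ) ≠ 0 := by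
    apply Finset.exists_ne_zero_of_sum_ne_zero
    rw [h1]
    exact_mod_cast Module.finrank_pos.ne'
  rw [trace_isotypicProj] at hi
  obtain ⟨n, ω, hω⟩ := exists_representation i
  have hne : Module.finrank ℝ (Representation.IntertwiningMap ω τ) ≠ 0 := by
    intro h0
    have h1 := sum_character_mul_character (ρ := ω) (σ := τ)
    simp only [hasCharacter_iff.mp hω, classOf_inv] at h1
    rw [h0, Nat.cast_zero, mul_zero] at h1
    apply hi
    simp only [mul_comm (i.chi (classOf _))]
    rw [h1, mul_zero]
  have : Nontrivial (Representation.IntertwiningMap ω τ) := by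
    by_contra hn
    rw [not_nontrivial_iff_subsingleton] at hn
    exact hne Module.finrank_zero_of_subsingleton
  obtain ⟨F, hF⟩ := exists_ne (0 : Representation.IntertwiningMap ω τ)
  have := hω.isIrreducible
  have hbij := (Representation.IsIrreducible.bijective_or_eq_zero F).resolve_right hF
  have hchar := Representation.char_iso (F.ofBijective hbij)
  exact ⟨i, hasCharacter_iff.mpr fun w => by rw [← hchar, hasCharacter_iff.mp hω]⟩

/-- An element of the group algebra that is the scalar `c` on the model acts as `c` on the whole
isotypic component of any representation, even an infinite-dimensional one such as the polynomials.
Translating the summation variable leaves only an identity between coefficients, obtained from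
traces on the model. -/
theorem sum_smul_isotypicProj {T : Type*} [Fintype T] (a : T → ℝ) (γ : T → H3) {c : ℝ}
    [FiniteDimensional ℝ W] (hω : HasCharacter ω j) (h : ∑ t, a t • ω (γ t) = c • 1)
    (ρ : Representation ℝ H3 X) (x : X) :
    ∑ t, a t • ρ (γ t) (isotypicProj j ρ x) = c • isotypicProj j ρ x := by
  have key (k : H3) : ∑ t, a t * j.chi (classOf ((γ t)⁻¹ * k)) = c * j.chi (classOf k) := by
    have h1 := congrArg (fun A => LinearMap.trace ℝ W (ω k⁻¹ * A)) h
    simp only [Finset.mul_sum, mul_smul_comm, map_sum, map_smul, mul_one, ← map_mul,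
      smul_eq_mul] at h1
    have h2 (g : H3) : LinearMap.trace ℝ W (ω g) = j.chi (classOf g) := hasCharacter_iff.mp hω g
    simp only [h2] at h1
    rw [classOf_inv] at h1
    rw [← h1]
    refine Finset.sum_congr rfl fun t _ => ?_
    rw [← classOf_inv, mul_inv_rev, inv_inv]
  simp only [isotypicProj_apply, map_sum, map_smul, Finset.smul_sum]
  have h3 (t : T) : ∑ w, a t • (j.chi 0 / 120 * j.chi (classOf w)) • ρ (γ t) (ρ w x)
      = ∑ k, a t • (j.chi 0 / 120 * j.chi (classOf ((γ t)⁻¹ * k))) • ρ k x := by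
    rw [← Equiv.sum_comp (Equiv.mulLeft (γ t)) fun k =>
      a t • (j.chi 0 / 120 * j.chi (classOf ((γ t)⁻¹ * k))) • ρ k x]
    simp
  simp only [h3]
  rw [Finset.sum_comm]
  refine Finset.sum_congr rfl fun k _ => ?_
  simp only [smul_smul]
  rw [← Finset.sum_smul]
  congr 1
  have := key k
  simp only [mul_left_comm _ (j.chi 0 / 120)]
  rw [← Finset.mul_sum, this]

theorem isotypicProj_isotypicProj (i j : Irrep) (ρ : Representation ℝ H3 X) (x : X) :
    isotypicProj i ρ (isotypicProj j ρ x) = if i = j then isotypicProj j ρ x else 0 := by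
  obtain ⟨n, ω, hω⟩ := exists_representation j
  have h := sum_smul_isotypicProj (fun w => i.chi 0 / 120 * i.chi (classOf w)) id
    (c := if i = j then 1 else 0) hω (by
      have := hω.isotypicProj_eq i
      rw [isotypicProj] at this
      rw [ite_smul, one_smul, zero_smul]
      exact this) ρ x
  rw [isotypicProj_apply]
  simpa using h

/-- The trace of an idempotent is its rank. -/
theorem isotypicProj_eq_zero [FiniteDimensional ℝ X]
    (h : ∑ w, i.chi (classOf w) * ρ.character w = 0) : isotypicProj i ρ = 0 := by
  have hid : IsIdempotentElem (isotypicProj i ρ) := by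
    ext x
    exact (isotypicProj_isotypicProj i i ρ x).trans (if_pos rfl)
  have ht := (LinearMap.IsIdempotentElem.isProj_range _ hid).trace
  rw [trace_isotypicProj, h, mul_zero] at ht
  rw [← LinearMap.range_eq_bot, ← Submodule.finrank_eq_zero (R := ℝ)]
  exact_mod_cast ht.symm

theorem isotypicProj_orbitSpan {x : X} (hx : isotypicProj i ρ x = x) {y : X}
    (hy : y ∈ (orbitSpan ρ x).toSubmodule) : isotypicProj i ρ y = y := by
  change y ∈ Submodule.span ℝ _ at hy
  induction hy using Submodule.span_induction with
  | mem y hy =>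
    obtain ⟨w, rfl⟩ := hy
    rw [isotypicProj_comm, hx]
  | zero => exact map_zero _
  | add y z _ _ hy hz => rw [map_add, hy, hz]
  | smul c y _ hy => rw [map_smul, hy]

theorem mem_orbitSpan (ρ : Representation ℝ H3 X) (x : X) : x ∈ (orbitSpan ρ x).toSubmodule :=
  Submodule.subset_span ⟨1, by simp⟩

theorem orbitSpan_le {x : X} {U : Subrepresentation ρ} (hx : x ∈ U.toSubmodule) :
    (orbitSpan ρ x).toSubmodule ≤ U.toSubmodule := by
  refine Submodule.span_le.mpr ?_
  rintro _ ⟨w, rfl⟩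
  exact U.apply_mem_toSubmodule w hx

instance (ρ : Representation ℝ H3 X) (x : X) :
    FiniteDimensional ℝ (orbitSpan ρ x).toSubmodule :=
  FiniteDimensional.span_of_finite ℝ (Set.finite_range _)

/-- The representation spanned by the orbit of a vector of an isotypic component contains a
vector whose orbit spans an irreducible representation. -/
theorem exists_hasCharacter_orbitSpan {x : X} (hx : isotypicProj i ρ x = x) (hx0 : x ≠ 0) :
    ∃ y ∈ (orbitSpan ρ x).toSubmodule, y ≠ 0 ∧
      HasCharacter (orbitSpan ρ y).toRepresentation i := by
  classical
  have hex : ∃ n, ∃ y ∈ (orbitSpan ρ x).toSubmodule, y ≠ 0 ∧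
      Module.finrank ℝ (orbitSpan ρ y).toSubmodule = n :=
    ⟨_, x, mem_orbitSpan ρ x, hx0, rfl⟩
  -- A nonzero vector whose orbit span has least dimension; minimality makes that span irreducible.
  obtain ⟨y, hy, hy0, hn⟩ := Nat.find_spec hex
  refine ⟨y, hy, hy0, ?_⟩
  have hyne : (⟨y, mem_orbitSpan ρ y⟩ : (orbitSpan ρ y).toSubmodule) ≠ 0 := fun h =>
    hy0 (congrArg Subtype.val h)
  have hirr : (orbitSpan ρ y).toRepresentation.IsIrreducible := by
    have : Nontrivial (Subrepresentation (orbitSpan ρ y).toRepresentation) := by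
      refine ⟨⊥, ⊤, fun h => ?_⟩
      have h1 : (⊥ : Submodule ℝ (orbitSpan ρ y).toSubmodule) = ⊤ :=
        congrArg Subrepresentation.toSubmodule h
      have h2 : (⟨y, mem_orbitSpan ρ y⟩ : (orbitSpan ρ y).toSubmodule) ∈
        (⊥ : Submodule ℝ (orbitSpan ρ y).toSubmodule) := by
        rw [h1]
        exact Submodule.mem_top
      exact hyne ((Submodule.mem_bot ℝ).mp h2)
    refine ⟨fun S => ?_⟩
    by_cases hS : S.toSubmodule = ⊥
    · exact Or.inl (Subrepresentation.toSubmodule_injective hS)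
    right
    obtain ⟨z, hz, hz0⟩ := Submodule.exists_mem_ne_zero_of_ne_bot hS
    have hzy := orbitSpan_le z.2
    have hfin : Module.finrank ℝ (orbitSpan ρ y).toSubmodule
        ≤ Module.finrank ℝ (orbitSpan ρ (z : X)).toSubmodule := by
      rw [hn]
      exact Nat.find_min' hex ⟨z, orbitSpan_le hy z.2, fun h => hz0 (Subtype.ext h), rfl⟩
    have heq := Submodule.eq_of_le_of_finrank_le hzy hfin
    apply Subrepresentation.toSubmodule_injective
    refine Submodule.eq_top_iff'.mpr fun u => ?_
    have hu : (u : X) ∈ (orbitSpan ρ (z : X)).toSubmodule := by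
      rw [heq]
      exact u.2
    have hle : (orbitSpan ρ (z : X)).toSubmodule
        ≤ S.toSubmodule.map (orbitSpan ρ y).toSubmodule.subtype := by
      refine Submodule.span_le.mpr ?_
      rintro _ ⟨w, rfl⟩
      exact ⟨_, S.apply_mem_toSubmodule w hz, rfl⟩
    obtain ⟨u', hu', he⟩ := hle hu
    rwa [Subtype.ext he] at hu'
  obtain ⟨j, hj⟩ := exists_hasCharacter hirr
  by_cases hij : i = j
  · rwa [hij]
  -- Under any other label the projection would kill `y`, although it fixes the whole orbit span of
  -- `x`.
  · have h1 : ((isotypicProj i (orbitSpan ρ y).toRepresentation ⟨y, mem_orbitSpan ρ y⟩ :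
        (orbitSpan ρ y).toSubmodule) : X) = isotypicProj i ρ y := by
      rw [isotypicProj_apply, isotypicProj_apply, Submodule.coe_sum]
      rfl
    rw [hj.isotypicProj_eq, if_neg hij, LinearMap.zero_apply, Submodule.coe_zero,
      isotypicProj_orbitSpan hx hy] at h1
    exact absurd h1.symm hy0

end Representations

/-! ### The action on the roots -/

theorem root_ne_neg_root (a b : Fin 15) : root a ≠ - root b := by
  intro h
  have h1 := root_dotProduct_pos a
  have h2 := root_dotProduct_pos b
  rw [h, neg_dotProduct] at h1
  linarith

/-- The finite check `reflZ_mulVec_rootZ` handles the generators, and closure induction the rest. -/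
theorem exists_mulVec_root (w : H3) (a : Fin 15) :
    ∃ b, (toMat w).mulVec (root a) = root b ∨ (toMat w).mulVec (root a) = - root b := by
  have hrefl (a b : Fin 15) : ∃ c, (reflMatrix (root a)).mulVec (root b) = root c ∨
      (reflMatrix (root a)).mulVec (root b) = - root c := by
    have hm (i : Fin 3) : goldHom ((reflZ a).mulVec (rootZ b) i)
        = 2 * (reflMatrix (root a)).mulVec (root b) i := by
      have h1 (k : Fin 3) : goldHom (reflZ a i k) = 2 * reflMatrix (root a) i k :=
        congrFun (congrFun (isDouble_reflMatrix a) i) k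
      simp only [Matrix.mulVec, dotProduct, map_sum, map_mul, h1, mul_assoc, Finset.mul_sum, root]
    obtain ⟨c, h | h⟩ := reflZ_mulVec_rootZ a b
    · refine ⟨c, Or.inl (funext fun i => ?_)⟩
      have h2 := hm i
      rw [h, Pi.smul_apply, two_smul, map_add] at h2
      change _ = goldHom (rootZ c i)
      linarith
    · refine ⟨c, Or.inr (funext fun i => ?_)⟩
      have h2 := hm i
      rw [h, Pi.neg_apply, Pi.smul_apply, two_smul, map_neg, map_add] at h2
      change _ = - goldHom (rootZ c i)
      linarith
  have key : ∀ v ∈ roots, ∀ g : Matrix (Fin 3) (Fin 3) ℝ,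
      (∃ b, g.mulVec (root a) = root b ∨ g.mulVec (root a) = - root b) →
      ∃ b, (reflMatrix v * g).mulVec (root a) = root b ∨
        (reflMatrix v * g).mulVec (root a) = - root b := by
    rintro v hv g ⟨b, h⟩
    obtain ⟨c, hc⟩ : ∃ c, reflMatrix v = reflMatrix (root c) := by
      obtain ⟨a, rfl | rfl⟩ := (mem_roots_iff v).mp hv
      · exact ⟨a, rfl⟩
      · exact ⟨a, reflMatrix_neg _⟩
    obtain ⟨d, hd⟩ := hrefl c b
    refine ⟨d, ?_⟩
    rw [hc, ← Matrix.mulVec_mulVec]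
    rcases h with h | h <;> rcases hd with hd | hd <;> rw [h] <;>
      simp [Matrix.mulVec_neg, hd]
  obtain ⟨g, hg⟩ := w
  change ∃ b, g.1.mulVec (root a) = root b ∨ g.1.mulVec (root a) = - root b
  induction hg using Subgroup.closure_induction_left with
  | one => exact ⟨a, Or.inl (Matrix.one_mulVec _)⟩
  | mul_left x hx y hy ih =>
    obtain ⟨v, hv, rfl⟩ := hx
    exact key v hv _ ih
  | inv_mul_cancel x hx y hy ih =>
    obtain ⟨v, hv, rfl⟩ := hx
    exact key v hv _ ih

/-- The elements of the group permute the positive roots up to sign. -/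
theorem exists_perm_mulVec_root (w : H3) : ∃ π : Equiv.Perm (Fin 15), ∀ a,
    (toMat w).mulVec (root a) = root (π a) ∨ (toMat w).mulVec (root a) = - root (π a) := by
  choose f hf using exists_mulVec_root w
  have hinj : Function.Injective f := by
    intro a b hab
    have hcancel {x y : Fin 3 → ℝ} (h : (toMat w).mulVec x = (toMat w).mulVec y) : x = y := by
      have := congrArg (toMat w).transpose.mulVec h
      rwa [Matrix.mulVec_mulVec, Matrix.mulVec_mulVec, transpose_mul_toMat, Matrix.one_mulVec,
        Matrix.one_mulVec] at this
    have h : (toMat w).mulVec (root a) = (toMat w).mulVec (root b) ∨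
        (toMat w).mulVec (root a) = (toMat w).mulVec (- root b) := by
      rw [Matrix.mulVec_neg]
      rcases hf a with ha | ha <;> rcases hf b with hb | hb <;> rw [ha, hb, hab] <;> simp
    rcases h with h | h
    · exact root_injective (hcancel h)
    · exact absurd (hcancel h) (root_ne_neg_root a b)
  exact ⟨Equiv.ofBijective f (Finite.injective_iff_bijective.mp hinj), hf⟩

theorem conj_reflMatrix (w : H3) (v : Fin 3 → ℝ) (hv : v ⬝ᵥ v = 4) :
    toMat w * reflMatrix v = (1 - (1 / 2 : ℝ) • Matrix.vecMulVec ((toMat w).mulVec v)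
      ((toMat w).mulVec v)) * toMat w := by
  rw [reflMatrix, hv, mul_sub, sub_mul, mul_one, one_mul, mul_smul_comm, smul_mul_assoc,
    Matrix.mul_vecMulVec, Matrix.vecMulVec_mul]
  have h : Matrix.vecMul ((toMat w).mulVec v) (toMat w) = v := by
    rw [← Matrix.mulVec_transpose, Matrix.mulVec_mulVec, transpose_mul_toMat, Matrix.one_mulVec]
  rw [h]
  norm_num

/-- Conjugating a reflection moves its root, and the sign of a root does not affect its reflection.
-/
theorem mul_reflection (w : H3) {a b : Fin 15}
    (h : (toMat w).mulVec (root a) = root b ∨ (toMat w).mulVec (root a) = - root b) :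
    w * reflection a = reflection b * w := by
  apply toMat_injective
  rw [toMat_mul, toMat_mul, toMat_reflection, toMat_reflection,
    conj_reflMatrix w _ (root_dotProduct_self a), reflMatrix, root_dotProduct_self]
  rcases h with h | h <;> rw [h] <;> norm_num [Matrix.neg_vecMulVec, Matrix.vecMulVec_neg]

/-! ### The sum of the reflections -/

section Representations

variable {X V : Type*} [AddCommGroup X] [Module ℝ X] [AddCommGroup V] [Module ℝ V]
  {τ : Representation ℝ H3 V} {j : Irrep}

/-- The sum of the actions of the reflections. -/
def reflSum (ρ : Representation ℝ H3 X) : X →ₗ[ℝ] X := ∑ a, ρ (reflection a)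

/-- The scalar by which the sum of the reflections acts on the irreducible representation. -/
def Irrep.content (i : Irrep) : ℝ := 15 * i.chi 2 / i.chi 0

theorem reflSum_apply (ρ : Representation ℝ H3 X) (x : X) :
    reflSum ρ x = ∑ a, ρ (reflection a) x := by
  simp [reflSum]

theorem reflSum_comm (ρ : Representation ℝ H3 X) (w : H3) (x : X) :
    reflSum ρ (ρ w x) = ρ w (reflSum ρ x) := by
  obtain ⟨π, hπ⟩ := exists_perm_mulVec_root w
  simp only [reflSum_apply, map_sum]
  rw [← Equiv.sum_comp π]
  refine Finset.sum_congr rfl fun a _ => ?_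
  rw [← Module.End.mul_apply, ← map_mul, ← mul_reflection w (hπ a), map_mul, Module.End.mul_apply]

/-- The sum is central, hence a scalar, and all 15 reflections have the same trace. -/
theorem HasCharacter.reflSum_eq [FiniteDimensional ℝ V] (h : HasCharacter τ j) :
    reflSum τ = j.content • 1 := by
  rw [h.eq_smul_one _ (reflSum_comm τ)]
  congr 1
  have h1 (a : Fin 15) : LinearMap.trace ℝ V (τ (reflection a)) = j.chi 2 := by
    rw [← classOf_reflection a]
    exact hasCharacter_iff.mp h _
  simp [reflSum, h1, Irrep.content]

theorem reflSum_isotypicProj (ρ : Representation ℝ H3 X) (j : Irrep) (x : X) :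
    reflSum ρ (isotypicProj j ρ x) = j.content • isotypicProj j ρ x := by
  obtain ⟨n, ω, hω⟩ := exists_representation j
  have h := sum_smul_isotypicProj (fun _ => (1 : ℝ)) reflection hω
    (by simpa [reflSum] using hω.reflSum_eq) ρ x
  simpa [reflSum_apply] using h

end Representations

end

noncomputable section

/-! ### Relations between the Dunkl operators and the multiplications -/

section Dunkl

variable {V : Type*} [AddCommGroup V] [Module ℝ V] (τ : Representation ℝ H3 V) (κ : ℝ)

-- Constants and multiplications generate everything, so operator identities are checked on
-- constants and propagated through commutators with the coordinates.
@[elab_as_elim]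
theorem vec_induction {p : Poly ⊗[ℝ] V → Prop} (f : Poly ⊗[ℝ] V) (const : ∀ u, p (const V u))
    (add : ∀ f g, p f → p g → p (f + g)) (mulX : ∀ i f, p f → p (mulX V i f)) : p f := by
  induction f using TensorProduct.induction_on with
  | zero => simpa using const 0
  | add f g hf hg => exact add f g hf hg
  | tmul q u =>
    induction q using MvPolynomial.induction_on with
    | C a =>
      have h : (C a : Poly) ⊗ₜ[ℝ] u = Icosahedral.const V (a • u) := by
        rw [← mul_one (C a), ← smul_eq_C_mul, TensorProduct.smul_tmul]
        rfl
      rw [h]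
      exact const _
    | add q q' hq hq' =>
      rw [TensorProduct.add_tmul]
      exact add _ _ hq hq'
    | mul_X q i hq =>
      have h : (q * X i) ⊗ₜ[ℝ] u = Icosahedral.mulX V i (q ⊗ₜ u) := by
        simp [Icosahedral.mulX, mul_comm]
      rw [h]
      exact mulX i _ hq

theorem mulX_mulX (i j : Fin 3) (f : Poly ⊗[ℝ] V) :
    mulX V i (mulX V j f) = mulX V j (mulX V i f) := by
  induction f using TensorProduct.induction_on with
  | zero => simp
  | add f g hf hg => simp only [map_add, hf, hg]
  | tmul q u => simp [mulX, mul_left_comm]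

theorem vecRep_tmul (w : H3) (q : Poly) (u : V) :
    vecRep τ w (q ⊗ₜ u) = subst (toMat w) q ⊗ₜ τ w u := rfl

theorem vecRep_const (w : H3) (u : V) : vecRep τ w (const V u) = const V (τ w u) := by
  change vecRep τ w (1 ⊗ₜ u) = _
  rw [vecRep_tmul, map_one]
  rfl

theorem vecRep_mulX (w : H3) (j : Fin 3) (f : Poly ⊗[ℝ] V) :
    vecRep τ w (mulX V j f) = ∑ i, toMat w i j • mulX V i (vecRep τ w f) := by
  induction f using TensorProduct.induction_on with
  | zero => simp
  | add f g hf hg => simp only [map_add, hf, hg, smul_add, Finset.sum_add_distrib]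
  | tmul q u =>
    have h : mulX V j (q ⊗ₜ u) = (X j * q) ⊗ₜ u := by simp [mulX]
    rw [h, vecRep_tmul, vecRep_tmul, map_mul]
    have hX : subst (toMat w) (X j) = ∑ i, C (toMat w i j) * X i := by simp [subst]
    rw [hX, Finset.sum_mul, TensorProduct.sum_tmul]
    refine Finset.sum_congr rfl fun i _ => ?_
    simp [mulX, ← smul_eq_C_mul, TensorProduct.smul_tmul']

/-- A twisted Leibniz rule: the divided difference of a coordinate is constant. -/
theorem divDiff_X_mul {v : Fin 3 → ℝ} (hv : v ≠ 0) (j : Fin 3) (p : Poly) :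
    divDiff v (X j * p) = X j * divDiff v p
      + (2 / (v ⬝ᵥ v) * v j) • subst (reflMatrix v) p := by
  apply mul_left_cancel₀ (linForm_ne_zero hv)
  have hX : X j - subst (reflMatrix v) (X j) = linForm v * C (2 / (v ⬝ᵥ v) * v j) := by
    have h0 : (∑ i, C ((1 : Matrix (Fin 3) (Fin 3) ℝ) i j) * X i : Poly) = X j := by
      simp [Matrix.one_apply]
    simp only [subst, aeval_X, reflMatrix, Matrix.sub_apply, Matrix.smul_apply,
      Matrix.vecMulVec_apply, smul_eq_mul, map_sub, sub_mul, Finset.sum_sub_distrib, h0,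
      sub_sub_cancel, linForm, Finset.sum_mul]
    refine Finset.sum_congr rfl fun i _ => ?_
    simp only [map_mul]
    ring
  rw [mul_add, mul_left_comm, linForm_mul_divDiff hv, linForm_mul_divDiff hv, smul_eq_C_mul,
    ← mul_assoc, ← hX, map_mul]
  ring

theorem root_ne_zero (a : Fin 15) : root a ≠ 0 := by
  intro h
  have := root_dotProduct_self a
  rw [h, zero_dotProduct] at this
  norm_num at this

theorem dunkl_tmul (i : Fin 3) (q : Poly) (u : V) : dunkl τ κ i (q ⊗ₜ u) = pderiv i q ⊗ₜ u
    + κ • ∑ a, root a i • (divDiff (root a) q ⊗ₜ τ (reflection a) u) := by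
  simp only [dunkl, LinearMap.add_apply, LinearMap.smul_apply, LinearMap.sum_apply,
    TensorProduct.map_tmul]
  rw [← Equiv.sum_comp rootEquiv]
  simp [TensorProduct.smul_tmul', reflection]

theorem dunkl_const (i : Fin 3) (u : V) : dunkl τ κ i (const V u) = 0 := by
  have h (a : Fin 15) : divDiff (root a) (1 : Poly) = 0 := by
    apply mul_left_cancel₀ (linForm_ne_zero (root_ne_zero a))
    rw [linForm_mul_divDiff (root_ne_zero a), map_one, sub_self, mul_zero]
  change dunkl τ κ i (1 ⊗ₜ u) = 0
  rw [dunkl_tmul]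
  simp [h]

/-- The commutator of a Dunkl operator and the multiplication by a coordinate. -/
def bracket (i j : Fin 3) : Poly ⊗[ℝ] V →ₗ[ℝ] Poly ⊗[ℝ] V :=
  (1 : Matrix (Fin 3) (Fin 3) ℝ) i j • 1
    + (κ / 2) • ∑ a, (root a i * root a j) • vecRep τ (reflection a)

theorem bracket_apply (i j : Fin 3) (f : Poly ⊗[ℝ] V) : bracket τ κ i j f =
    (1 : Matrix (Fin 3) (Fin 3) ℝ) i j • f
      + (κ / 2) • ∑ a, (root a i * root a j) • vecRep τ (reflection a) f := by
  simp [bracket]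

theorem bracket_symm (i j : Fin 3) : bracket τ κ i j = bracket τ κ j i := by
  simp only [bracket, mul_comm (root _ i)]
  rw [← Matrix.transpose_apply 1 i j, Matrix.transpose_one]

/-- The defining relation of the rational Cherednik algebra. The factor κ/2 in `bracket` is 2κ/⟨v,
v⟩ with ⟨v, v⟩ = 4. -/
theorem dunkl_mulX (i j : Fin 3) (f : Poly ⊗[ℝ] V) :
    dunkl τ κ i (mulX V j f) = mulX V j (dunkl τ κ i f) + bracket τ κ i j f := by
  induction f using TensorProduct.induction_on with
  | zero => simp
  | add f g hf hg =>
    simp only [map_add, hf, hg]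
    abel
  | tmul q u =>
    have hx (q : Poly) (u : V) : mulX V j (q ⊗ₜ u) = (X j * q) ⊗ₜ u := by simp [mulX]
    rw [bracket_apply, hx, dunkl_tmul, dunkl_tmul, map_add, map_smul, map_sum, hx, Derivation.leibniz]
    simp only [map_smul, hx, divDiff_X_mul (root_ne_zero _), TensorProduct.add_tmul, smul_add,
      Finset.sum_add_distrib, root_dotProduct_self, vecRep_tmul, toMat_reflection, smul_eq_mul]
    have h1 : (q * pderiv i (X j)) ⊗ₜ[ℝ] u
        = (1 : Matrix (Fin 3) (Fin 3) ℝ) i j • (q ⊗ₜ[ℝ] u) := by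
      rw [pderiv_X, Matrix.one_apply]
      by_cases h : i = j
      · subst h; simp
      · simp [h, Ne.symm h]
    have h2 (a : Fin 15) : root a i • ((2 / 4 * root a j) • subst (reflMatrix (root a)) q)
          ⊗ₜ[ℝ] τ (reflection a) u
        = (1 / 2 : ℝ) • (root a i * root a j) • subst (reflMatrix (root a)) q
          ⊗ₜ[ℝ] τ (reflection a) u := by
      rw [← TensorProduct.smul_tmul', smul_smul, smul_smul]
      congr 1
      ring
    simp only [h1, h2]
    rw [← Finset.smul_sum (r := (1 / 2 : ℝ)), smul_smul κ, mul_one_div]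
    abel

/-- The roots enter quadratically, so a permutation of the positive roots up to sign leaves the sum
covariant. -/
theorem bracket_conj (w : H3) (j k : Fin 3) (f : Poly ⊗[ℝ] V) :
    vecRep τ w (bracket τ κ j k f)
      = ∑ i, ∑ l, (toMat w i j * toMat w l k) • bracket τ κ i l (vecRep τ w f) := by
  obtain ⟨π, hπ⟩ := exists_perm_mulVec_root w
  simp only [bracket_apply, map_add, map_smul, map_sum, smul_add, Finset.sum_add_distrib]
  congr 1
  · have h := congrFun (congrFun (transpose_mul_toMat w) j) k
    rw [← h, Matrix.mul_apply]
    simp only [Matrix.transpose_apply, Matrix.one_apply, smul_ite, smul_zero, one_smul,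
      ite_smul, zero_smul, Finset.sum_ite_eq, Finset.mem_univ, if_true, Finset.sum_smul]
  · have h1 (a : Fin 15) : (root a j * root a k) • vecRep τ w (vecRep τ (reflection a) f)
        = ∑ i, ∑ l, (toMat w i j * toMat w l k) • (root (π a) i * root (π a) l) •
          vecRep τ (reflection (π a)) (vecRep τ w f) := by
      have hc : vecRep τ w (vecRep τ (reflection a) f)
          = vecRep τ (reflection (π a)) (vecRep τ w f) := by
        rw [← Module.End.mul_apply, ← map_mul, mul_reflection w (hπ a), map_mul,
          Module.End.mul_apply]
      have hs (m : Fin 3) : ((toMat w).transpose.mulVec ((toMat w).mulVec (root a))) m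
          = root a m := by
        rw [Matrix.mulVec_mulVec, transpose_mul_toMat, Matrix.one_mulVec]
      have hjk : (∑ i, toMat w i j * root (π a) i) * (∑ l, toMat w l k * root (π a) l)
          = root a j * root a k := by
        have hj := hs j
        have hk := hs k
        rcases hπ a with h | h <;> rw [h] at hj hk
        · rw [← hj, ← hk]
          simp only [Matrix.mulVec, dotProduct, Matrix.transpose_apply]
        · rw [Matrix.mulVec_neg, Pi.neg_apply] at hj hk
          rw [← hj, ← hk]
          simp only [Matrix.mulVec, dotProduct, Matrix.transpose_apply, neg_mul_neg]
      rw [hc, ← hjk, Finset.sum_mul_sum]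
      simp only [Finset.sum_smul, smul_smul]
      refine Finset.sum_congr rfl fun i _ => Finset.sum_congr rfl fun l _ => ?_
      congr 1
      ring
    simp only [h1]
    rw [Equiv.sum_comp π fun b => ∑ i, ∑ l, (toMat w i j * toMat w l k) •
      (root b i * root b l) • vecRep τ (reflection b) (vecRep τ w f), Finset.sum_comm,
      Finset.smul_sum]
    refine Finset.sum_congr rfl fun i _ => ?_
    rw [Finset.sum_comm, Finset.smul_sum]
    refine Finset.sum_congr rfl fun l _ => ?_
    rw [← Finset.smul_sum, smul_comm]

theorem vecRep_dunkl (w : H3) (j : Fin 3) (f : Poly ⊗[ℝ] V) :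
    vecRep τ w (dunkl τ κ j f) = ∑ i, toMat w i j • dunkl τ κ i (vecRep τ w f) := by
  induction f using vec_induction generalizing j with
  | const u => simp [dunkl_const, vecRep_const]
  | add f g hf hg => simp only [map_add, hf, hg, smul_add, Finset.sum_add_distrib]
  | mulX k f hf =>
    have h1 (i : Fin 3) : toMat w i j • dunkl τ κ i (vecRep τ w (mulX V k f))
        = ∑ l, (toMat w l k • mulX V l (toMat w i j • dunkl τ κ i (vecRep τ w f))
          + (toMat w i j * toMat w l k) • bracket τ κ i l (vecRep τ w f)) := by
      rw [vecRep_mulX, map_sum, Finset.smul_sum]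
      refine Finset.sum_congr rfl fun l _ => ?_
      rw [map_smul, map_smul, dunkl_mulX, smul_add, smul_add, smul_comm (toMat w i j),
        smul_smul (toMat w i j) _ (bracket _ _ _ _ _)]
    simp only [h1, Finset.sum_add_distrib]
    rw [dunkl_mulX, map_add, vecRep_mulX, hf, bracket_conj]
    simp only [map_sum, Finset.smul_sum]
    rw [Finset.sum_comm]

theorem toMat_reflection_apply (a : Fin 15) (i j : Fin 3) : toMat (reflection a) i j
    = (1 : Matrix (Fin 3) (Fin 3) ℝ) i j - root a j / 2 * root a i := by
  rw [toMat_reflection, reflMatrix, root_dotProduct_self]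
  simp only [Matrix.sub_apply, Matrix.smul_apply, Matrix.vecMulVec_apply, smul_eq_mul]
  ring

theorem sum_toMat_reflection_smul {M : Type*} [AddCommGroup M] [Module ℝ M] (a : Fin 15)
    (j : Fin 3) (F : Fin 3 → M) : ∑ i, toMat (reflection a) i j • F i
      = F j - (root a j / 2) • ∑ i, root a i • F i := by
  simp only [toMat_reflection_apply, sub_smul, Finset.sum_sub_distrib, Matrix.one_apply, ite_smul,
    one_smul, zero_smul, Finset.sum_ite_eq', Finset.mem_univ, if_true, Finset.smul_sum, smul_smul]

/-- The commutator of `bracket τ κ i k` with 𝒟ⱼ has coefficients vᵢ vⱼ vₖ, symmetric in `i` and `j`.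
This is the obstruction met in the induction for `dunkl_dunkl`. -/
theorem bracket_dunkl (i j k : Fin 3) (f : Poly ⊗[ℝ] V) :
    bracket τ κ i k (dunkl τ κ j f) + dunkl τ κ i (bracket τ κ j k f)
      = bracket τ κ j k (dunkl τ κ i f) + dunkl τ κ j (bracket τ κ i k f) := by
  have h (i j : Fin 3) : bracket τ κ i k (dunkl τ κ j f) = dunkl τ κ j (bracket τ κ i k f)
      - (κ / 2) • ∑ a, (root a i * root a j * root a k / 2) •
        ∑ l, root a l • dunkl τ κ l (vecRep τ (reflection a) f) := by
    have h1 : ∑ a, (root a i * root a k) • vecRep τ (reflection a) (dunkl τ κ j f)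
        = ∑ a, (root a i * root a k) • dunkl τ κ j (vecRep τ (reflection a) f)
          - ∑ a, (root a i * root a j * root a k / 2) •
            ∑ l, root a l • dunkl τ κ l (vecRep τ (reflection a) f) := by
      rw [← Finset.sum_sub_distrib]
      refine Finset.sum_congr rfl fun a _ => ?_
      rw [vecRep_dunkl,
        sum_toMat_reflection_smul a j fun l => dunkl τ κ l (vecRep τ (reflection a) f),
        smul_sub, smul_smul]
      congr 2
      ring
    rw [bracket_apply, bracket_apply, h1, smul_sub, map_add, map_smul, map_smul, map_sum]
    simp only [map_smul]
    abel
  rw [h i j, h j i]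
  simp only [mul_comm (root _ i) (root _ j)]
  abel

theorem dunkl_dunkl (i j : Fin 3) (f : Poly ⊗[ℝ] V) :
    dunkl τ κ i (dunkl τ κ j f) = dunkl τ κ j (dunkl τ κ i f) := by
  induction f using vec_induction with
  | const u => simp [dunkl_const]
  | add f g hf hg => simp only [map_add, hf, hg]
  | mulX k f hf =>
    simp only [dunkl_mulX, map_add, hf, add_assoc]
    rw [bracket_dunkl]

/-! ### Homogeneous components -/

/-- The homogeneous polynomials of degree `n` with values in `V`. -/
def homog (V : Type*) [AddCommGroup V] [Module ℝ V] : ℕ → Submodule ℝ (Poly ⊗[ℝ] V)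
  | 0 => LinearMap.range (const V)
  | n + 1 => ⨆ i, (homog V n).map (mulX V i)

theorem mulX_mem_homog {n : ℕ} {f : Poly ⊗[ℝ] V} (hf : f ∈ homog V n) (i : Fin 3) :
    mulX V i f ∈ homog V (n + 1) :=
  Submodule.mem_iSup_of_mem i (Submodule.mem_map_of_mem hf)

@[elab_as_elim]
theorem homog_induction {p : ∀ (n : ℕ) (f : Poly ⊗[ℝ] V), f ∈ homog V n → Prop}
    (const : ∀ u, p 0 (const V u) ⟨u, rfl⟩)
    (add : ∀ n f g hf hg, p (n + 1) f hf → p (n + 1) g hg → p (n + 1) (f + g) (add_mem hf hg))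
    (mulX : ∀ n i f hf, p n f hf → p (n + 1) (mulX V i f) (mulX_mem_homog hf i))
    {n : ℕ} {f : Poly ⊗[ℝ] V} (hf : f ∈ homog V n) : p n f hf := by
  induction n generalizing f with
  | zero =>
    obtain ⟨u, rfl⟩ := hf
    exact const u
  | succ n ih =>
    refine Submodule.iSup_induction' _ (motive := fun f hf => p (n + 1) f hf) ?_ ?_ ?_ hf
    · rintro i _ ⟨f, hf, rfl⟩
      exact mulX n i f hf (ih hf)
    · have h := mulX n 0 0 (zero_mem _) (ih (zero_mem _))
      simpa using h
    · exact fun f g hf hg => add n f g hf hg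

theorem vecRep_mem_homog {n : ℕ} {f : Poly ⊗[ℝ] V} (hf : f ∈ homog V n) (w : H3) :
    vecRep τ w f ∈ homog V n := by
  induction hf using homog_induction with
  | const u =>
    rw [vecRep_const]
    exact ⟨_, rfl⟩
  | add n f g _ _ hf hg =>
    rw [map_add]
    exact add_mem hf hg
  | mulX n i f _ hf =>
    rw [vecRep_mulX]
    exact sum_mem fun j _ => Submodule.smul_mem _ _ (mulX_mem_homog hf j)

theorem isotypicProj_mem_homog {n : ℕ} {f : Poly ⊗[ℝ] V} (hf : f ∈ homog V n) (j : Irrep) :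
    isotypicProj j (vecRep τ) f ∈ homog V n := by
  rw [isotypicProj_apply]
  exact sum_mem fun w _ => Submodule.smul_mem _ _ (vecRep_mem_homog τ hf w)

theorem bracket_mem_homog {n : ℕ} {f : Poly ⊗[ℝ] V} (hf : f ∈ homog V n) (i j : Fin 3) :
    bracket τ κ i j f ∈ homog V n := by
  rw [bracket_apply]
  exact add_mem (Submodule.smul_mem _ _ hf) (Submodule.smul_mem _ _
    (sum_mem fun a _ => Submodule.smul_mem _ _ (vecRep_mem_homog τ hf _)))

/-- The truncated subtraction is harmless, since Dunkl operators vanish in degree 0. -/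
theorem dunkl_mem_homog {n : ℕ} {f : Poly ⊗[ℝ] V} (hf : f ∈ homog V n) (i : Fin 3) :
    dunkl τ κ i f ∈ homog V (n - 1) := by
  induction hf using homog_induction with
  | const u =>
    rw [dunkl_const]
    exact zero_mem _
  | add n f g _ _ hf hg =>
    rw [map_add]
    exact add_mem hf hg
  | mulX n j f hf ih =>
    rw [dunkl_mulX]
    refine add_mem ?_ (bracket_mem_homog τ κ hf i j)
    cases n with
    | zero =>
      obtain ⟨u, rfl⟩ := hf
      rw [dunkl_const, map_zero]
      exact zero_mem _
    | succ n => exact mulX_mem_homog ih j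

theorem iSup_homog : ⨆ n, homog V n = ⊤ := by
  refine Submodule.eq_top_iff'.mpr fun f => ?_
  induction f using vec_induction with
  | const u => exact Submodule.mem_iSup_of_mem 0 ⟨u, rfl⟩
  | add f g hf hg => exact add_mem hf hg
  | mulX i f hf =>
    induction hf using Submodule.iSup_induction' with
    | mem n f hf => exact Submodule.mem_iSup_of_mem (n + 1) (mulX_mem_homog hf i)
    | zero =>
      rw [map_zero]
      exact zero_mem _
    | add f g _ _ hf hg =>
      rw [map_add]
      exact add_mem hf hg

/-- The Euler operator, corrected by the sum of the reflections. -/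
def euler : Poly ⊗[ℝ] V →ₗ[ℝ] Poly ⊗[ℝ] V :=
  ∑ i, mulX V i ∘ₗ dunkl τ κ i + κ • reflSum (vecRep τ)

theorem euler_apply (f : Poly ⊗[ℝ] V) : euler τ κ f
    = ∑ i, mulX V i (dunkl τ κ i f) + κ • ∑ a, vecRep τ (reflection a) f := by
  simp [euler, reflSum_apply]

theorem euler_const (u : V) : euler τ κ (const V u) = κ • const V (reflSum τ u) := by
  simp [euler_apply, dunkl_const, vecRep_const, reflSum_apply]

/-- The reflection terms of the commutators [𝒟ᵢ, xⱼ] cancel against those from moving xⱼ past the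
sum of the reflections; only the grading remains. -/
theorem euler_mulX (j : Fin 3) (f : Poly ⊗[ℝ] V) :
    euler τ κ (mulX V j f) = mulX V j (euler τ κ f) + mulX V j f := by
  simp only [euler_apply, dunkl_mulX, map_add, Finset.sum_add_distrib, map_sum, map_smul,
    vecRep_mulX, mulX_mulX _ j, bracket_apply]
  have h1 : ∑ i, (1 : Matrix (Fin 3) (Fin 3) ℝ) i j • mulX V i f = mulX V j f := by
    simp [Matrix.one_apply, ite_smul]
  have h2 : ∑ i, (κ / 2) • ∑ a, (root a i * root a j) • mulX V i (vecRep τ (reflection a) f)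
      = κ • ∑ a, (root a j / 2) • ∑ i, root a i • mulX V i (vecRep τ (reflection a) f) := by
    simp only [Finset.smul_sum, smul_smul]
    rw [Finset.sum_comm]
    refine Finset.sum_congr rfl fun a _ => Finset.sum_congr rfl fun i _ => ?_
    congr 1
    ring
  have h3 : ∑ a, ∑ i, toMat (reflection a) i j • mulX V i (vecRep τ (reflection a) f)
      = ∑ a, mulX V j (vecRep τ (reflection a) f)
        - ∑ a, (root a j / 2) • ∑ i, root a i • mulX V i (vecRep τ (reflection a) f) := by
    rw [← Finset.sum_sub_distrib]
    exact Finset.sum_congr rfl fun a _ =>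
      sum_toMat_reflection_smul a j fun l => mulX V l (vecRep τ (reflection a) f)
  rw [h1, h2, h3, smul_sub]
  abel

theorem euler_homog {c : ℝ} (hc : reflSum τ = c • 1) {n : ℕ} {f : Poly ⊗[ℝ] V}
    (hf : f ∈ homog V n) : euler τ κ f = (n + κ * c) • f := by
  induction hf using homog_induction with
  | const u =>
    rw [euler_const, hc]
    simp [mul_smul]
  | add n f g _ _ hf hg => rw [map_add, hf, hg, smul_add]
  | mulX n i f _ hf =>
    rw [euler_mulX, hf, map_smul]
    push_cast
    module

/-- For κ = 0 this is the degree operator, with no hypothesis on `τ`; it serves to show that the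
degrees are independent. -/
theorem euler_zero_homog {n : ℕ} {f : Poly ⊗[ℝ] V} (hf : f ∈ homog V n) :
    euler τ 0 f = (n : ℝ) • f := by
  induction hf using homog_induction with
  | const u => simp [euler_const]
  | add n f g _ _ hf hg => rw [map_add, hf, hg, smul_add]
  | mulX n i f _ hf =>
    rw [euler_mulX, hf, map_smul]
    push_cast
    module

end Dunkl

end

noncomputable section

/-! ### Linear maps determined by constants and multiplications -/

section Forms

variable {V : Type*} [AddCommGroup V] [Module ℝ V] {N : Type*} [AddCommGroup N] [Module ℝ N]

-- Commuting operators generate a commutative subalgebra, into which the polynomial ring can be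
-- evaluated.
open scoped IsMulCommutative in
theorem exists_algHom_end (A : Fin 3 → Module.End ℝ N) (hA : ∀ i j, A i * A j = A j * A i) :
    ∃ e : Poly →ₐ[ℝ] Module.End ℝ N, ∀ i, e (X i) = A i := by
  have : IsMulCommutative (Algebra.adjoin ℝ (Set.range A)) :=
    Algebra.isMulCommutative_adjoin ℝ (by
      rintro _ ⟨i, rfl⟩ _ ⟨j, rfl⟩
      exact hA i j)
  exact ⟨(Algebra.adjoin ℝ (Set.range A)).val.comp
    (aeval fun i => ⟨A i, Algebra.subset_adjoin ⟨i, rfl⟩⟩), fun i => by simp⟩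

/-- The universal property of a free module over the polynomials. It produces the value at the
origin, the contravariant form and the exponential of the Laplacian. -/
theorem exists_vec_hom (A : Fin 3 → Module.End ℝ N) (hA : ∀ i j, A i * A j = A j * A i)
    (c : V →ₗ[ℝ] N) : ∃ F : Poly ⊗[ℝ] V →ₗ[ℝ] N,
      (∀ u, F (const V u) = c u) ∧ ∀ i f, F (mulX V i f) = A i (F f) := by
  obtain ⟨e, he⟩ := exists_algHom_end A hA
  refine ⟨TensorProduct.lift ((LinearMap.lcomp ℝ N c) ∘ₗ e.toLinearMap), fun u => ?_, fun i f => ?_⟩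
  · change e 1 (c u) = c u
    rw [map_one]
    rfl
  · induction f using TensorProduct.induction_on with
    | zero => simp
    | add f g hf hg => simp only [map_add, hf, hg]
    | tmul q u =>
      change e (X i * q) (c u) = A i (e q (c u))
      rw [map_mul, he]
      rfl

variable (τ : Representation ℝ H3 V) (κ : ℝ)

/-- The value at the origin. -/
def evalZero (V : Type*) [AddCommGroup V] [Module ℝ V] : Poly ⊗[ℝ] V →ₗ[ℝ] V :=
  (exists_vec_hom (fun _ => 0) (fun _ _ => rfl) LinearMap.id).choose

theorem evalZero_const (u : V) : evalZero V (const V u) = u :=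
  (exists_vec_hom (fun _ => 0) (fun _ _ => rfl) LinearMap.id).choose_spec.1 u

theorem evalZero_mulX (i : Fin 3) (f : Poly ⊗[ℝ] V) : evalZero V (mulX V i f) = 0 :=
  (exists_vec_hom (fun _ => 0) (fun _ _ => rfl) LinearMap.id).choose_spec.2 i f

theorem evalZero_vecRep (w : H3) (f : Poly ⊗[ℝ] V) :
    evalZero V (vecRep τ w f) = τ w (evalZero V f) := by
  induction f using vec_induction with
  | const u => rw [vecRep_const, evalZero_const, evalZero_const]
  | add f g hf hg => simp only [map_add, hf, hg]
  | mulX i f _ => simp [vecRep_mulX, evalZero_mulX]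

/-! ### The contravariant form -/

/-- A bilinear form for which the Dunkl operators are adjoint to the multiplications. -/
structure IsContravariant (β : LinearMap.BilinForm ℝ V)
    (C : LinearMap.BilinForm ℝ (Poly ⊗[ℝ] V)) : Prop where
  symm : ∀ f g, C f g = C g f
  inv : ∀ w f g, C (vecRep τ w f) (vecRep τ w g) = C f g
  adj : ∀ i f g, C (mulX V i f) g = C f (dunkl τ κ i g)
  extend : ∀ u u', C (const V u) (const V u') = β u u'

variable {τ κ} {β : LinearMap.BilinForm ℝ V}

/-- Reflections are involutions preserving the form, hence self-adjoint. -/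
theorem bracket_adjoint {C : LinearMap.BilinForm ℝ (Poly ⊗[ℝ] V)}
    (inv : ∀ w f g, C (vecRep τ w f) (vecRep τ w g) = C f g) (i j : Fin 3) (f g : Poly ⊗[ℝ] V) :
    C (bracket τ κ i j f) g = C f (bracket τ κ i j g) := by
  have h (a : Fin 15) : C (vecRep τ (reflection a) f) g = C f (vecRep τ (reflection a) g) := by
    have hr : reflection a * reflection a = 1 := by
      apply toMat_injective
      rw [toMat_mul, toMat_reflection, reflMatrix_mul_self, toMat_one]
    rw [← inv (reflection a), ← Module.End.mul_apply, ← map_mul, hr, map_one, Module.End.one_apply]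
  simp only [bracket_apply, map_add, map_smul, map_sum, LinearMap.add_apply, LinearMap.smul_apply,
    LinearMap.sum_apply, h]

theorem exists_isContravariant (hβ : IsInvariantInner τ β) : ∃ C, IsContravariant τ κ β C := by
  -- The form is a map to the dual space in which the transposed Dunkl operators play the role of
  -- the coordinates; they commute because the Dunkl operators do.
  obtain ⟨C, hC0, hC⟩ := exists_vec_hom (N := Module.Dual ℝ (Poly ⊗[ℝ] V))
    (fun i => (dunkl τ κ i).dualMap) (fun i j => by
      refine LinearMap.ext fun φ => LinearMap.ext fun f => ?_
      exact congrArg φ (dunkl_dunkl τ κ j i f)) ((LinearMap.lcomp ℝ ℝ (evalZero V)) ∘ₗ β)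
  replace hC0 (u : V) (g : Poly ⊗[ℝ] V) : C (const V u) g = β u (evalZero V g) := by
    rw [hC0]
    rfl
  replace hC (i : Fin 3) (f g : Poly ⊗[ℝ] V) : C (mulX V i f) g = C f (dunkl τ κ i g) := by
    rw [hC]
    rfl
  have inv (w : H3) (f g : Poly ⊗[ℝ] V) : C (vecRep τ w f) (vecRep τ w g) = C f g := by
    induction f using vec_induction generalizing g with
    | const u => rw [vecRep_const, hC0, hC0, evalZero_vecRep, hβ.inv]
    | add f f' hf hf' => simp only [map_add, LinearMap.add_apply, hf, hf']
    | mulX i f hf =>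
      rw [hC, ← hf, vecRep_dunkl, vecRep_mulX]
      simp only [map_sum, map_smul, LinearMap.sum_apply, LinearMap.smul_apply, hC]
  -- The construction gives adjointness in one slot only; the other slot follows from the symmetric,
  -- self-adjoint bracket and is what makes the form symmetric.
  have adj' (i : Fin 3) (f g : Poly ⊗[ℝ] V) : C (dunkl τ κ i f) g = C f (mulX V i g) := by
    induction f using vec_induction generalizing g with
    | const u => rw [dunkl_const, hC0, evalZero_mulX, map_zero, map_zero, LinearMap.zero_apply]
    | add f f' hf hf' => simp only [map_add, LinearMap.add_apply, hf, hf']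
    | mulX j f hf =>
      rw [dunkl_mulX, map_add, LinearMap.add_apply, hC, hf, hC, dunkl_mulX, map_add,
        bracket_adjoint inv, bracket_symm]
  refine ⟨C, fun f g => ?_, inv, hC, fun u u' => by rw [hC0, evalZero_const]⟩
  induction f using vec_induction generalizing g with
  | const u =>
    induction g using vec_induction with
    | const u' => rw [hC0, hC0, evalZero_const, evalZero_const, hβ.symm]
    | add g g' hg hg' => simp only [map_add, LinearMap.add_apply, hg, hg']
    | mulX i g _ => rw [hC0, evalZero_mulX, hC, dunkl_const, map_zero, map_zero]
  | add f f' hf hf' => simp only [map_add, LinearMap.add_apply, hf, hf']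
  | mulX i f hf => rw [hC, hf, adj']

theorem IsContravariant.adj_dunkl {C : LinearMap.BilinForm ℝ (Poly ⊗[ℝ] V)}
    (hC : IsContravariant τ κ β C) (i : Fin 3) (f g : Poly ⊗[ℝ] V) :
    C (dunkl τ κ i f) g = C f (mulX V i g) := by
  rw [hC.symm, ← hC.adj, hC.symm]

theorem IsContravariant.const_mulX {C : LinearMap.BilinForm ℝ (Poly ⊗[ℝ] V)}
    (hC : IsContravariant τ κ β C) (u : V) (i : Fin 3) (g : Poly ⊗[ℝ] V) :
    C (const V u) (mulX V i g) = 0 := by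
  rw [hC.symm, hC.adj, dunkl_const, map_zero]

theorem IsContravariant.unique {C C' : LinearMap.BilinForm ℝ (Poly ⊗[ℝ] V)}
    (hC : IsContravariant τ κ β C) (hC' : IsContravariant τ κ β C') : C = C' := by
  refine LinearMap.ext₂ fun f g => ?_
  induction f using vec_induction generalizing g with
  | const u =>
    induction g using vec_induction with
    | const u' => rw [hC.extend, hC'.extend]
    | add g g' hg hg' => rw [map_add, map_add, hg, hg']
    | mulX i g _ => rw [hC.const_mulX, hC'.const_mulX]
  | add f f' hf hf' => simp only [map_add, LinearMap.add_apply, hf, hf']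
  | mulX i f hf => rw [hC.adj, hC'.adj, hf]

/-! ### The exponential of the Dunkl Laplacian -/

-- Conjugation by exp(s Σ 𝒟ᵢ² / 2) sends xᵢ to xᵢ + s𝒟ᵢ. These operators commute because the bracket
-- is symmetric, so they define the map without a power series.
variable (τ κ) in
theorem exists_heat (s : ℝ) : ∃ F : Poly ⊗[ℝ] V →ₗ[ℝ] Poly ⊗[ℝ] V,
    (∀ u, F (const V u) = const V u) ∧
      ∀ i f, F (mulX V i f) = mulX V i (F f) + s • dunkl τ κ i (F f) := by
  refine exists_vec_hom (fun i => mulX V i + s • dunkl τ κ i) (fun i j => ?_) (const V)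
  refine LinearMap.ext fun f => ?_
  simp only [Module.End.mul_apply, LinearMap.add_apply, LinearMap.smul_apply, map_add, map_smul,
    dunkl_mulX, mulX_mulX i j, dunkl_dunkl τ κ i j, bracket_symm τ κ i j, smul_add]
  abel

variable (τ κ) in
/-- The exponential of a multiple of the Dunkl Laplacian. -/
def heat (s : ℝ) : Poly ⊗[ℝ] V →ₗ[ℝ] Poly ⊗[ℝ] V := (exists_heat τ κ s).choose

theorem heat_const (s : ℝ) (u : V) : heat τ κ s (const V u) = const V u :=
  (exists_heat τ κ s).choose_spec.1 u

theorem heat_mulX (s : ℝ) (i : Fin 3) (f : Poly ⊗[ℝ] V) :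
    heat τ κ s (mulX V i f) = mulX V i (heat τ κ s f) + s • dunkl τ κ i (heat τ κ s f) :=
  (exists_heat τ κ s).choose_spec.2 i f

theorem heat_vecRep (s : ℝ) (w : H3) (f : Poly ⊗[ℝ] V) :
    heat τ κ s (vecRep τ w f) = vecRep τ w (heat τ κ s f) := by
  induction f using vec_induction with
  | const u => rw [vecRep_const, heat_const, heat_const, vecRep_const]
  | add f g hf hg => simp only [map_add, hf, hg]
  | mulX j f hf =>
    rw [vecRep_mulX, heat_mulX, map_add, map_smul, vecRep_mulX, vecRep_dunkl]
    simp only [map_sum, map_smul, heat_mulX, hf, smul_add, Finset.sum_add_distrib, Finset.smul_sum,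
      smul_comm s]

theorem heat_dunkl (s : ℝ) (i : Fin 3) (f : Poly ⊗[ℝ] V) :
    heat τ κ s (dunkl τ κ i f) = dunkl τ κ i (heat τ κ s f) := by
  induction f using vec_induction with
  | const u => rw [dunkl_const, heat_const, dunkl_const, map_zero]
  | add f g hf hg => simp only [map_add, hf, hg]
  | mulX j f hf =>
    have hb : heat τ κ s (bracket τ κ i j f) = bracket τ κ i j (heat τ κ s f) := by
      simp only [bracket_apply, map_add, map_smul, map_sum, heat_vecRep]
    rw [dunkl_mulX, map_add, hb, heat_mulX, heat_mulX, hf, map_add, map_smul, dunkl_mulX,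
      dunkl_dunkl]
    abel

theorem heat_heat_neg (s : ℝ) (f : Poly ⊗[ℝ] V) : heat τ κ s (heat τ κ (-s) f) = f := by
  induction f using vec_induction with
  | const u => rw [heat_const, heat_const]
  | add f g hf hg => rw [map_add, map_add, hf, hg]
  | mulX j f hf =>
    rw [heat_mulX, map_add, map_smul, heat_dunkl, heat_mulX, hf]
    module

theorem heat_neg_heat (s : ℝ) (f : Poly ⊗[ℝ] V) : heat τ κ (-s) (heat τ κ s f) = f := by
  simpa using heat_heat_neg (τ := τ) (κ := κ) (-s) f

/-! ### The Gaussian form -/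

/-- The operator for s = 1 carries xᵢ - 𝒟ᵢ to xᵢ and commutes with 𝒟ᵢ. -/
theorem IsContravariant.isGaussianForm {C : LinearMap.BilinForm ℝ (Poly ⊗[ℝ] V)}
    (hC : IsContravariant τ κ β C) :
    IsGaussianForm τ κ β (C.compl₁₂ (heat τ κ 1) (heat τ κ 1)) where
  symm f g := hC.symm _ _
  inv w f g := by simp only [LinearMap.compl₁₂_apply, heat_vecRep, hC.inv]
  adj i f g := by
    have h : heat τ κ 1 (mulX V i g - dunkl τ κ i g) = mulX V i (heat τ κ 1 g) := by
      rw [map_sub, heat_mulX, heat_dunkl]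
      module
    rw [LinearMap.compl₁₂_apply, LinearMap.compl₁₂_apply, h, heat_dunkl, hC.adj_dunkl]
  extend u u' := by simp only [LinearMap.compl₁₂_apply, heat_const, hC.extend]

theorem IsGaussianForm.isContravariant
    {B : LinearMap.BilinForm ℝ (Poly ⊗[ℝ] V)} (hB : IsGaussianForm τ κ β B) :
    IsContravariant τ κ β (B.compl₁₂ (heat τ κ (-1)) (heat τ κ (-1))) where
  symm f g := hB.symm _ _
  inv w f g := by simp only [LinearMap.compl₁₂_apply, heat_vecRep, hB.inv]
  adj i f g := by
    have h : heat τ κ (-1) (mulX V i f)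
        = mulX V i (heat τ κ (-1) f) - dunkl τ κ i (heat τ κ (-1) f) := by
      rw [heat_mulX]
      module
    rw [LinearMap.compl₁₂_apply, LinearMap.compl₁₂_apply, h, heat_dunkl, hB.symm, ← hB.adj,
      hB.symm]
  extend u u' := by simp only [LinearMap.compl₁₂_apply, heat_const, hB.extend]

theorem IsGaussianForm.eq_compl {B C : LinearMap.BilinForm ℝ (Poly ⊗[ℝ] V)}
    (hB : IsGaussianForm τ κ β B) (hC : IsContravariant τ κ β C) :
    B = C.compl₁₂ (heat τ κ 1) (heat τ κ 1) := by
  rw [hC.unique hB.isContravariant]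
  refine LinearMap.ext₂ fun f g => ?_
  simp only [LinearMap.compl₁₂_apply, heat_neg_heat]

theorem existsUnique_isGaussianForm (hβ : IsInvariantInner τ β) (κ : ℝ) :
    ∃! B, IsGaussianForm τ κ β B := by
  obtain ⟨C, hC⟩ := exists_isContravariant (κ := κ) hβ
  exact ⟨_, hC.isGaussianForm, fun B hB => hB.eq_compl hC⟩

/-- The two forms differ by a bijective change of variable. -/
theorem mem_positivitySet_iff {C : LinearMap.BilinForm ℝ (Poly ⊗[ℝ] V)}
    (hC : IsContravariant τ κ β C) : κ ∈ positivitySet τ β ↔ ∀ f, f ≠ 0 → 0 < C f f := by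
  constructor
  · rintro ⟨B, hB, hpos⟩ f hf
    have h := hpos (heat τ κ (-1) f) fun h0 => hf (by
      rw [← heat_heat_neg (τ := τ) (κ := κ) 1 f, h0, map_zero])
    rwa [hB.eq_compl hC, LinearMap.compl₁₂_apply, heat_heat_neg] at h
  · refine fun hpos => ⟨_, hC.isGaussianForm, fun f hf => hpos _ fun h0 => hf ?_⟩
    rw [← heat_neg_heat (τ := τ) (κ := κ) 1 f, h0, map_zero]

/-- Averaging over the group. Singular values do not involve a form, but their construction uses
one. -/
theorem exists_isInvariantInner [FiniteDimensional ℝ V] (τ : Representation ℝ H3 V) :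
    ∃ β, IsInvariantInner τ β := by
  let b := Module.finBasis ℝ V
  let β₀ : LinearMap.BilinForm ℝ V :=
    ∑ i, (LinearMap.mul ℝ ℝ).compl₁₂ (b.coord i) (b.coord i)
  have h0 (u u' : V) : β₀ u u' = ∑ i, b.coord i u * b.coord i u' := by simp [β₀]
  have hnn (u : V) : 0 ≤ β₀ u u := by
    rw [h0]
    exact Finset.sum_nonneg fun i _ => mul_self_nonneg _
  have hpos (u : V) (hu : u ≠ 0) : 0 < β₀ u u := by
    refine (hnn u).lt_of_ne fun h => hu ?_
    rw [h0, eq_comm, Finset.sum_eq_zero_iff_of_nonneg fun i _ => mul_self_nonneg _] at h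
    exact b.forall_coord_eq_zero_iff.mp fun i => mul_self_eq_zero.mp (h i (Finset.mem_univ i))
  refine ⟨∑ w, β₀.compl₁₂ (τ w) (τ w), fun u u' => ?_, fun u hu => ?_, fun w u u' => ?_⟩
  · simp only [LinearMap.sum_apply, LinearMap.compl₁₂_apply, h0, mul_comm]
  · simp only [LinearMap.sum_apply, LinearMap.compl₁₂_apply]
    refine Finset.sum_pos' (fun w _ => hnn _) ⟨1, Finset.mem_univ 1, hpos _ ?_⟩
    rwa [map_one]
  · simp only [LinearMap.sum_apply, LinearMap.compl₁₂_apply]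
    rw [← Equiv.sum_comp (Equiv.mulRight w) fun g => β₀ (τ g u) (τ g u')]
    simp [map_mul]

end Forms

end

noncomputable section

/-! ### Positivity and singular values -/

section Positivity

variable {V : Type*} [AddCommGroup V] [Module ℝ V] {τ : Representation ℝ H3 V} {κ : ℝ}
  {β : LinearMap.BilinForm ℝ V} {C : LinearMap.BilinForm ℝ (Poly ⊗[ℝ] V)} {i j : Irrep}

variable (τ) in
/-- The irreducible representation labelled `j` occurs in degree `n`. -/
def Occurs (n : ℕ) (j : Irrep) : Prop :=
  ∃ q ∈ homog V n, q ≠ 0 ∧ isotypicProj j (vecRep τ) q = q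

theorem isotypicProj_idem {X : Type*} [AddCommGroup X] [Module ℝ X] (j : Irrep)
    (ρ : Representation ℝ H3 X) (x : X) :
    isotypicProj j ρ (isotypicProj j ρ x) = isotypicProj j ρ x := by
  rw [isotypicProj_isotypicProj, if_pos rfl]

theorem exists_homog_sum (f : Poly ⊗[ℝ] V) : ∃ (s : Finset ℕ) (F : ℕ → Poly ⊗[ℝ] V),
    (∀ n, F n ∈ homog V n) ∧ (∀ n ∈ s, F n ≠ 0) ∧ f = ∑ n ∈ s, F n := by
  have hmem : f ∈ ⨆ n, homog V n := by
    rw [iSup_homog]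
    trivial
  obtain ⟨F, hF, rfl⟩ := (Submodule.mem_iSup_iff_exists_finsupp _ _).mp hmem
  exact ⟨F.support, F, hF, fun n => Finsupp.mem_support_iff.mp, rfl⟩

theorem occurs_of_ne_zero {n : ℕ} {f : Poly ⊗[ℝ] V} (hf : f ∈ homog V n)
    (h : isotypicProj j (vecRep τ) f ≠ 0) : Occurs τ n j :=
  ⟨isotypicProj j (vecRep τ) f, isotypicProj_mem_homog τ hf j, h, isotypicProj_idem j (vecRep τ) f⟩

theorem exists_isotypicProj_ne_zero (τ : Representation ℝ H3 V) {f : Poly ⊗[ℝ] V}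
    (hf : f ≠ 0) : ∃ j, isotypicProj j (vecRep τ) f ≠ 0 := by
  by_contra! h
  apply hf
  have h1 := LinearMap.congr_fun (sum_isotypicProj (vecRep τ)) f
  rw [LinearMap.sum_apply, Finset.sum_eq_zero fun j _ => h j] at h1
  exact h1.symm

theorem dunkl_homog_zero {f : Poly ⊗[ℝ] V} (hf : f ∈ homog V 0) (a : Fin 3) :
    dunkl τ κ a f = 0 := by
  obtain ⟨u, rfl⟩ := hf
  exact dunkl_const τ κ a u

theorem evalZero_homog {n : ℕ} {f : Poly ⊗[ℝ] V} (hf : f ∈ homog V (n + 1)) :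
    evalZero V f = 0 := by
  have h : homog V (n + 1) ≤ LinearMap.ker (evalZero V) := by
    refine iSup_le fun a => ?_
    rintro _ ⟨g, _, rfl⟩
    exact evalZero_mulX a g
  exact h hf

theorem IsContravariant.homog_orthogonal (hC : IsContravariant τ κ β C) {m n : ℕ}
    {f g : Poly ⊗[ℝ] V} (hf : f ∈ homog V m) (hg : g ∈ homog V n) (hmn : m ≠ n) : C f g = 0 := by
  induction hf using homog_induction generalizing n g with
  | const u =>
    have h : homog V n ≤ LinearMap.ker (C (const V u)) := by
      cases n with
      | zero => exact absurd rfl hmn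
      | succ n =>
        refine iSup_le fun a => ?_
        rintro _ ⟨g, _, rfl⟩
        exact hC.const_mulX u a g
    exact h hg
  | add m f f' _ _ hf hf' => rw [map_add, LinearMap.add_apply, hf hg hmn, hf' hg hmn, add_zero]
  | mulX m a f _ hf =>
    rw [hC.adj]
    cases n with
    | zero => rw [dunkl_homog_zero hg, map_zero]
    | succ n => exact hf (dunkl_mem_homog τ κ hg a) fun h => hmn (congrArg _ h)

theorem IsContravariant.isotypicProj_adjoint (hC : IsContravariant τ κ β C) (j : Irrep)
    (f g : Poly ⊗[ℝ] V) :
    C (isotypicProj j (vecRep τ) f) g = C f (isotypicProj j (vecRep τ) g) := by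
  have h (w : H3) : C (vecRep τ w f) g = C f (vecRep τ w⁻¹ g) := by
    rw [← hC.inv w f, ← Module.End.mul_apply, ← map_mul, mul_inv_cancel, map_one,
      Module.End.one_apply]
  simp only [isotypicProj_apply, map_sum, map_smul, LinearMap.sum_apply, LinearMap.smul_apply, h]
  rw [← Equiv.sum_comp (Equiv.inv H3)]
  simp [classOf_inv]

theorem IsContravariant.sum_isotypicProj (hC : IsContravariant τ κ β C) (f : Poly ⊗[ℝ] V) :
    C f f = ∑ j, C (isotypicProj j (vecRep τ) f) (isotypicProj j (vecRep τ) f) := by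
  simp only [hC.isotypicProj_adjoint, isotypicProj_idem]
  rw [← map_sum, ← LinearMap.sum_apply, Icosahedral.sum_isotypicProj, Module.End.one_apply]

theorem homog_le_eigenspace (τ : Representation ℝ H3 V) (n : ℕ) :
    homog V n ≤ Module.End.eigenspace (euler τ 0) (n : ℝ) :=
  fun _ hf => Module.End.mem_eigenspace_iff.mpr (euler_zero_homog τ hf)

theorem iSupIndep_homog (τ : Representation ℝ H3 V) : iSupIndep (homog V) :=
  ((Module.End.eigenspaces_iSupIndep (euler τ 0)).comp Nat.cast_injective).mono
    (homog_le_eigenspace τ)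

theorem notMem_range_const {n : ℕ} {q : Poly ⊗[ℝ] V}
    (hq : q ∈ homog V (n + 1)) (hq0 : q ≠ 0) : q ∉ LinearMap.range (const V) := by
  rintro ⟨u, rfl⟩
  have h := evalZero_homog hq
  rw [evalZero_const] at h
  exact hq0 (by rw [h, map_zero])

variable [FiniteDimensional ℝ V]

theorem sum_mulX_dunkl (hτ : HasCharacter τ i) (κ : ℝ) {n : ℕ} {q : Poly ⊗[ℝ] V}
    (hq : q ∈ homog V n) (hj : isotypicProj j (vecRep τ) q = q) :
    ∑ a, mulX V a (dunkl τ κ a q) = (n + κ * (i.content - j.content)) • q := by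
  have h1 := euler_homog τ κ hτ.reflSum_eq hq
  have h2 := reflSum_isotypicProj (vecRep τ) j q
  rw [hj, reflSum_apply] at h2
  rw [euler_apply, h2] at h1
  rw [eq_sub_of_add_eq h1]
  module

/-- The Euler identity paired with `q`, each xₐ moved to the other side as 𝒟ₐ. -/
theorem IsContravariant.smul_apply_self (hC : IsContravariant τ κ β C) (hτ : HasCharacter τ i)
    {n : ℕ} {q : Poly ⊗[ℝ] V} (hq : q ∈ homog V n) (hj : isotypicProj j (vecRep τ) q = q) :
    (n + κ * (i.content - j.content)) * C q q
      = ∑ a, C (dunkl τ κ a q) (dunkl τ κ a q) := by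
  have h := congrArg (fun f => C f q) (sum_mulX_dunkl hτ κ hq hj)
  simp only [map_sum, map_smul, LinearMap.sum_apply, LinearMap.smul_apply, smul_eq_mul,
    hC.adj] at h
  exact h.symm

/-- Induction on the degree: distinct isotypes are orthogonal, and on each of them a positive
multiple of C(q, q) is a sum of values of the form one degree lower. -/
theorem IsContravariant.pos_homog (hC : IsContravariant τ κ β C) (hβ : IsInvariantInner τ β)
    (hτ : HasCharacter τ i) (n : ℕ)
    (h : ∀ m < n, ∀ j, Occurs τ (m + 1) j → 0 < m + 1 + κ * (i.content - j.content))
    {f : Poly ⊗[ℝ] V} (hf : f ∈ homog V n) (hf0 : f ≠ 0) : 0 < C f f := by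
  induction n generalizing f with
  | zero =>
    obtain ⟨u, rfl⟩ := hf
    rw [hC.extend]
    exact hβ.pos u fun h0 => hf0 (by rw [h0, map_zero])
  | succ n ih =>
    have ih' {g : Poly ⊗[ℝ] V} (hg : g ∈ homog V n) (hg0 : g ≠ 0) : 0 < C g g :=
      ih (fun m hm => h m (hm.trans n.lt_succ_self)) hg hg0
    have hnn {g : Poly ⊗[ℝ] V} (hg : g ∈ homog V n) : 0 ≤ C g g := by
      by_cases hg0 : g = 0
      · simp [hg0]
      · exact (ih' hg hg0).le
    have key (j : Irrep) {q : Poly ⊗[ℝ] V} (hq : q ∈ homog V (n + 1)) (hq0 : q ≠ 0)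
        (hj : isotypicProj j (vecRep τ) q = q) : 0 < C q q := by
      have hpos := h n n.lt_succ_self j ⟨q, hq, hq0, hj⟩
      have h1 := hC.smul_apply_self hτ hq hj
      push_cast at h1
      refine pos_of_mul_pos_right (h1 ▸ ?_) hpos.le
      -- If every 𝒟ₐ killed `q`, the Euler identity would make a positive multiple of `q` vanish.
      have hex : ∃ a, dunkl τ κ a q ≠ 0 := by
        by_contra! h0
        have h2 := sum_mulX_dunkl hτ κ hq hj
        simp only [h0, map_zero, Finset.sum_const_zero] at h2
        push_cast at h2
        exact (smul_ne_zero hpos.ne' hq0) h2.symm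
      obtain ⟨a, ha⟩ := hex
      exact Finset.sum_pos' (fun a _ => hnn (dunkl_mem_homog τ κ hq a))
        ⟨a, Finset.mem_univ a, ih' (dunkl_mem_homog τ κ hq a) ha⟩
    have key' (j : Irrep) (h0 : isotypicProj j (vecRep τ) f ≠ 0) :
        0 < C (isotypicProj j (vecRep τ) f) (isotypicProj j (vecRep τ) f) :=
      key j (isotypicProj_mem_homog τ hf j) h0
        (isotypicProj_idem j (vecRep τ) f)
    rw [hC.sum_isotypicProj]
    obtain ⟨j, hj⟩ := exists_isotypicProj_ne_zero τ hf0
    refine Finset.sum_pos' (fun j _ => ?_) ⟨j, Finset.mem_univ j, key' j hj⟩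
    by_cases h0 : isotypicProj j (vecRep τ) f = 0
    · simp [h0]
    · exact (key' j h0).le

theorem mem_positivitySet (hβ : IsInvariantInner τ β) (hτ : HasCharacter τ i)
    (h : ∀ m j, Occurs τ (m + 1) j → 0 < m + 1 + κ * (i.content - j.content)) :
    κ ∈ positivitySet τ β := by
  obtain ⟨C, hC⟩ := exists_isContravariant (κ := κ) hβ
  rw [mem_positivitySet_iff hC]
  intro f hf
  obtain ⟨s, F, hF, hs, rfl⟩ := exists_homog_sum f
  have hpos (n : ℕ) (h0 : F n ≠ 0) : 0 < C (F n) (F n) :=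
    hC.pos_homog hβ hτ n (fun m _ => h m) (hF n) h0
  have hsum : C (∑ n ∈ s, F n) (∑ n ∈ s, F n) = ∑ n ∈ s, C (F n) (F n) := by
    simp only [map_sum, LinearMap.sum_apply]
    refine Finset.sum_congr rfl fun n hn => Finset.sum_eq_single_of_mem n hn fun m _ hm => ?_
    exact hC.homog_orthogonal (hF m) (hF n) hm
  rw [hsum]
  refine Finset.sum_pos (fun n hn => hpos n (hs n hn)) ?_
  rw [Finset.nonempty_iff_ne_empty]
  rintro rfl
  exact hf Finset.sum_empty

/-- For a positive definite form, a nonpositive scalar forces every 𝒟ₐ q to vanish. Then `q` is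
orthogonal to all products with a coordinate, hence to itself. -/
theorem notMem_positivitySet (hβ : IsInvariantInner τ β) (hτ : HasCharacter τ i) {n : ℕ}
    (ho : Occurs τ (n + 1) j) (h : n + 1 + κ * (i.content - j.content) ≤ 0) :
    κ ∉ positivitySet τ β := by
  obtain ⟨C, hC⟩ := exists_isContravariant (κ := κ) hβ
  rw [mem_positivitySet_iff hC]
  intro hpos
  obtain ⟨q, hq, hq0, hj⟩ := ho
  have hnn (g : Poly ⊗[ℝ] V) : 0 ≤ C g g := by
    by_cases hg0 : g = 0
    · simp [hg0]
    · exact (hpos g hg0).le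
  have h1 := hC.smul_apply_self hτ hq hj
  push_cast at h1
  have h2 : ∑ a, C (dunkl τ κ a q) (dunkl τ κ a q) = 0 :=
    le_antisymm (h1 ▸ mul_nonpos_of_nonpos_of_nonneg h (hnn q)) (Finset.sum_nonneg fun a _ => hnn _)
  rw [Finset.sum_eq_zero_iff_of_nonneg fun a _ => hnn _] at h2
  have h3 (a : Fin 3) : dunkl τ κ a q = 0 := by
    by_contra h0
    exact (hpos _ h0).ne' (h2 a (Finset.mem_univ a))
  have h4 : homog V (n + 1) ≤ LinearMap.ker (C.flip q) := by
    refine iSup_le fun a => ?_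
    rintro _ ⟨g, _, rfl⟩
    change C (mulX V a g) q = 0
    rw [hC.adj, h3, map_zero]
  exact (hpos q hq0).ne' (h4 hq)

/-- The scalar 0 makes the sum of the C(𝒟ₐ p, 𝒟ₐ p) vanish, and the form is already definite one
degree lower. Passing from `q` to `p` only ensures that a single copy of the isotype is spanned. -/
theorem exists_isSingularPoly (hτ : HasCharacter τ i) {n : ℕ} (ho : Occurs τ (n + 1) j)
    (h0 : n + 1 + κ * (i.content - j.content) = 0)
    (h : ∀ m < n, ∀ j, Occurs τ (m + 1) j → 0 < m + 1 + κ * (i.content - j.content)) :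
    ∃ p, IsSingularPoly τ κ p ∧ HasIsotype τ p j := by
  obtain ⟨β, hβ⟩ := exists_isInvariantInner τ
  obtain ⟨C, hC⟩ := exists_isContravariant (κ := κ) hβ
  obtain ⟨q, hq, hq0, hj⟩ := ho
  obtain ⟨p, hp, hp0, hpj⟩ := exists_hasCharacter_orbitSpan hj hq0
  have hpn : p ∈ homog V (n + 1) := by
    have := orbitSpan_le (ρ := vecRep τ) (U := ⟨homog V (n + 1), fun w f hf =>
      vecRep_mem_homog τ hf w⟩) hq
    exact this hp
  have h1 := hC.smul_apply_self hτ hpn (isotypicProj_orbitSpan hj hp)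
  push_cast at h1
  rw [h0, zero_mul] at h1
  have hpos {g : Poly ⊗[ℝ] V} (hg : g ∈ homog V n) (hg0 : g ≠ 0) : 0 < C g g :=
    hC.pos_homog hβ hτ n h hg hg0
  have hmem (a : Fin 3) : dunkl τ κ a p ∈ homog V n := dunkl_mem_homog τ κ hpn a
  rw [eq_comm, Finset.sum_eq_zero_iff_of_nonneg fun a _ => ?_] at h1
  · refine ⟨p, ⟨notMem_range_const hpn hp0, fun a => ?_⟩, hpj⟩
    by_contra hne
    exact (hpos (hmem a) hne).ne' (h1 a (Finset.mem_univ a))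
  · by_cases hg0 : dunkl τ κ a p = 0
    · simp [hg0]
    · exact (hpos (hmem a) hg0).le

theorem IsSingularValue.exists_occurs (hτ : HasCharacter τ i) (hs : IsSingularValue τ κ) :
    ∃ n j, Occurs τ (n + 1) j ∧ n + 1 + κ * (i.content - j.content) = 0 := by
  obtain ⟨p, hp, hD⟩ := hs
  obtain ⟨s, F, hF, hs, rfl⟩ := exists_homog_sum p
  have hex : ∃ n, n + 1 ∈ s := by
    by_contra! h0
    apply hp
    refine Submodule.sum_mem _ fun n hn => ?_
    cases n with
    | zero => exact hF 0
    | succ n => exact absurd hn (h0 n)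
  obtain ⟨n, hn⟩ := hex
  obtain ⟨j, hj⟩ := exists_isotypicProj_ne_zero τ (hs _ hn)
  refine ⟨n, j, occurs_of_ne_zero (hF (n + 1)) hj, ?_⟩
  obtain ⟨G, hGF⟩ : ∃ G : ℕ → Poly ⊗[ℝ] V, ∀ n, G n = isotypicProj j (vecRep τ) (F n) :=
    ⟨_, fun _ => rfl⟩
  have hG (n : ℕ) : G n ∈ homog V n := by
    rw [hGF]
    exact isotypicProj_mem_homog τ (hF n) j
  have hGj (n : ℕ) : isotypicProj j (vecRep τ) (G n) = G n := by
    rw [hGF, isotypicProj_idem]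
  -- The common kernel of the Dunkl operators is stable under the group, hence under the isotypic
  -- projection.
  have hker : ∀ a, dunkl τ κ a (∑ m ∈ s, G m) = 0 := by
    intro a
    have h1 (w : H3) : dunkl τ κ a (vecRep τ w (∑ m ∈ s, F m)) = 0 := by
      have h2 (b : Fin 3) := congrArg (vecRep τ w) (hD b)
      simp only [vecRep_dunkl, map_zero] at h2
      -- Orthogonality of the matrix inverts the equivariance relation for the Dunkl operators.
      have h3 : dunkl τ κ a (vecRep τ w (∑ m ∈ s, F m))
          = ∑ b, toMat w a b • ∑ c, toMat w c b •
            dunkl τ κ c (vecRep τ w (∑ m ∈ s, F m)) := by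
        have h4 (c : Fin 3) : ∑ b, toMat w a b * toMat w c b
            = (1 : Matrix (Fin 3) (Fin 3) ℝ) a c :=
          congrFun (congrFun (toMat_mul_transpose w) a) c
        simp only [Finset.smul_sum, smul_smul]
        rw [Finset.sum_comm]
        simp only [← Finset.sum_smul, h4, Matrix.one_apply, ite_smul, one_smul, zero_smul,
          Finset.sum_ite_eq, Finset.mem_univ, if_true]
      rw [h3]
      simp only [h2, smul_zero, Finset.sum_const_zero]
    have h5 : ∑ m ∈ s, G m = isotypicProj j (vecRep τ) (∑ m ∈ s, F m) := by
      simp only [hGF, map_sum]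
    rw [h5, isotypicProj_apply]
    generalize ∑ m ∈ s, F m = p at h1
    simp only [map_sum, map_smul, h1, smul_zero, Finset.sum_const_zero]
  -- Summing the Euler identities over the degrees; independence of the degrees then isolates the
  -- term of degree `n + 1`.
  have hsum : ∑ m ∈ s, (m + κ * (i.content - j.content)) • G m = 0 := by
    have h1 (m : ℕ) := sum_mulX_dunkl hτ κ (hG m) (hGj m)
    simp only [← h1]
    rw [Finset.sum_comm]
    simp only [← map_sum, hker, map_zero, Finset.sum_const_zero]
  have h1 := (iSupIndep_iff_finsetSum_eq_zero_imp_eq_zero _).mp (iSupIndep_homog τ) s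
    (fun m => (m + κ * (i.content - j.content)) • G m)
    (fun m _ => Submodule.smul_mem _ _ (hG m)) hsum (n + 1) (hn)
  have h2 := (smul_eq_zero.mp h1).resolve_right (by rwa [hGF])
  exact_mod_cast h2

end Positivity

end

noncomputable section

/-! ### The irreducible representations that occur in a given degree -/

section Occurrence

universe u

variable {V : Type u} [AddCommGroup V] [Module ℝ V] {τ : Representation ℝ H3 V} {i j : Irrep}

/-- Degree `n` is a quotient of the n-th tensor power of the natural representation times `V`.
Overcounting symmetric powers is harmless, as only the absence of isotypes is deduced. -/
theorem exists_rep_homog [FiniteDimensional ℝ V] (τ : Representation ℝ H3 V) (n : ℕ) :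
    ∃ (Y : Type u) (_ : AddCommGroup Y) (_ : Module ℝ Y) (_ : FiniteDimensional ℝ Y)
      (σ : Representation ℝ H3 Y) (F : Y →ₗ[ℝ] Poly ⊗[ℝ] V),
      (∀ w y, F (σ w y) = vecRep τ w (F y)) ∧ homog V n ≤ LinearMap.range F ∧
        ∀ w, σ.character w = natRep.character w ^ n * τ.character w := by
  induction n with
  | zero => exact ⟨V, _, _, inferInstance, τ, const V, fun w u => (vecRep_const τ w u).symm,
      le_rfl, fun w => by rw [pow_zero, one_mul]⟩
  | succ n ih =>
    obtain ⟨Y, _, _, _, σ, F, hF, hr, hσ⟩ := ih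
    let A : (Fin 3 → ℝ) →ₗ[ℝ] Y →ₗ[ℝ] Poly ⊗[ℝ] V :=
      ∑ a, (LinearMap.proj a).smulRight (mulX V a ∘ₗ F)
    have hA (x : Fin 3 → ℝ) (y : Y) : A x y = ∑ a, x a • mulX V a (F y) := by
      simp [A, LinearMap.sum_apply]
    refine ⟨(Fin 3 → ℝ) ⊗[ℝ] Y, inferInstance, inferInstance, inferInstance, natRep.tprod σ,
      TensorProduct.lift A, fun w y => ?_, ?_, fun w => ?_⟩
    · induction y using TensorProduct.induction_on with
      | zero => simp
      | add y z hy hz => simp only [map_add, hy, hz]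
      | tmul x y =>
        change A (natRep w x) (σ w y) = vecRep τ w (A x y)
        simp only [hA, hF, natRep_apply, map_sum, map_smul, vecRep_mulX, Finset.smul_sum, smul_smul,
          Matrix.mulVec, dotProduct, Finset.sum_smul]
        rw [Finset.sum_comm]
        simp only [mul_comm]
    · refine iSup_le fun a => ?_
      rintro _ ⟨f, hf, rfl⟩
      obtain ⟨y, rfl⟩ := hr hf
      refine ⟨Pi.single a 1 ⊗ₜ y, ?_⟩
      change A (Pi.single a 1) y = _
      simp [hA, Pi.single_apply]
    · rw [Representation.char_tensor, Pi.mul_apply, hσ, pow_succ']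
      ring

/-- The sum of the values of `χⱼ χ₃ⁿ χᵢ` over the golden integers. -/
def tensorMult (i j : Irrep) (n : ℕ) : GoldInt :=
  ∑ s, (classSize s : GoldInt) * (j.chiZ s * (Irrep.chiZ .τ₃ s ^ n * i.chiZ s))

theorem tensorMult_ne_zero [FiniteDimensional ℝ V] (hτ : HasCharacter τ i) {n : ℕ}
    (h : Occurs τ n j) : tensorMult i j n ≠ 0 := by
  intro h0
  obtain ⟨q, hq, hq0, hj⟩ := h
  obtain ⟨Y, _, _, _, σ, F, hF, hr, hσ⟩ := exists_rep_homog τ n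
  obtain ⟨y, rfl⟩ := hr hq
  have hE : isotypicProj j σ = 0 := by
    apply isotypicProj_eq_zero
    have h3 (w : H3) : natRep.character w = Irrep.chi .τ₃ (classOf w) :=
      (Matrix.trace_toLin'_eq _).trans (trace_toMat w)
    simp only [hσ, h3, hasCharacter_iff.mp hτ]
    rw [sum_classOf fun s => j.chi s * (Irrep.chi .τ₃ s ^ n * i.chi s)]
    have h1 := congrArg goldHom h0
    simpa only [tensorMult, map_sum, map_mul, map_pow, map_natCast, goldHom_chiZ, map_zero] using h1
  have h1 := map_isotypicProj F hF j y
  rw [hE, LinearMap.zero_apply, map_zero] at h1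
  exact hq0 (hj.symm.trans h1.symm)

/-- The sum of the values of `χᵢ χⱼ` weighted by powers of a doubled matrix entry. -/
def powerMult (i j : Irrep) (n : ℕ) : GoldInt :=
  ∑ k, ∑ s, ∑ m, i.chiZ (classZ (elemZ k s m)) * j.chiZ (classZ (elemZ k s m))
    * elemZ k s m 0 0 ^ n

theorem X_pow_tmul_mem_homog (n : ℕ) (u : V) : (X 0 ^ n : Poly) ⊗ₜ[ℝ] u ∈ homog V n := by
  induction n with
  | zero => exact ⟨u, by rw [pow_zero]; rfl⟩
  | succ n ih =>
    have h := mulX_mem_homog ih 0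
    rwa [mulX, TensorProduct.map_tmul, LinearMap.mulLeft_apply, LinearMap.id_apply, ← pow_succ'] at h

/-- If `j` were absent, its projection would kill x₀ⁿ ⊗ u for every u. Evaluation at the first basis
vector turns the translates of x₀ⁿ into powers of the corner entry, and a trace over `V` gives the
weighted character sum. -/
theorem occurs_of_powerMult [FiniteDimensional ℝ V] (hτ : HasCharacter τ i) {n : ℕ}
    (h : powerMult i j n ≠ 0) : Occurs τ n j := by
  by_contra ho
  have h0 (u : V) : isotypicProj j (vecRep τ) ((X 0 ^ n : Poly) ⊗ₜ[ℝ] u) = 0 := by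
    have hu := X_pow_tmul_mem_homog n u
    generalize (X 0 ^ n : Poly) ⊗ₜ[ℝ] u = f at hu ⊢
    by_contra hne
    exact ho (occurs_of_ne_zero hu hne)
  let b := Module.finBasis ℝ V
  let e : Poly →ₗ[ℝ] ℝ := (aeval (Pi.single 0 1 : Fin 3 → ℝ)).toLinearMap
  have he (w : H3) : e (subst (toMat w) (X 0 ^ n)) = toMat w 0 0 ^ n := by
    simp [e, subst, Pi.single_apply]
  let L (a) : Poly ⊗[ℝ] V →ₗ[ℝ] ℝ := TensorProduct.lift ((LinearMap.mul ℝ ℝ).compl₁₂ e (b.coord a))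
  have hL (a) (p : Poly) (v : V) : L a (p ⊗ₜ v) = e p * b.coord a v := rfl
  have htr (w : H3) : ∑ a, b.coord a (τ w (b a)) = i.chi (classOf w) := by
    rw [← hasCharacter_iff.mp hτ, Representation.character, LinearMap.trace_eq_matrix_trace ℝ b]
    simp [Matrix.trace, LinearMap.toMatrix_apply]
  have h1 : ∑ a, L a (isotypicProj j (vecRep τ) ((X 0 ^ n : Poly) ⊗ₜ[ℝ] b a)) = 0 := by
    simp only [h0, map_zero, Finset.sum_const_zero]
  simp only [isotypicProj_apply, vecRep_tmul, map_sum, map_smul, hL, he, smul_eq_mul] at h1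
  rw [Finset.sum_comm] at h1
  simp only [← Finset.mul_sum, htr, div_mul_eq_mul_div, mul_assoc, ← Finset.sum_div] at h1
  have h2 : ∑ w, j.chi (classOf w) * (toMat w 0 0 ^ n * i.chi (classOf w)) = 0 := by
    rcases div_eq_zero_iff.mp h1 with h1 | h1
    · exact (mul_eq_zero.mp h1).resolve_left (chi_zero_pos j).ne'
    · norm_num at h1
  apply h
  apply goldHom_injective
  have h3 := congrArg goldHom
    (sum_H3 fun s x => i.chiZ s * j.chiZ s * x ^ n)
  rw [powerMult, ← h3, map_zero]
  simp only [map_sum, map_mul, map_pow, goldHom_chiZ, goldHom_doubleMat, mul_pow]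
  -- The power of 2 accounts for the doubled matrix entry.
  rw [← mul_zero ((2 : ℝ) ^ n), ← h2, Finset.mul_sum]
  exact Finset.sum_congr rfl fun w _ => by ring

end Occurrence

/-! ### Bounds for the smallest singular values -/

/-- The contents as integers. -/
def Irrep.contentZ : Irrep → ℤ
  | .τ₁ => 15 | .τ₂ => -15 | .τ₃ => 5 | .τ₄ => -5 | .τ₅ => 5
  | .τ₆ => -5 | .τ₇ => 0 | .τ₈ => 0 | .τ₉ => 3 | .τ₁₀ => -3

theorem Irrep.cast_contentZ (i : Irrep) : (i.contentZ : ℝ) = i.content := by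
  rw [Irrep.content, eq_div_iff (chi_zero_pos i).ne', ← goldHom_chiZ, ← goldHom_chiZ]
  have h : ∀ i : Irrep, (i.contentZ : GoldInt) * i.chiZ 0 = 15 * i.chiZ 2 := by decide +kernel
  simpa only [map_mul, map_intCast, map_ofNat] using congrArg goldHom (h i)

/-- The representation labelled `j` occurs in degree `n + 1` for the value `b / a`, and the
representations that occur in smaller degrees satisfy the bounds that this value requires. -/
def IsExtremal (i j : Irrep) (n : ℕ) (a b : ℤ) : Prop :=
  0 < a ∧ powerMult i j (n + 1) ≠ 0 ∧ a * (n + 1) + b * (i.contentZ - j.contentZ) = 0 ∧ n < 3 ∧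
    -- This covers all degrees from 4 on at once, without knowing what occurs there; `m + 1` below
    -- runs through the degrees 1, 2, 3.
    (∀ j' : Irrep, 0 ≤ a * 4 + b * (i.contentZ - j'.contentZ)) ∧
    ∀ (m : Fin 3) (j' : Irrep), tensorMult i j' (m + 1) = 0 ∨
      0 ≤ a * (m + 1) + b * (i.contentZ - j'.contentZ) ∧
        (m < n → 0 < a * (m + 1) + b * (i.contentZ - j'.contentZ))

instance (i j : Irrep) (n : ℕ) (a b : ℤ) : Decidable (IsExtremal i j n a b) := by
  delta IsExtremal
  infer_instance

section Bounds

variable {V : Type*} [AddCommGroup V] [Module ℝ V] [FiniteDimensional ℝ V]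
  {τ : Representation ℝ H3 V} {i j j' : Irrep} {n n' : ℕ} {a b a' b' : ℤ}

theorem IsExtremal.occurs (h : IsExtremal i j n a b) (hτ : HasCharacter τ i) :
    Occurs τ (n + 1) j := occurs_of_powerMult hτ h.2.1

theorem IsExtremal.eq_zero (h : IsExtremal i j n a b) :
    n + 1 + (b / a : ℝ) * (i.content - j.content) = 0 := by
  have ha : (a : ℝ) ≠ 0 := by exact_mod_cast h.1.ne'
  have h1 := congrArg (Int.cast : ℤ → ℝ) h.2.2.1
  push_cast [Irrep.cast_contentZ] at h1
  field_simp
  linear_combination h1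

theorem IsExtremal.nonneg_and_pos (h : IsExtremal i j n a b) (hτ : HasCharacter τ i) (m : ℕ)
    (k : Irrep) (ho : Occurs τ (m + 1) k) : 0 ≤ m + 1 + (b / a : ℝ) * (i.content - k.content) ∧
      (m < n → 0 < m + 1 + (b / a : ℝ) * (i.content - k.content)) := by
  obtain ⟨ha, -, -, hn, h4, h3⟩ := h
  have ha' : (0 : ℝ) < a := by exact_mod_cast ha
  have key : 0 ≤ a * (m + 1) + b * (i.contentZ - k.contentZ) ∧
      (m < n → 0 < a * (m + 1) + b * (i.contentZ - k.contentZ)) := by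
    by_cases hm : m < 3
    · exact (h3 ⟨m, hm⟩ k).resolve_left (tensorMult_ne_zero hτ ho)
    · refine ⟨?_, fun hmn => absurd (hmn.trans hn) hm⟩
      have h1 := h4 k
      have h2 : a * 4 ≤ a * (m + 1) := by
        apply mul_le_mul_of_nonneg_left _ ha.le
        omega
      linarith
  have heq : m + 1 + (b / a : ℝ) * (i.content - k.content)
      = ((a * (m + 1) + b * (i.contentZ - k.contentZ) : ℤ) : ℝ) / a := by
    push_cast [Irrep.cast_contentZ]
    field_simp
  rw [heq]
  exact ⟨div_nonneg (by exact_mod_cast key.1) ha'.le,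
    fun hmn => div_pos (by exact_mod_cast key.2 hmn) ha'⟩

/-- The quantities that decide about positivity are positive for the parameter `κ`. -/
def IsRegular (τ : Representation ℝ H3 V) (i : Irrep) (κ : ℝ) : Prop :=
  ∀ m j, Occurs τ (m + 1) j → 0 < m + 1 + κ * (i.content - j.content)

theorem IsRegular.not_isSingularValue {κ : ℝ} (h : IsRegular τ i κ) (hτ : HasCharacter τ i) :
    ¬ IsSingularValue τ κ := by
  intro hs
  obtain ⟨m, k, ho, h0⟩ := hs.exists_occurs hτ
  exact (h m k ho).ne' h0

/-- An affine function of κ that is positive at 0 and nonnegative at `b / a` is positive in between.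
-/
theorem IsExtremal.isRegular_of_neg (h : IsExtremal i j n a b) (hτ : HasCharacter τ i) {κ : ℝ}
    (hκ : (b / a : ℝ) < κ) (hκ0 : κ ≤ 0) : IsRegular τ i κ := by
  intro m k ho
  have h1 := (h.nonneg_and_pos hτ m k ho).1
  rcases le_or_gt (i.content - k.content) 0 with hc | hc
  · have := mul_nonneg_of_nonpos_of_nonpos hκ0 hc
    positivity
  · have := mul_lt_mul_of_pos_right hκ hc
    linarith

theorem IsExtremal.isRegular_of_pos (h : IsExtremal i j n a b) (hτ : HasCharacter τ i) {κ : ℝ}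
    (hκ : κ < (b / a : ℝ)) (hκ0 : 0 ≤ κ) : IsRegular τ i κ := by
  intro m k ho
  have h1 := (h.nonneg_and_pos hτ m k ho).1
  rcases lt_or_ge (i.content - k.content) 0 with hc | hc
  · have := mul_lt_mul_of_neg_right hκ hc
    linarith
  · have := mul_nonneg hκ0 hc
    positivity

theorem IsExtremal.exists_isSingularPoly (h : IsExtremal i j n a b) (hτ : HasCharacter τ i) :
    ∃ p, IsSingularPoly τ (b / a : ℝ) p ∧ HasIsotype τ p j :=
  Icosahedral.exists_isSingularPoly hτ (h.occurs hτ) h.eq_zero fun m hm k ho =>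
    (h.nonneg_and_pos hτ m k ho).2 hm

theorem IsExtremal.isSmallestNegative (h : IsExtremal i j n a b) (hτ : HasCharacter τ i)
    (hb : (b / a : ℝ) < 0) : IsSmallestNegative τ (b / a : ℝ) j := by
  obtain ⟨p, hp, hpj⟩ := h.exists_isSingularPoly hτ
  refine ⟨⟨⟨hb, p, hp⟩, fun κ hκ => ?_⟩, p, hp, hpj⟩
  by_contra! hlt
  exact (h.isRegular_of_neg hτ hlt hκ.1.le).not_isSingularValue hτ hκ.2

theorem IsExtremal.isSmallestPositive (h : IsExtremal i j n a b) (hτ : HasCharacter τ i)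
    (hb : 0 < (b / a : ℝ)) : IsSmallestPositive τ (b / a : ℝ) j := by
  obtain ⟨p, hp, hpj⟩ := h.exists_isSingularPoly hτ
  refine ⟨⟨⟨hb, p, hp⟩, fun κ hκ => ?_⟩, p, hp, hpj⟩
  by_contra! hlt
  exact (h.isRegular_of_pos hτ hlt hκ.1.le).not_isSingularValue hτ hκ.2

/-- The extremal affine function vanishes at `b / a` and stays nonpositive beyond it. -/
theorem IsExtremal.lt_of_mem (h : IsExtremal i j n a b) (hτ : HasCharacter τ i)
    (hb : (b / a : ℝ) < 0) {β : LinearMap.BilinForm ℝ V} (hβ : IsInvariantInner τ β) {κ : ℝ}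
    (hκ : κ ∈ positivitySet τ β) : (b / a : ℝ) < κ := by
  by_contra! hle
  refine notMem_positivitySet hβ hτ (h.occurs hτ) ?_ hκ
  have h0 := h.eq_zero
  have hc : 0 ≤ i.content - j.content := by
    by_contra! hc
    have := mul_pos_of_neg_of_neg hb hc
    linarith
  linarith [mul_le_mul_of_nonneg_right hle hc]

theorem IsExtremal.gt_of_mem (h : IsExtremal i j n a b) (hτ : HasCharacter τ i)
    (hb : 0 < (b / a : ℝ)) {β : LinearMap.BilinForm ℝ V} (hβ : IsInvariantInner τ β) {κ : ℝ}
    (hκ : κ ∈ positivitySet τ β) : κ < (b / a : ℝ) := by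
  by_contra! hle
  refine notMem_positivitySet hβ hτ (h.occurs hτ) ?_ hκ
  have h0 := h.eq_zero
  have hc : i.content - j.content ≤ 0 := by
    by_contra! hc
    have := mul_pos hb hc
    linarith
  linarith [mul_le_mul_of_nonpos_right hle hc]

theorem IsExtremal.bounded (h : IsExtremal i j n a b) (h' : IsExtremal i j' n' a' b')
    (hτ : HasCharacter τ i) {k k' : ℝ} (hk : k = b / a) (hk' : k' = b' / a') (hk0 : k < 0)
    (hk0' : 0 < k') : IsSmallestNegative τ k j ∧ IsSmallestPositive τ k' j' ∧
      HasPositivitySet τ (Set.Ioo k k') := by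
  subst hk hk'
  refine ⟨h.isSmallestNegative hτ hk0, h'.isSmallestPositive hτ hk0', fun β hβ => ?_⟩
  refine Set.Subset.antisymm (fun κ hκ => ⟨h.lt_of_mem hτ hk0 hβ hκ, h'.gt_of_mem hτ hk0' hβ hκ⟩) ?_
  rintro κ ⟨h1, h2⟩
  rcases le_total κ 0 with h0 | h0
  · exact mem_positivitySet hβ hτ (h.isRegular_of_neg hτ h1 h0)
  · exact mem_positivitySet hβ hτ (h'.isRegular_of_pos hτ h2 h0)

/-- With the largest content no scalar can decrease as κ grows. -/
theorem IsExtremal.unbounded_above (h : IsExtremal i j n a b) (hi : ∀ k : Irrep, k.content ≤ i.content)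
    (hτ : HasCharacter τ i) {k : ℝ} (hk : k = b / a) (hk0 : k < 0) : IsSmallestNegative τ k j ∧
      (∀ κ > 0, ¬ IsSingularValue τ κ) ∧ HasPositivitySet τ (Set.Ioi k) := by
  subst hk
  have hreg {κ : ℝ} (hκ : 0 ≤ κ) : IsRegular τ i κ := fun m k _ => by
    have := mul_nonneg hκ (sub_nonneg.mpr (hi k))
    positivity
  refine ⟨h.isSmallestNegative hτ hk0, fun κ hκ => (hreg hκ.le).not_isSingularValue hτ,
    fun β hβ => Set.Subset.antisymm (fun κ hκ => h.lt_of_mem hτ hk0 hβ hκ) fun κ h1 => ?_⟩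
  rcases le_total κ 0 with h0 | h0
  · exact mem_positivitySet hβ hτ (h.isRegular_of_neg hτ h1 h0)
  · exact mem_positivitySet hβ hτ (hreg h0)

theorem IsExtremal.unbounded_below (h : IsExtremal i j n a b) (hi : ∀ k : Irrep, i.content ≤ k.content)
    (hτ : HasCharacter τ i) {k : ℝ} (hk : k = b / a) (hk0 : 0 < k) :
    (∀ κ < 0, ¬ IsSingularValue τ κ) ∧ IsSmallestPositive τ k j ∧
      HasPositivitySet τ (Set.Iio k) := by
  subst hk
  have hreg {κ : ℝ} (hκ : κ ≤ 0) : IsRegular τ i κ := fun m k _ => by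
    have := mul_nonneg_of_nonpos_of_nonpos hκ (sub_nonpos.mpr (hi k))
    positivity
  refine ⟨fun κ hκ => (hreg hκ.le).not_isSingularValue hτ, h.isSmallestPositive hτ hk0,
    fun β hβ => Set.Subset.antisymm (fun κ hκ => h.gt_of_mem hτ hk0 hβ hκ) fun κ h1 => ?_⟩
  rcases le_total κ 0 with h0 | h0
  · exact mem_positivitySet hβ hτ (hreg h0)
  · exact mem_positivitySet hβ hτ (h.isRegular_of_pos hτ h1 h0)

end Bounds

end

/-! ### The table of smallest singular values -/

theorem contentZ_bounds : ∀ k : Irrep, -15 ≤ k.contentZ ∧ k.contentZ ≤ 15 := by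
  decide +kernel

theorem content_le (k : Irrep) : k.content ≤ Irrep.content .τ₁ := by
  rw [← Irrep.cast_contentZ, ← Irrep.cast_contentZ]
  exact_mod_cast (contentZ_bounds k).2

theorem le_content (k : Irrep) : Irrep.content .τ₂ ≤ k.content := by
  rw [← Irrep.cast_contentZ, ← Irrep.cast_contentZ]
  exact_mod_cast (contentZ_bounds k).1

/-- The smallest singular values of the ten representations. -/
theorem isExtremal_table :
    IsExtremal .τ₁ .τ₃ 0 10 (-1) ∧
    IsExtremal .τ₂ .τ₄ 0 10 1 ∧
    IsExtremal .τ₃ .τ₄ 0 10 (-1) ∧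
    IsExtremal .τ₃ .τ₁ 0 10 1 ∧
    IsExtremal .τ₄ .τ₂ 0 10 (-1) ∧
    IsExtremal .τ₄ .τ₃ 0 10 1 ∧
    -- The asymmetry for τ₅: the zero of 1 + κ(5 - 0), from τ₇ in degree 1, is -1/5, whereas the
    -- zero of 3 + κ(5 - 15), from τ₁ in degree 3, is 3/10. The third argument is the degree minus
    -- one.
    IsExtremal .τ₅ .τ₇ 0 5 (-1) ∧
    IsExtremal .τ₅ .τ₁ 2 10 3 ∧
    IsExtremal .τ₆ .τ₂ 2 10 (-3) ∧
    IsExtremal .τ₆ .τ₈ 0 5 1 ∧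
    IsExtremal .τ₇ .τ₂ 2 5 (-1) ∧
    IsExtremal .τ₇ .τ₅ 0 5 1 ∧
    IsExtremal .τ₈ .τ₆ 0 5 (-1) ∧
    IsExtremal .τ₈ .τ₁ 2 5 1 ∧
    IsExtremal .τ₉ .τ₁₀ 0 6 (-1) ∧
    IsExtremal .τ₉ .τ₁ 1 6 1 ∧
    IsExtremal .τ₁₀ .τ₂ 1 6 (-1) ∧
    IsExtremal .τ₁₀ .τ₉ 0 6 1 := by
  decide +kernel

end Icosahedral

theorem mainTheorem1 :
    -- each of the ten characters is the character of an irreducible representation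
    (∀ i : Irrep, ∃ (n : ℕ) (τ : Representation ℝ H3 (Fin n → ℝ)),
      τ.IsIrreducible ∧ HasCharacter τ i) ∧
    ∀ (V : Type*) [AddCommGroup V] [Module ℝ V] [FiniteDimensional ℝ V]
      (τ : Representation ℝ H3 V), τ.IsIrreducible →
      -- every irreducible representation is exactly one of the ten
      (∃! i : Irrep, HasCharacter τ i) ∧
      -- the Gaussian form exists and is unique up to the choice of the inner product on `V`
      (∀ β, IsInvariantInner τ β → ∀ κ : ℝ, ∃! B, IsGaussianForm τ κ β B) ∧
      -- the smallest singular values and the positivity intervals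
      (HasCharacter τ .τ₁ → IsSmallestNegative τ (-1 / 10) .τ₃ ∧
        (∀ κ > 0, ¬ IsSingularValue τ κ) ∧ HasPositivitySet τ (Set.Ioi (-1 / 10))) ∧
      (HasCharacter τ .τ₂ → (∀ κ < 0, ¬ IsSingularValue τ κ) ∧
        IsSmallestPositive τ (1 / 10) .τ₄ ∧ HasPositivitySet τ (Set.Iio (1 / 10))) ∧
      (HasCharacter τ .τ₃ → IsSmallestNegative τ (-1 / 10) .τ₄ ∧
        IsSmallestPositive τ (1 / 10) .τ₁ ∧ HasPositivitySet τ (Set.Ioo (-1 / 10) (1 / 10))) ∧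
      (HasCharacter τ .τ₄ → IsSmallestNegative τ (-1 / 10) .τ₂ ∧
        IsSmallestPositive τ (1 / 10) .τ₃ ∧ HasPositivitySet τ (Set.Ioo (-1 / 10) (1 / 10))) ∧
      (HasCharacter τ .τ₅ → IsSmallestNegative τ (-1 / 5) .τ₇ ∧
        IsSmallestPositive τ (3 / 10) .τ₁ ∧ HasPositivitySet τ (Set.Ioo (-1 / 5) (3 / 10))) ∧
      (HasCharacter τ .τ₆ → IsSmallestNegative τ (-3 / 10) .τ₂ ∧
        IsSmallestPositive τ (1 / 5) .τ₈ ∧ HasPositivitySet τ (Set.Ioo (-3 / 10) (1 / 5))) ∧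
      (HasCharacter τ .τ₇ → IsSmallestNegative τ (-1 / 5) .τ₂ ∧
        IsSmallestPositive τ (1 / 5) .τ₅ ∧ HasPositivitySet τ (Set.Ioo (-1 / 5) (1 / 5))) ∧
      (HasCharacter τ .τ₈ → IsSmallestNegative τ (-1 / 5) .τ₆ ∧
        IsSmallestPositive τ (1 / 5) .τ₁ ∧ HasPositivitySet τ (Set.Ioo (-1 / 5) (1 / 5))) ∧
      (HasCharacter τ .τ₉ → IsSmallestNegative τ (-1 / 6) .τ₁₀ ∧
        IsSmallestPositive τ (1 / 6) .τ₁ ∧ HasPositivitySet τ (Set.Ioo (-1 / 6) (1 / 6))) ∧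
      (HasCharacter τ .τ₁₀ → IsSmallestNegative τ (-1 / 6) .τ₂ ∧
        IsSmallestPositive τ (1 / 6) .τ₉ ∧ HasPositivitySet τ (Set.Ioo (-1 / 6) (1 / 6))) := by
  obtain ⟨h1, h2, h3n, h3p, h4n, h4p, h5n, h5p, h6n, h6p, h7n, h7p, h8n, h8p, h9n, h9p, h10n,
    h10p⟩ := isExtremal_table
  refine ⟨fun i => ?_, fun V _ _ _ τ hτ => ⟨?_, fun β hβ κ => existsUnique_isGaussianForm hβ κ,
    fun h => h1.unbounded_above content_le h ?_ ?_,
    fun h => h2.unbounded_below le_content h ?_ ?_,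
    fun h => h3n.bounded h3p h ?_ ?_ ?_ ?_,
    fun h => h4n.bounded h4p h ?_ ?_ ?_ ?_,
    fun h => h5n.bounded h5p h ?_ ?_ ?_ ?_,
    fun h => h6n.bounded h6p h ?_ ?_ ?_ ?_,
    fun h => h7n.bounded h7p h ?_ ?_ ?_ ?_,
    fun h => h8n.bounded h8p h ?_ ?_ ?_ ?_,
    fun h => h9n.bounded h9p h ?_ ?_ ?_ ?_,
    fun h => h10n.bounded h10p h ?_ ?_ ?_ ?_⟩⟩
  · obtain ⟨n, τ, h⟩ := exists_representation i
    exact ⟨n, τ, h.isIrreducible, h⟩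
  · obtain ⟨i, h⟩ := exists_hasCharacter hτ
    exact ⟨i, h, fun _ h' => h'.unique h⟩
  all_goals norm_num
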